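/- Let $d\ge 1$, let $|\cdot|$ be the $1$-norm on $\mathbb{Z}^d$, and for an integer $L\ge1$ put $\Lambda_L=[-L,L]^d\cap\mathbb{Z}^d$. Let masses $m_x$, spring constants $k_x$ ($x\in\mathbb{Z}^d$) and couplings $\lambda_{x,y}=\lambda_{y,x}$ ($|x-y|=1$) be real random variables on a probability space $(\Omega,\mathbb{P})$ such that, for deterministic constants $m_{\min},m_{\max},k_{\max},\lambda_{\max}$ with $m_{\min}>0$, almost surely $m_{\min}\le m_x\le m_{\max}$, $0\le k_x\le k_{\max}$ and $0\le\lambda_{x,y}\le\lambda_{\max}$ for all $x$ and all nearest neighbors $x,y$. Let $h_{0,L}$ be the real symmetric matrix on $\ell^2(\Lambda_L)$ with diagonal entries $\frac{k_x}{2}+\sum_{u\in\Lambda_L,\,|u-x|=1}\lambda_{x,u}$, with entries $-\lambda_{x,y}$ if $|x-y|=1$, and with all other entries $0$. Assume that for every $L\ge1$ the matrix $h_{0,L}$ is almost surely positive definite, and let $h_L=\mu^{1/2}h_{0,L}\mu^{1/2}$, where $\mu$ is the diagonal matrix with entries $\frac1{2m_x}$. Let $$H_L=\sum_{x\in\Lambda_L}\Big(\frac{1}{2m_x}p_x^2+\frac{k_x}{2}q_x^2\Big)+\sum_{\{x,y\}\subset\Lambda_L,\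 |x-y|=1}\lambda_{x,y}(q_x-q_y)^2,\qquad p_x=-i\frac{\partial}{\partial q_x},$$ be the self-adjoint operator on $L^2(\mathbb{R}^{\Lambda_L})$ obtained as the closure from the Schwartz functions. For $f:\Lambda_L\to\mathbb{C}$ let $W(f)=\exp\big[i\sum_x(\mathrm{Re}f(x)\,q_x+\mathrm{Im}f(x)\,p_x)\big]$ be the Weyl operator; for bounded $A$ let $\tau_t(A)=e^{itH_L}Ae^{-itH_L}$ and, for $\beta\in(0,\infty)$, $\langle A\rangle_\beta=\mathrm{Tr}[Ae^{-\beta H_L}]/\mathrm{Tr}[e^{-\beta H_L}]$. Put $$C_\beta(f,g;t)=\langle\tau_t(W(f))W(g)\rangle_\beta-\langle W(f)\rangle_\beta\langle W(g)\rangle_\beta .$$ Fix $\beta\in(0,\infty)$ and $r\in(0,1]$, and suppose that $h_L$ has exponentially decaying $(-1,r)$-eigenfunction correlators: there are $C<\infty$ and $\eta>0$ such that $$\mathbb{E}\Big(\sup_{u:\mathbb{R}\to\mathbb{C},\ |u|\le1}\big|\langle\delta_x,h_L^{-1}u(h_L)\delta_y\rangle\big|^r\Big)\le Ce^{-\eta|x-y|}$$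 for all $L\ge1$ and all $x,y\in\Lambda_L$. Then there exist $C'<\infty$ and $\mu'>0$ such that for all $L\ge1$ and all $f,g:\Lambda_L\to\mathbb{C}$ $$\mathbb{E}\Big(\sup_{t\in\mathbb{R}}|C_\beta(f,g;t)|\Big)\le C'\sum_{x,y\in\Lambda_L}|f(x)|^r|g(y)|^re^{-\mu'|x-y|}.$$ -/

import Mathlib

open MeasureTheory Filter Topology
open scoped ENNReal SchwartzMap LineDeriv

noncomputable section

namespace HarmonicOscillators

/-! ### Operators on a Hilbert space -/

section Hilbert

variable {E : Type} [NormedAddCommGroup E] [InnerProductSpace ℂ E] [CompleteSpace E]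

/-- `U` is a strongly continuous one-parameter unitary group whose infinitesimal generator
extends `i A`. If `A` is self-adjoint, then by Stone's theorem there is exactly one such group,
namely `U t = e^{itA}`. -/
structure IsUnitaryGroup (A : E →ₗ.[ℂ] E) (U : ℝ → E →L[ℂ] E) : Prop where
  zero : U 0 = 1
  add : ∀ s t, U (s + t) = U s * U t
  mem_unitary : ∀ t, U t ∈ unitary (E →L[ℂ] E)
  continuous : ∀ ψ, Continuous fun t => U t ψ
  hasDerivAt : ∀ ψ : A.domain, HasDerivAt (fun t => U t (ψ : E)) (Complex.I • A ψ) 0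

/-- The unitary group `t ↦ e^{itA}` of a self-adjoint operator `A`. -/
def expI (A : E →ₗ.[ℂ] E) : ℝ → E →L[ℂ] E :=
  Classical.epsilon (IsUnitaryGroup A)

/-- `T` is (on `[0, ∞)`) a strongly continuous semigroup of bounded self-adjoint operators whose
infinitesimal generator extends `-A`. If `A` is self-adjoint and bounded below, then exactly one
semigroup on `[0, ∞)` has these properties, namely `T s = e^{-sA}`. -/
structure IsHeatSemigroup (A : E →ₗ.[ℂ] E) (T : ℝ → E →L[ℂ] E) : Prop where
  zero : T 0 = 1
  add : ∀ s t, 0 ≤ s → 0 ≤ t → T (s + t) = T s * T t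
  isSelfAdjoint : ∀ s, 0 ≤ s → IsSelfAdjoint (T s)
  continuousOn : ∀ ψ, ContinuousOn (fun s => T s ψ) (Set.Ici 0)
  hasDerivWithinAt : ∀ ψ : A.domain,
    HasDerivWithinAt (fun s => T s (ψ : E)) (-(A ψ)) (Set.Ici 0) 0

/-- The semigroup `s ↦ e^{-sA}`, `s ≥ 0`, of a self-adjoint operator `A` bounded below. -/
def expNeg (A : E →ₗ.[ℂ] E) : ℝ → E →L[ℂ] E :=
  Classical.epsilon (IsHeatSemigroup A)

/-- `X` has trace `c`: in every orthonormal basis the sum of the diagonal matrix elements of `X`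
converges unconditionally, with value `c`. The bounded operators that have a trace in this sense
are exactly the trace class operators. -/
def HasTrace (X : E →L[ℂ] E) (c : ℂ) : Prop :=
  ∀ (ι : Type) (b : HilbertBasis ι ℂ E), HasSum (fun i => inner ℂ (b i) (X (b i))) c

/-- The trace of a trace class operator. -/
def trace (X : E →L[ℂ] E) : ℂ :=
  Classical.epsilon (HasTrace X)

end Hilbert

/-! ### The lattice, the parameters and the one-particle operator -/

/-- The `1`-distance `|x - y|` on `ℤ^d`. -/
def dist₁ {d : ℕ} (x y : Fin d → ℤ) : ℤ :=
  ∑ i, |x i - y i|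

theorem dist₁_comm {d : ℕ} (x y : Fin d → ℤ) : dist₁ x y = dist₁ y x := by
  simp only [dist₁, abs_sub_comm]

/-- The cube `Λ_L = [-L, L]^d ∩ ℤ^d`. -/
def box (d L : ℕ) : Finset (Fin d → ℤ) :=
  Finset.Icc (fun _ => -(L : ℤ)) (fun _ => (L : ℤ))

/-- The masses `m_x`, the spring constants `k_x`, and the couplings `λ_{x,y}` of undirected
pairs (of which only the nearest neighbor pairs are used). -/
structure Params (d : ℕ) where
  m : (Fin d → ℤ) → ℝ
  k : (Fin d → ℤ) → ℝ
  lam : Sym2 (Fin d → ℤ) → ℝ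

/-- The uniform bounds on the parameters. -/
structure Params.Bounded {d : ℕ} (p : Params d) (mmin mmax kmax lmax : ℝ) : Prop where
  m_mem : ∀ x, p.m x ∈ Set.Icc mmin mmax
  k_mem : ∀ x, p.k x ∈ Set.Icc 0 kmax
  lam_mem : ∀ x y, dist₁ x y = 1 → p.lam s(x, y) ∈ Set.Icc 0 lmax

/-- The matrix `h_{0,L}` of the potential energy. -/
def h₀ {d : ℕ} (p : Params d) (L : ℕ) : Matrix (box d L) (box d L) ℝ :=
  Matrix.of fun x y =>
    if x = y then p.k x / 2 + ∑ u : box d L, if dist₁ (u : Fin d → ℤ) x = 1 then p.lam s(↑x, ↑u) else 0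
    else if dist₁ (x : Fin d → ℤ) y = 1 then -p.lam s(↑x, ↑y)
    else 0

/-- The diagonal matrix `μ^{1/2}`, where `μ_{x,x} = 1 / (2 m_x)`. -/
def sqrtMu {d : ℕ} (p : Params d) (L : ℕ) : Matrix (box d L) (box d L) ℝ :=
  Matrix.diagonal fun x => √(1 / (2 * p.m x))

/-- The one-particle operator `h_L = μ^{1/2} h_{0,L} μ^{1/2}`. -/
def hOne {d : ℕ} (p : Params d) (L : ℕ) : Matrix (box d L) (box d L) ℝ :=
  sqrtMu p L * h₀ p L * sqrtMu p L

theorem h₀_isHermitian {d : ℕ} (p : Params d) (L : ℕ) : (h₀ p L).IsHermitian := by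
  refine Matrix.IsHermitian.ext fun x y => ?_
  by_cases hxy : x = y
  · subst hxy
    simp
  · simp [h₀, hxy, Ne.symm hxy, dist₁_comm (y : Fin d → ℤ) x, Sym2.eq_swap (a := (y : Fin d → ℤ))]

theorem hOne_isHermitian {d : ℕ} (p : Params d) (L : ℕ) : (hOne p L).IsHermitian := by
  have h1 : (sqrtMu p L).conjTranspose = sqrtMu p L := by
    simp [sqrtMu]
  have h2 := Matrix.isHermitian_mul_mul_conjTranspose (sqrtMu p L) (h₀_isHermitian p L)
  rwa [h1] at h2

/-- The matrix element `⟨δ_x, F(A) δ_y⟩` of a function `F : ℝ → ℂ` of a real symmetric matrix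
`A = O diag(e_k) Oᵀ`, that is, `∑ k, O_{x,k} F(e_k) O_{y,k}`. -/
def funElem {n : Type} [Fintype n] [DecidableEq n] {A : Matrix n n ℝ} (hA : A.IsHermitian)
    (F : ℝ → ℂ) (x y : n) : ℂ :=
  ∑ k, ((hA.eigenvectorUnitary : Matrix n n ℝ) x k : ℂ) * F (hA.eigenvalues k) *
    ((hA.eigenvectorUnitary : Matrix n n ℝ) y k : ℂ)

/-- Exponentially decaying `(α, r)`-eigenfunction correlators of `h_L`, for random parameters `p`;
the supremum is over all functions `u : ℝ → ℂ` with `|u| ≤ 1`. -/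
def ExpDecayCorrelators {d : ℕ} {Ω : Type*} [MeasurableSpace Ω] (P : Measure Ω)
    (p : Ω → Params d) (α r : ℝ) : Prop :=
  ∃ C μ : ℝ, 0 < μ ∧ ∀ L : ℕ, 1 ≤ L → ∀ x y : box d L,
    ∫⁻ ω, ⨆ (u : ℝ → ℂ) (_ : ∀ s, ‖u s‖ ≤ 1),
        ‖funElem (hOne_isHermitian (p ω) L) (fun s => ((s ^ α : ℝ) : ℂ) * u s) x y‖ₑ ^ r ∂P
      ≤ ENNReal.ofReal (C * Real.exp (-μ * dist₁ (x : Fin d → ℤ) y))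

/-! ### The many-body system on `L²(ℝ^{Λ_L})` -/

/-- The configuration space `ℝ^{Λ_L}`. -/
abbrev Config (d L : ℕ) : Type := EuclideanSpace ℝ (box d L)

/-- The Hilbert space `L²(ℝ^{Λ_L})`. -/
abbrev HSpace (d L : ℕ) : Type := Lp ℂ 2 (volume : Measure (Config d L))

/-- The inclusion of the Schwartz functions into `L²(ℝ^{Λ_L})`. -/
def incl (d L : ℕ) : 𝓢(Config d L, ℂ) →ₗ[ℂ] HSpace d L :=
  (SchwartzMap.toLpCLM ℂ (E := Config d L) ℂ 2 volume).toLinearMap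

theorem incl_injective (d L : ℕ) : Function.Injective (incl d L) :=
  SchwartzMap.injective_toLp 2 volume

/-- An operator on the Schwartz space, seen as an unbounded operator in `L²(ℝ^{Λ_L})` whose domain
consists of the Schwartz functions. -/
def onSchwartz {d L : ℕ} (T : 𝓢(Config d L, ℂ) →ₗ[ℂ] 𝓢(Config d L, ℂ)) :
    HSpace d L →ₗ.[ℂ] HSpace d L where
  domain := LinearMap.range (incl d L)
  toFun := incl d L ∘ₗ T ∘ₗ (LinearEquiv.ofInjective (incl d L) (incl_injective d L)).symm.toLinearMap

/-- The position operator `q_x` on Schwartz functions. -/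
def posOp {d L : ℕ} (x : box d L) : 𝓢(Config d L, ℂ) →ₗ[ℂ] 𝓢(Config d L, ℂ) :=
  (SchwartzMap.smulLeftCLM ℂ fun q : Config d L => ((q x : ℝ) : ℂ)).toLinearMap

theorem posOp_apply {d L : ℕ} (x : box d L) (ψ : 𝓢(Config d L, ℂ)) (q : Config d L) :
    posOp x ψ q = (q x : ℂ) * ψ q := by
  have hq : (fun q : Config d L => ((q x : ℝ) : ℂ)).HasTemperateGrowth :=
    (Complex.ofRealCLM.comp (EuclideanSpace.proj (𝕜 := ℝ) x)).hasTemperateGrowth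
  simp [posOp, SchwartzMap.smulLeftCLM_apply_apply hq]

/-- The momentum operator `p_x = -i ∂/∂q_x` on Schwartz functions. -/
def momOp {d L : ℕ} (x : box d L) : 𝓢(Config d L, ℂ) →ₗ[ℂ] 𝓢(Config d L, ℂ) :=
  -Complex.I • (LineDeriv.lineDerivOpCLM ℂ 𝓢(Config d L, ℂ)
    (EuclideanSpace.single x (1 : ℝ))).toLinearMap

theorem momOp_apply {d L : ℕ} (x : box d L) (ψ : 𝓢(Config d L, ℂ)) (q : Config d L) :
    momOp x ψ q = -Complex.I * lineDeriv ℝ ψ q (EuclideanSpace.single x 1) := by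
  simp [momOp, SchwartzMap.lineDerivOp_apply]

/-- The differential expression of the harmonic Hamiltonian,
`∑_x (p_x² / (2 m_x) + k_x q_x² / 2) + ∑_{{x,y}, |x-y|=1} λ_{x,y} (q_x - q_y)²`; the sum over
undirected edges is half the sum over ordered pairs. -/
def hamSchwartz {d : ℕ} (p : Params d) (L : ℕ) : 𝓢(Config d L, ℂ) →ₗ[ℂ] 𝓢(Config d L, ℂ) :=
  (∑ x : box d L, (((1 / (2 * p.m x) : ℝ) : ℂ) • (momOp x ∘ₗ momOp x) +
      ((p.k x / 2 : ℝ) : ℂ) • (posOp x ∘ₗ posOp x))) +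
    (1 / 2 : ℂ) • ∑ x : box d L, ∑ y : box d L,
      if dist₁ (x : Fin d → ℤ) y = 1 then
        ((p.lam s(↑x, ↑y) : ℝ) : ℂ) • ((posOp x - posOp y) ∘ₗ (posOp x - posOp y))
      else 0

/-- The Hamiltonian `H_L`, the closure of the differential operator on Schwartz functions. -/
def ham {d : ℕ} (p : Params d) (L : ℕ) : HSpace d L →ₗ.[ℂ] HSpace d L :=
  (onSchwartz (hamSchwartz p L)).closure

/-- The closure of `∑_x (Re f(x) q_x + Im f(x) p_x)`. -/
def field {d L : ℕ} (f : box d L → ℂ) : HSpace d L →ₗ.[ℂ] HSpace d L :=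
  (onSchwartz (∑ x : box d L,
    (((f x).re : ℂ) • posOp x + ((f x).im : ℂ) • momOp x))).closure

/-- The Weyl operator `W(f) = exp[i ∑_x (Re f(x) q_x + Im f(x) p_x)]`. -/
def weyl {d L : ℕ} (f : box d L → ℂ) : HSpace d L →L[ℂ] HSpace d L :=
  expI (field f) 1

/-- The Heisenberg evolution `τ_t(X) = e^{itH_L} X e^{-itH_L}`. -/
def heisenberg {d : ℕ} (p : Params d) (L : ℕ) (t : ℝ) (X : HSpace d L →L[ℂ] HSpace d L) :
    HSpace d L →L[ℂ] HSpace d L :=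
  expI (ham p L) t * X * expI (ham p L) (-t)

/-- The thermal expectation `⟨X⟩_β = Tr[X e^{-βH_L}] / Tr[e^{-βH_L}]`. -/
def thermal {d : ℕ} (p : Params d) (L : ℕ) (β : ℝ) (X : HSpace d L →L[ℂ] HSpace d L) : ℂ :=
  trace (X * expNeg (ham p L) β) / trace (expNeg (ham p L) β)

/-- The thermal correlation
`C_β(f,g;t) = ⟨τ_t(W(f)) W(g)⟩_β - ⟨W(f)⟩_β ⟨W(g)⟩_β`. -/
def thermalCorr {d : ℕ} (p : Params d) (L : ℕ) (β : ℝ) (f g : box d L → ℂ) (t : ℝ) : ℂ :=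
  thermal p L β (heisenberg p L t (weyl f) * weyl g) -
    thermal p L β (weyl f) * thermal p L β (weyl g)

end HarmonicOscillators

end

noncomputable section

set_option linter.unusedSectionVars false

namespace HarmonicOscillators

/-! ### Operators diagonal in a Hilbert basis: unitary group, heat semigroup, trace -/

section Diagonal

variable {E : Type} [NormedAddCommGroup E] [InnerProductSpace ℂ E] [CompleteSpace E]
variable {ι : Type}

/-! The system is a finite set of coupled oscillators, so everything reduces to functions of the
matrix `h_L`. Diagonalize `h_L = O diag(γₖ²) Oᵀ`. In the normal modes `H_L = ∑ₖ γₖ (2 cₖ aₖ + 1)`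
with ladder operators `aₖ, cₖ` (`hamSchwartz_eq`), so the products of creation operators applied to
the Gaussian ground state form an eigenbasis with energies `∑ₖ γₖ (2 αₖ + 1)`. A field operator
becomes `∑ₖ (conj ζₖ aₖ + ζₖ cₖ)`. Time evolution multiplies `ζₖ` by `exp(2itγₖ)`
(`evolution_weyl`). The thermal expectation of a Weyl operator is the Gaussian `exp(-N(ζ)/2)` with
`N(ζ) = ∑ₖ |ζₖ|² coth(βγₖ)` (`weylSum_eq`), which follows from an ordinary differential equation in
the Weyl parameter whose right side is computed by the KMS relations.

Combined with the Weyl relation this gives `C_β(f,g;t) = exp(-(N(f)+N(g))/2) (exp(-z(t)) - 1)`,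
where `z(t)` is the thermal two-point function of the evolved `f` with `g` (`thermalCorr_eq`).
Positivity of the covariance, `N(f)+N(g)+2 Re z ≥ 0`, says that the prefactor beats the growth of
`exp(-z)`, hence `|C_β| ≤ min(2, |z|) ≤ 2|z|^r` (`norm_thermalCorr_le`).

Finally `z(t)` is a finite sum of coefficients bounded by a constant times `|f(x)||g(y)|`, times
matrix elements `⟨δ_x, F(h_L) δ_y⟩` for three functions `F` (`twoPoint_eq`). Since `γ coth(βγ) ≤ γ +
1/β` and the spectrum of `h_L` is bounded uniformly in `L`, each `F(s)` is at most a constant times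
`1/s` there, uniformly in `t` (`mul_norm_kernel_le`). So `F(h_L) = K h_L⁻¹ u(h_L)` with `|u| ≤ 1`,
the correlator controls the supremum over `t` inside the expectation, and subadditivity of `x ↦ x^r`
finishes the bound with the decay rate of the hypothesis.

The analytic work lies in linking the operators defined through their generators to these formulas.
Eigenvectors, or invariance of the Schwartz space, pin down the groups and semigroups. Completeness
of the eigenbasis comes from the injectivity of the Fourier transform. -/

theorem hasSum_norm_sq_inner (b : HilbertBasis ι ℂ E) (x : E) :
    HasSum (fun i => ‖inner ℂ (b i) x‖ ^ 2) (‖x‖ ^ 2) := by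
  have h := b.hasSum_inner_mul_inner x x
  have h2 := Complex.hasSum_re h
  simp only [← RCLike.re_eq_complex_re, inner_self_eq_norm_sq] at h2
  refine h2.congr_fun ?_
  intro i
  rw [← inner_conj_symm x (b i), mul_comm, RCLike.mul_conj]
  norm_cast

theorem eq_of_forall_inner_eq (b : HilbertBasis ι ℂ E) {x y : E}
    (h : ∀ i, inner ℂ (b i) x = inner ℂ (b i) y) : x = y := by
  have h1 := hasSum_norm_sq_inner b (x - y)
  have h2 : (fun i => ‖inner ℂ (b i) (x - y)‖ ^ 2) = fun _ => 0 := by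
    funext i
    simp [h i]
  rw [h2] at h1
  have h3 := h1.unique hasSum_zero
  exact sub_eq_zero.1 (norm_eq_zero.1 (by simpa using h3))

/-- Coordinatewise convergence with a square summable bound implies convergence in norm. -/
theorem tendsto_of_tendsto_inner {X : Type*} {l : Filter X} (b : HilbertBasis ι ℂ E) {f : X → E}
    {x : E} {g : ι → ℝ} (hg : Summable fun i => g i ^ 2)
    (hb : ∀ᶠ n in l, ∀ i, ‖inner ℂ (b i) (f n) - inner ℂ (b i) x‖ ≤ g i)
    (h : ∀ i, Tendsto (fun n => inner ℂ (b i) (f n)) l (𝓝 (inner ℂ (b i) x))) :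
    Tendsto f l (𝓝 x) := by
  rw [tendsto_iff_norm_sub_tendsto_zero]
  have h1 : Tendsto (fun n => ∑' i, ‖inner ℂ (b i) (f n - x)‖ ^ 2) l (𝓝 (∑' _ : ι, (0 : ℝ))) := by
    refine tendsto_tsum_of_dominated_convergence hg (fun i => ?_) ?_
    · have := ((h i).sub_const (inner ℂ (b i) x)).norm.pow 2
      simpa [inner_sub_right] using this
    · filter_upwards [hb] with n hn i
      rw [Real.norm_of_nonneg (by positivity), inner_sub_right]
      gcongr
      exact hn i
  simp only [(hasSum_norm_sq_inner b _).tsum_eq, tsum_zero] at h1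
  have h2 := (Real.continuous_sqrt.tendsto 0).comp h1
  simpa [Function.comp_def, Real.sqrt_sq] using h2

theorem exists_diagonal (b : HilbertBasis ι ℂ E) {c : ι → ℂ} {M : ℝ} (hM : ∀ i, ‖c i‖ ≤ M) :
    ∃ T : E →L[ℂ] E, ∀ ψ i, inner ℂ (b i) (T ψ) = c i * inner ℂ (b i) ψ := by
  have hmem : ∀ ψ : E, Memℓp (fun i => c i * b.repr ψ i) 2 := fun ψ => by
    refine memℓp_gen ?_
    simp only [ENNReal.toReal_ofNat, Real.rpow_two]
    refine Summable.of_nonneg_of_le (fun i => by positivity) (fun i => ?_)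
      (((hasSum_norm_sq_inner b ψ).summable).mul_left (M ^ 2))
    rw [norm_mul, mul_pow, b.repr_apply_apply]
    gcongr
    exact hM i
  let T₀ : E →ₗ[ℂ] E :=
    { toFun := fun ψ => b.repr.symm ⟨fun i => c i * b.repr ψ i, hmem ψ⟩
      map_add' := fun ψ φ => by
        rw [← map_add]
        congr 1
        ext i
        simp only [map_add, lp.coeFn_add, Pi.add_apply, mul_add]
      map_smul' := fun a ψ => by
        rw [RingHom.id_apply, ← map_smul]
        congr 1
        ext i
        simp [mul_left_comm] }
  have hT₀ : ∀ ψ i, inner ℂ (b i) (T₀ ψ) = c i * inner ℂ (b i) ψ := fun ψ i => by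
    rw [← b.repr_apply_apply, ← b.repr_apply_apply]
    simp [T₀]
  refine ⟨T₀.mkContinuous M fun ψ => ?_, fun ψ i => hT₀ ψ i⟩
  -- An index is what forces `0 ≤ M`; without one the space is zero and the bound is trivial.
  by_cases hE : Nonempty ι
  · have hM0 : 0 ≤ M := (norm_nonneg _).trans (hM hE.some)
    refine le_of_sq_le_sq ?_ (by positivity)
    rw [mul_pow]
    refine hasSum_le (fun i => ?_) (hasSum_norm_sq_inner b (T₀ ψ))
      ((hasSum_norm_sq_inner b ψ).mul_left (M ^ 2))
    rw [hT₀, norm_mul, mul_pow]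
    gcongr
    exact hM i
  · have : T₀ ψ = 0 := eq_of_forall_inner_eq b fun i => (hE ⟨i⟩).elim
    have h2 : ψ = 0 := eq_of_forall_inner_eq b fun i => (hE ⟨i⟩).elim
    rw [this, h2]
    simp

/-- The operator that multiplies the `i`-th coordinate by `c i`. -/
def diagOp (b : HilbertBasis ι ℂ E) (c : ι → ℂ) : E →L[ℂ] E :=
  Classical.epsilon fun T => ∀ ψ i, inner ℂ (b i) (T ψ) = c i * inner ℂ (b i) ψ

theorem inner_diagOp (b : HilbertBasis ι ℂ E) {c : ι → ℂ} {M : ℝ} (hM : ∀ i, ‖c i‖ ≤ M)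
    (ψ : E) (i : ι) : inner ℂ (b i) (diagOp b c ψ) = c i * inner ℂ (b i) ψ :=
  Classical.epsilon_spec (p := fun T : E →L[ℂ] E =>
    ∀ ψ i, inner ℂ (b i) (T ψ) = c i * inner ℂ (b i) ψ) (exists_diagonal b hM) ψ i

theorem diagOp_mul (b : HilbertBasis ι ℂ E) {c c' : ι → ℂ} {M M' : ℝ} (hM : ∀ i, ‖c i‖ ≤ M)
    (hM' : ∀ i, ‖c' i‖ ≤ M') :
    diagOp b c * diagOp b c' = diagOp b fun i => c i * c' i := by
  ext ψ
  refine eq_of_forall_inner_eq b fun i => ?_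
  have hMM : ∀ i, ‖c i * c' i‖ ≤ M * M' := fun i => by
    rw [norm_mul]
    exact mul_le_mul (hM i) (hM' i) (norm_nonneg _) ((norm_nonneg _).trans (hM i))
  rw [mul_apply_eq_comp, inner_diagOp b hM, inner_diagOp b hM', inner_diagOp b hMM]
  ring

theorem diagOp_one (b : HilbertBasis ι ℂ E) : (diagOp b fun _ => 1) = 1 := by
  ext ψ
  refine eq_of_forall_inner_eq b fun i => ?_
  rw [inner_diagOp b (M := 1) (by simp)]
  simp

theorem star_diagOp (b : HilbertBasis ι ℂ E) {c : ι → ℂ} {M : ℝ} (hM : ∀ i, ‖c i‖ ≤ M) :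
    star (diagOp b c) = diagOp b fun i => starRingEnd ℂ (c i) := by
  have hM' : ∀ i, ‖starRingEnd ℂ (c i)‖ ≤ M := fun i => by simpa using hM i
  rw [ContinuousLinearMap.star_eq_adjoint]
  refine (ContinuousLinearMap.eq_adjoint_iff _ _).2 (fun x y => ?_) |>.symm
  rw [← (b.hasSum_inner_mul_inner _ _).tsum_eq, ← (b.hasSum_inner_mul_inner x _).tsum_eq]
  refine tsum_congr fun i => ?_
  rw [inner_diagOp b hM, ← inner_conj_symm _ (b i), inner_diagOp b hM', map_mul,
    inner_conj_symm, Complex.conj_conj]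
  ring

theorem norm_inner_diagOp_le (b : HilbertBasis ι ℂ E) {c : ι → ℂ} (hM : ∀ i, ‖c i‖ ≤ 1)
    (ψ : E) (i : ι) : ‖inner ℂ (b i) (diagOp b c ψ)‖ ≤ ‖inner ℂ (b i) ψ‖ := by
  rw [inner_diagOp b hM, norm_mul]
  exact mul_le_of_le_one_left (norm_nonneg _) (hM i)

/-- An unbounded operator is diagonal in a Hilbert basis, with eigenvalues `e`. -/
structure IsDiagonalIn (A : E →ₗ.[ℂ] E) (b : HilbertBasis ι ℂ E) (e : ι → ℝ) : Prop where
  eigen : ∀ i, ∃ h : b i ∈ A.domain, A ⟨b i, h⟩ = (e i : ℂ) • b i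
  coord : ∀ (ψ : A.domain) (i : ι), inner ℂ (b i) (A ψ) = e i * inner ℂ (b i) (ψ : E)

variable {A : E →ₗ.[ℂ] E} {b : HilbertBasis ι ℂ E} {e : ι → ℝ}

theorem norm_exp_ofReal_mul_I_sub_one_le (x : ℝ) : ‖Complex.exp (x * Complex.I) - 1‖ ≤ |x| := by
  have := Real.norm_exp_I_mul_ofReal_sub_one_le (x := x)
  rwa [mul_comm, Real.norm_eq_abs] at this

/-- Supplies existence for the choice in `expI`. On the domain, the coordinates of the difference
quotient are dominated by `|eᵢ ⟨bᵢ, ψ⟩| = |⟨bᵢ, A ψ⟩|`, which is square summable, so dominated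
convergence turns coordinatewise differentiability into differentiability in norm. -/
theorem IsDiagonalIn.isUnitaryGroup (h : IsDiagonalIn A b e) :
    IsUnitaryGroup A fun t => diagOp b fun i => Complex.exp ((t * e i : ℝ) * Complex.I) := by
  have hM : ∀ t : ℝ, ∀ i, ‖Complex.exp ((t * e i : ℝ) * Complex.I)‖ ≤ 1 := fun t i => by
    rw [Complex.norm_exp_ofReal_mul_I]
  have hadd : ∀ s t : ℝ, (diagOp b fun i => Complex.exp (((s + t) * e i : ℝ) * Complex.I)) =
      (diagOp b fun i => Complex.exp ((s * e i : ℝ) * Complex.I)) *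
        diagOp b fun i => Complex.exp ((t * e i : ℝ) * Complex.I) := fun s t => by
    rw [diagOp_mul b (hM s) (hM t)]
    congr 1
    funext i
    rw [← Complex.exp_add]
    push_cast
    ring_nf
  have hzero : (diagOp b fun i => Complex.exp (((0 : ℝ) * e i : ℝ) * Complex.I)) = 1 := by
    simp [diagOp_one]
  refine ⟨hzero, hadd, fun t => ?_, fun ψ => ?_, fun ψ => ?_⟩
  · have hstar : star (diagOp b fun i => Complex.exp ((t * e i : ℝ) * Complex.I)) =
        diagOp b fun i => Complex.exp (((-t) * e i : ℝ) * Complex.I) := by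
      rw [star_diagOp b (hM t)]
      congr 1
      funext i
      rw [← Complex.exp_conj]
      simp
    rw [Unitary.mem_iff, hstar, ← hadd, ← hadd]
    simp [diagOp_one]
  · refine continuous_iff_continuousAt.2 fun t => ?_
    refine tendsto_of_tendsto_inner b (g := fun i => 2 * ‖inner ℂ (b i) ψ‖) ?_ ?_ fun i => ?_
    · simpa only [mul_pow] using (hasSum_norm_sq_inner b ψ).summable.mul_left (2 ^ 2)
    · refine Eventually.of_forall fun s i => (norm_sub_le _ _).trans ?_
      have h1 := norm_inner_diagOp_le b (hM s) ψ i
      have h2 := norm_inner_diagOp_le b (hM t) ψ i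
      linarith
    · simp only [inner_diagOp b (hM _)]
      refine Continuous.tendsto ?_ t
      fun_prop
  · rw [hasDerivAt_iff_tendsto_slope_zero]
    refine tendsto_of_tendsto_inner b (g := fun i => 2 * ‖inner ℂ (b i) (A ψ)‖) ?_ ?_ fun i => ?_
    · simpa only [mul_pow] using (hasSum_norm_sq_inner b (A ψ)).summable.mul_left (2 ^ 2)
    · filter_upwards [self_mem_nhdsWithin] with t ht i
      refine (norm_sub_le _ _).trans ?_
      rw [hzero, zero_add, one_apply_eq_self, inner_smul_right_eq_smul, inner_sub_right,
        inner_diagOp b (hM _), inner_smul_right, h.coord, norm_smul, norm_mul, norm_mul]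
      have h1 : Complex.exp ((t * e i : ℝ) * Complex.I) * inner ℂ (b i) (ψ : E) -
          inner ℂ (b i) (ψ : E) = (Complex.exp ((t * e i : ℝ) * Complex.I) - 1) *
            inner ℂ (b i) (ψ : E) := by ring
      have h2 := norm_exp_ofReal_mul_I_sub_one_le (t * e i)
      rw [h1, norm_mul, norm_inv, Complex.norm_I, one_mul, Complex.norm_real, two_mul, ← mul_assoc]
      gcongr
      rw [inv_mul_le_iff₀ (norm_pos_iff.2 ht)]
      simpa [abs_mul] using h2
    · have h1 : HasDerivAt (fun t : ℝ => Complex.exp ((t * e i : ℝ) * Complex.I) *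
          inner ℂ (b i) (ψ : E)) (Complex.I * (e i * inner ℂ (b i) (ψ : E))) 0 := by
        have h2 : HasDerivAt (fun t : ℝ => ((t * e i : ℝ) : ℂ) * Complex.I) (e i * Complex.I) 0 := by
          have h3 : HasDerivAt (fun t : ℝ => t * e i) (1 * e i) 0 := (hasDerivAt_id 0).mul_const _
          simpa using h3.ofReal_comp.mul_const Complex.I
        refine (h2.cexp.mul_const (inner ℂ (b i) (ψ : E))).congr_deriv ?_
        simp
        ring
      rw [hasDerivAt_iff_tendsto_slope_zero] at h1
      rw [inner_smul_right, h.coord]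
      refine h1.congr fun t => ?_
      rw [hzero, zero_add, one_apply_eq_self, inner_smul_right_eq_smul,
        inner_sub_right, inner_diagOp b (hM _)]
      simp

/-- A vector valued function with `f' = c f` on `[0, ∞)` is exponential. -/
theorem eq_exp_smul_of_hasDerivWithinAt {f : ℝ → E} {c : ℂ}
    (hf : ∀ s, 0 ≤ s → HasDerivWithinAt f (c • f s) (Set.Ici s) s)
    (hc : ContinuousOn f (Set.Ici 0)) {s : ℝ} (hs : 0 ≤ s) : f s = Complex.exp (s * c) • f 0 := by
  let g : ℝ → E := fun s => Complex.exp (-(s * c)) • f s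
  have hexp : ∀ s : ℝ, HasDerivAt (fun s : ℝ => Complex.exp (-(s * c)))
      (Complex.exp (-(s * c)) * -c) s := fun s => by
    have h3 : HasDerivAt (fun s : ℝ => -((s : ℂ) * c)) (-c) s := by
      simpa using ((hasDerivAt_id s).ofReal_comp.mul_const c).fun_neg
    exact h3.cexp
  have hg : ∀ x ∈ Set.Ico 0 s, HasDerivWithinAt g 0 (Set.Ici x) x := fun x hx => by
    refine ((hexp x).hasDerivWithinAt.smul (hf x hx.1)).congr_deriv ?_
    rw [smul_smul, ← add_smul]
    simp
  have hgc : ContinuousOn g (Set.Icc 0 s) := by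
    refine ContinuousOn.smul ?_ (hc.mono fun x hx => hx.1)
    exact fun x _ => (hexp x).continuousAt.continuousWithinAt
  have h5 := constant_of_has_deriv_right_zero hgc hg s ⟨hs, le_rfl⟩
  simp only [g, Complex.ofReal_zero, zero_mul, neg_zero, Complex.exp_zero, one_smul] at h5
  rw [← h5, smul_smul, ← Complex.exp_add]
  simp

theorem IsUnitaryGroup.hasDerivAt_apply {U : ℝ → E →L[ℂ] E} (hU : IsUnitaryGroup A U)
    (ψ : A.domain) (s : ℝ) :
    HasDerivAt (fun s => U s (ψ : E)) (Complex.I • U s (A ψ)) s := by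
  have h1 : HasFDerivAt (U s) ((U s).restrictScalars ℝ) (U (s - s) (ψ : E)) :=
    ((U s).restrictScalars ℝ).hasFDerivAt
  have h2 : HasDerivAt (fun r => U r (ψ : E)) (Complex.I • A ψ) (s - s) := by
    rw [sub_self]
    exact hU.hasDerivAt ψ
  have h3 : HasDerivAt (fun r => U (r - s) (ψ : E)) (Complex.I • A ψ) s := h2.comp_sub_const s s
  have h4 := h1.comp_hasDerivAt s h3
  simp only [ContinuousLinearMap.coe_restrictScalars', map_smul] at h4
  refine h4.congr_of_eventuallyEq (Eventually.of_forall fun r => ?_)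
  simp only [Function.comp_apply]
  rw [← mul_apply_eq_comp, ← hU.add]
  simp

theorem IsUnitaryGroup.apply_eigenvector {U : ℝ → E →L[ℂ] E} (hU : IsUnitaryGroup A U)
    {v : A.domain} {c : ℂ} (hv : A v = c • (v : E)) (t : ℝ) :
    U t v = Complex.exp (t * (Complex.I * c)) • (v : E) := by
  -- The uniqueness lemma for the differential equation covers only `s ≥ 0`; the signs `ε = 1` and
  -- `ε = -1` reach all times.
  have hder : ∀ ε : ℝ, ∀ s, HasDerivAt (fun s => U (ε * s) (v : E))
      ((ε * (Complex.I * c) : ℂ) • U (ε * s) v) s := fun ε s => by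
    have h6 : HasDerivAt (fun r => ε * r) ε s := by simpa using (hasDerivAt_id s).const_mul ε
    refine ((hU.hasDerivAt_apply v (ε * s)).scomp s h6).congr_deriv ?_
    rw [hv, map_smul, ← Complex.coe_smul, smul_smul, smul_smul]
    congr 1
    ring
  have hmain : ∀ ε : ℝ, ∀ s : ℝ, 0 ≤ s →
      U (ε * s) v = Complex.exp (s * (ε * (Complex.I * c))) • (v : E) := fun ε s hs => by
    have := eq_exp_smul_of_hasDerivWithinAt (f := fun s => U (ε * s) (v : E))
      (fun s _ => (hder ε s).hasDerivWithinAt)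
      (fun s _ => (hder ε s).continuousAt.continuousWithinAt) hs
    simpa [hU.zero] using this
  rcases le_total 0 t with ht | ht
  · simpa using hmain 1 t ht
  · have := hmain (-1) (-t) (by linarith)
    simpa using this

theorem isUnitaryGroup_expI (h : ∃ U, IsUnitaryGroup A U) : IsUnitaryGroup A (expI A) :=
  Classical.epsilon_spec h

theorem isHeatSemigroup_expNeg (h : ∃ T, IsHeatSemigroup A T) : IsHeatSemigroup A (expNeg A) :=
  Classical.epsilon_spec h

theorem IsDiagonalIn.expI_apply (h : IsDiagonalIn A b e) (t : ℝ) (i : ι) :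
    expI A t (b i) = Complex.exp ((t * e i : ℝ) * Complex.I) • b i := by
  obtain ⟨hm, hi⟩ := h.eigen i
  have := (isUnitaryGroup_expI ⟨_, h.isUnitaryGroup⟩).apply_eigenvector (v := ⟨b i, hm⟩) hi t
  rw [this]
  congr 2
  push_cast
  ring

theorem ext_on_basis {S T : E →L[ℂ] E} (b : HilbertBasis ι ℂ E) (h : ∀ i, S (b i) = T (b i)) :
    S = T := by
  refine ContinuousLinearMap.ext_on (s := Set.range b) ?_ ?_
  · rw [dense_iff_closure_eq, ← Submodule.topologicalClosure_coe, b.dense_span]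
    rfl
  · rintro _ ⟨i, rfl⟩
    exact h i

/-- On each eigenvector any admissible group solves `f' = i eᵢ f`, so the chosen group and the
explicit one agree on the basis. This settles uniqueness without the general form of Stone's
theorem. -/
theorem IsDiagonalIn.expI_eq (h : IsDiagonalIn A b e) (t : ℝ) :
    expI A t = diagOp b fun i => Complex.exp ((t * e i : ℝ) * Complex.I) := by
  refine ext_on_basis b fun i => ?_
  obtain ⟨hm, hi⟩ := h.eigen i
  rw [h.expI_apply, h.isUnitaryGroup.apply_eigenvector (v := ⟨b i, hm⟩) hi t]
  congr 2
  push_cast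
  ring

theorem IsDiagonalIn.inner_expI (h : IsDiagonalIn A b e) (t : ℝ) (ψ : E) (i : ι) :
    inner ℂ (b i) (expI A t ψ) = Complex.exp ((t * e i : ℝ) * Complex.I) * inner ℂ (b i) ψ := by
  rw [h.expI_eq, inner_diagOp b (M := 1)]
  exact fun i => by rw [Complex.norm_exp_ofReal_mul_I]

theorem one_sub_exp_neg_le {x : ℝ} (hx : 0 ≤ x) : |Real.exp (-x) - 1| ≤ x := by
  have h1 := Real.add_one_le_exp (-x)
  have h2 : Real.exp (-x) ≤ 1 := Real.exp_le_one_iff.2 (by linarith)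
  rw [abs_le]
  constructor <;> linarith

/-- The same dominated convergence as for the unitary group, with `|exp(-x) - 1| ≤ x` for `x ≥ 0` as
the domination. -/
theorem IsDiagonalIn.isHeatSemigroup (h : IsDiagonalIn A b e) (he : ∀ i, 0 ≤ e i) :
    IsHeatSemigroup A fun s => diagOp b fun i => (Real.exp (-(s * e i)) : ℂ) := by
  have hM : ∀ s : ℝ, 0 ≤ s → ∀ i, ‖(Real.exp (-(s * e i)) : ℂ)‖ ≤ 1 := fun s hs i => by
    rw [Complex.norm_real, Real.norm_eq_abs, Real.abs_exp, Real.exp_le_one_iff]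
    have := mul_nonneg hs (he i)
    linarith
  have hzero : (diagOp b fun i => (Real.exp (-((0 : ℝ) * e i)) : ℂ)) = 1 := by
    simp [diagOp_one]
  refine ⟨hzero, fun s t hs ht => ?_, fun s hs => ?_, fun ψ => ?_, fun ψ => ?_⟩
  · rw [diagOp_mul b (hM s hs) (hM t ht)]
    congr 1
    funext i
    rw [← Complex.ofReal_mul, ← Real.exp_add]
    ring_nf
  · rw [IsSelfAdjoint, star_diagOp b (hM s hs)]
    congr 1
    funext i
    rw [Complex.conj_ofReal]
  · intro t ht
    refine tendsto_of_tendsto_inner b (g := fun i => 2 * ‖inner ℂ (b i) ψ‖) ?_ ?_ fun i => ?_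
    · simpa only [mul_pow] using (hasSum_norm_sq_inner b ψ).summable.mul_left (2 ^ 2)
    · filter_upwards [self_mem_nhdsWithin] with s hs i
      refine (norm_sub_le _ _).trans ?_
      have h1 := norm_inner_diagOp_le b (hM s hs) ψ i
      have h2 := norm_inner_diagOp_le b (hM t ht) ψ i
      linarith
    · rw [inner_diagOp b (hM t ht)]
      have h1 : Continuous fun s : ℝ => (Real.exp (-(s * e i)) : ℂ) * inner ℂ (b i) ψ := by fun_prop
      refine (h1.continuousWithinAt (s := Set.Ici 0) (x := t)).tendsto.congr' ?_
      filter_upwards [self_mem_nhdsWithin] with s hs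
      rw [inner_diagOp b (hM s hs)]
  · rw [hasDerivWithinAt_iff_tendsto_slope]
    refine tendsto_of_tendsto_inner b (g := fun i => 2 * ‖inner ℂ (b i) (A ψ)‖) ?_ ?_ fun i => ?_
    · simpa only [mul_pow] using (hasSum_norm_sq_inner b (A ψ)).summable.mul_left (2 ^ 2)
    · filter_upwards [self_mem_nhdsWithin] with t ht i
      have ht0 : 0 < t := lt_of_le_of_ne ht.1 (Ne.symm ht.2)
      refine (norm_sub_le _ _).trans ?_
      rw [slope_def_module, hzero, sub_zero, one_apply_eq_self, inner_smul_right_eq_smul,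
        inner_sub_right, inner_diagOp b (hM _ ht0.le), inner_neg_right, h.coord, norm_neg,
        norm_smul, norm_mul]
      have h1 : (Real.exp (-(t * e i)) : ℂ) * inner ℂ (b i) (ψ : E) -
          inner ℂ (b i) (ψ : E) = ((Real.exp (-(t * e i)) - 1 : ℝ) : ℂ) *
            inner ℂ (b i) (ψ : E) := by push_cast; ring
      have h2 := one_sub_exp_neg_le (mul_nonneg ht0.le (he i))
      rw [h1, norm_mul, norm_inv, Complex.norm_real, Complex.norm_real, two_mul, ← mul_assoc,
        Real.norm_of_nonneg (he i), Real.norm_of_nonneg ht0.le]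
      gcongr
      rw [inv_mul_le_iff₀ ht0]
      exact h2
    · have h1 : HasDerivAt (fun t : ℝ => (Real.exp (-(t * e i)) : ℂ) *
          inner ℂ (b i) (ψ : E)) (-(e i * inner ℂ (b i) (ψ : E))) 0 := by
        have h3 : HasDerivAt (fun t : ℝ => -(t * e i)) (-(1 * e i)) 0 :=
          ((hasDerivAt_id 0).mul_const _).fun_neg
        refine (h3.exp.ofReal_comp.mul_const (inner ℂ (b i) (ψ : E))).congr_deriv ?_
        simp
      have h2 := hasDerivWithinAt_iff_tendsto_slope.1 (h1.hasDerivWithinAt (s := Set.Ici 0))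
      rw [inner_neg_right, h.coord]
      refine h2.congr' ?_
      filter_upwards [self_mem_nhdsWithin] with t ht
      rw [slope_def_module, slope_def_module, hzero, one_apply_eq_self,
        inner_smul_right_eq_smul, inner_sub_right, inner_diagOp b (hM _ ht.1)]
      simp

theorem IsHeatSemigroup.apply_eigenvector {T : ℝ → E →L[ℂ] E} (hT : IsHeatSemigroup A T)
    {v : A.domain} {c : ℂ} (hv : A v = c • (v : E)) {s : ℝ} (hs : 0 ≤ s) :
    T s v = Complex.exp (s * -c) • (v : E) := by
  have hder : ∀ s, 0 ≤ s → HasDerivWithinAt (fun s => T s (v : E)) (-c • T s (v : E))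
      (Set.Ici s) s := fun s hs => by
    have h1 : HasFDerivAt (T s) ((T s).restrictScalars ℝ) (T (s - s) (v : E)) :=
      ((T s).restrictScalars ℝ).hasFDerivAt
    have h2 : HasDerivWithinAt (fun r => T r (v : E)) (-(A v)) (Set.Ici 0) (s - s) := by
      rw [sub_self]
      exact hT.hasDerivWithinAt v
    have h3 : HasDerivWithinAt (fun r => T (r - s) (v : E)) (-(A v)) (Set.Ici s) s := by
      have h5 : HasDerivWithinAt (fun r => r - s) 1 (Set.Ici s) s :=
        ((hasDerivAt_id s).sub_const s).hasDerivWithinAt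
      have h6 : Set.MapsTo (fun r => r - s) (Set.Ici s) (Set.Ici 0) := fun r hr => by
        simpa using hr
      simpa [Function.comp_def] using
        HasDerivWithinAt.scomp (h := fun r => r - s) s h2 h5 h6
    have h4 := h1.comp_hasDerivWithinAt s h3
    refine (h4.congr_deriv ?_).congr_of_mem (fun r hr => ?_) Set.self_mem_Ici
    · simp [hv]
    · simp only [Function.comp_apply]
      rw [← mul_apply_eq_comp, ← hT.add _ _ hs (by simpa using hr)]
      simp
  have := eq_exp_smul_of_hasDerivWithinAt hder (hT.continuousOn _) hs
  simpa [hT.zero] using this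

theorem IsDiagonalIn.expNeg_apply (h : IsDiagonalIn A b e) (he : ∀ i, 0 ≤ e i) {s : ℝ}
    (hs : 0 ≤ s) (i : ι) : expNeg A s (b i) = (Real.exp (-(s * e i)) : ℂ) • b i := by
  obtain ⟨hm, hi⟩ := h.eigen i
  have := (isHeatSemigroup_expNeg ⟨_, h.isHeatSemigroup he⟩).apply_eigenvector
    (v := ⟨b i, hm⟩) hi hs
  rw [this]
  push_cast
  ring_nf

/-- The trace of `X T`, where `T` is diagonal with nonnegative summable eigenvalues. -/
theorem hasTrace_mul (b : HilbertBasis ι ℂ E) {T : E →L[ℂ] E} {x : ι → ℝ} (hx : ∀ i, 0 ≤ x i)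
    (hxs : Summable x) (hT : ∀ i, T (b i) = (x i : ℂ) • b i) (X : E →L[ℂ] E) :
    HasTrace (X * T) (∑' i, (x i : ℂ) * inner ℂ (b i) (X (b i))) := by
  intro κ b'
  let F : ι × κ → ℂ := fun q => (x q.1 : ℂ) *
    (inner ℂ (b q.1) (b' q.2) * inner ℂ (b' q.2) (X (b q.1)))
  have hin : ∀ i, HasSum (fun j => F (i, j)) ((x i : ℂ) * inner ℂ (b i) (X (b i))) := fun i =>
    (b'.hasSum_inner_mul_inner (b i) (X (b i))).mul_left _
  -- Parseval in the second basis and `|ab| ≤ |a|² + |b|²` bound each row of the double series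
  -- uniformly in `i`; summability of `x` then makes the double series absolutely convergent, so the
  -- two bases may be interchanged.
  have hbound : ∀ i, Summable (fun j => ‖inner ℂ (b i) (b' j) * inner ℂ (b' j) (X (b i))‖) ∧
      ∑' j, ‖inner ℂ (b i) (b' j) * inner ℂ (b' j) (X (b i))‖ ≤ 1 + ‖X‖ ^ 2 := fun i => by
    have h1 : HasSum (fun j => ‖inner ℂ (b' j) (b i)‖ ^ 2 + ‖inner ℂ (b' j) (X (b i))‖ ^ 2)
        (‖b i‖ ^ 2 + ‖X (b i)‖ ^ 2) :=
      (hasSum_norm_sq_inner b' (b i)).add (hasSum_norm_sq_inner b' (X (b i)))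
    have h2 : ∀ j, ‖inner ℂ (b i) (b' j) * inner ℂ (b' j) (X (b i))‖ ≤
        ‖inner ℂ (b' j) (b i)‖ ^ 2 + ‖inner ℂ (b' j) (X (b i))‖ ^ 2 := fun j => by
      rw [norm_mul, norm_inner_symm]
      nlinarith [sq_nonneg (‖inner ℂ (b' j) (b i)‖ - ‖inner ℂ (b' j) (X (b i))‖),
        norm_nonneg (inner ℂ (b' j) (b i)), norm_nonneg (inner ℂ (b' j) (X (b i)))]
    have h3 := Summable.of_nonneg_of_le (fun j => norm_nonneg _) h2 h1.summable
    refine ⟨h3, (h3.tsum_le_tsum h2 h1.summable).trans ?_⟩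
    rw [h1.tsum_eq]
    have h4 : ‖b i‖ = 1 := b.orthonormal.1 i
    have h5 : ‖X (b i)‖ ≤ ‖X‖ := by simpa [h4] using X.le_opNorm (b i)
    rw [h4, one_pow]
    gcongr
  have hF : Summable F := by
    refine Summable.of_norm ?_
    rw [summable_prod_of_nonneg (fun q => norm_nonneg _)]
    have hFn : ∀ i j, ‖F (i, j)‖ =
        x i * ‖inner ℂ (b i) (b' j) * inner ℂ (b' j) (X (b i))‖ := fun i j => by
      simp only [F]
      rw [norm_mul, Complex.norm_real, Real.norm_of_nonneg (hx i)]
    simp only [hFn, tsum_mul_left]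
    refine ⟨fun i => (hbound i).1.mul_left _, ?_⟩
    refine Summable.of_nonneg_of_le (fun i => mul_nonneg (hx i) (tsum_nonneg fun j => norm_nonneg _))
      (fun i => mul_le_mul_of_nonneg_left (hbound i).2 (hx i)) (hxs.mul_right _)
  have htot : HasSum F (∑' i, (x i : ℂ) * inner ℂ (b i) (X (b i))) := by
    have := (hF.hasSum.prod_fiberwise hin).tsum_eq
    rw [this]
    exact hF.hasSum
  have hswap := (Equiv.prodComm κ ι).hasSum_iff.2 htot
  refine hswap.prod_fiberwise fun j => ?_
  have hj := (innerSL ℂ (b' j) ∘L (X * T)).hasSum (b.hasSum_repr (b' j))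
  simp only [ContinuousLinearMap.comp_apply, innerSL_apply_apply] at hj
  refine hj.congr_fun fun i => ?_
  simp only [F, Function.comp_apply, Equiv.prodComm_apply, Prod.swap_prod_mk, map_smul,
    mul_apply_eq_comp, hT, inner_smul_right, b.repr_apply_apply]
  ring

/-- `HasTrace` quantifies over all Hilbert bases, so one basis has to be exhibited before the value
becomes unique. -/
theorem trace_eq {X : E →L[ℂ] E} {c : ℂ} (b : HilbertBasis ι ℂ E) (h : HasTrace X c) :
    trace X = c :=
  (Classical.epsilon_spec (p := HasTrace X) ⟨c, h⟩ ι b).unique (h ι b)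

end Diagonal

/-! ### Uniqueness and extension of unitary groups from weak information on generators -/

section UnitaryGroups

variable {E : Type} [NormedAddCommGroup E] [InnerProductSpace ℂ E] [CompleteSpace E]
variable {A : E →ₗ.[ℂ] E} {U V : ℝ → E →L[ℂ] E}

/-- For an operator that is not closable, `closure` returns the operator itself, so the inclusion
survives in that case too and closability never has to be proved. -/
theorem mem_closure_graph (A : E →ₗ.[ℂ] E) (ψ : A.closure.domain) :
    ((ψ : E), A.closure ψ) ∈ closure (A.graph : Set (E × E)) := by
  have h1 : ((ψ : E), A.closure ψ) ∈ A.closure.graph := A.closure.mem_graph ψ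
  by_cases h : A.IsClosable
  · rw [← h.graph_closure_eq_closure_graph] at h1
    rwa [← Submodule.topologicalClosure_coe]
  · have h2 : A.closure.graph = A.graph := by rw [LinearPMap.closure_def' h]
    rw [h2] at h1
    exact subset_closure h1

theorem norm_apply_of_mem_unitary {W : E →L[ℂ] E} (hW : W ∈ unitary (E →L[ℂ] E)) (x : E) :
    ‖W x‖ = ‖x‖ :=
  ContinuousLinearMap.norm_map_of_mem_unitary hW x

theorem inner_apply_of_mem_unitary {W : E →L[ℂ] E} (hW : W ∈ unitary (E →L[ℂ] E)) (x y : E) :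
    inner ℂ (W x) (W y) = inner ℂ x y :=
  ContinuousLinearMap.inner_map_map_of_mem_unitary hW x y

theorem inner_group_left (hadd : ∀ s t, U (s + t) = U s * U t) (hzero : U 0 = 1)
    (hU : ∀ t, U t ∈ unitary (E →L[ℂ] E)) (s : ℝ) (x y : E) :
    inner ℂ (U s x) y = inner ℂ x (U (-s) y) := by
  rw [← inner_apply_of_mem_unitary (hU s) x, ← mul_apply_eq_comp, ← hadd]
  simp [hzero]

theorem IsUnitaryGroup.inner_left (hU : IsUnitaryGroup A U) (s : ℝ) (x y : E) :
    inner ℂ (U s x) y = inner ℂ x (U (-s) y) :=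
  inner_group_left hU.add hU.zero hU.mem_unitary s x y

/-- Differentiate `⟨U_r φ, U_s χ⟩ = ⟨φ, U_{s-r} χ⟩` at `r = 0` in both of its forms. -/
theorem IsUnitaryGroup.inner_generator (hU : IsUnitaryGroup A U) (φ χ : A.domain) (s : ℝ) :
    inner ℂ (A φ) (U s χ) = inner ℂ (φ : E) (U s (A χ)) := by
  have h1 : HasDerivAt (fun r => inner ℂ (U r (φ : E)) (U s (χ : E)))
      (inner ℂ (Complex.I • A φ) (U s χ)) 0 := by
    have := (hU.hasDerivAt φ).inner ℂ (hasDerivAt_const (0 : ℝ) (U s (χ : E)))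
    rwa [inner_zero_right, zero_add] at this
  have h2 : HasDerivAt (fun r => inner ℂ (U r (φ : E)) (U s (χ : E)))
      (inner ℂ (φ : E) (-(Complex.I • U s (A χ)))) 0 := by
    have h3 : HasDerivAt (fun r => U (s - r) (χ : E)) (-(Complex.I • U s (A χ))) 0 := by
      have h4 := hU.hasDerivAt_apply χ (s - 0)
      simpa using h4.comp_const_sub s 0
    have h5 := (hasDerivAt_const (0 : ℝ) (φ : E)).inner ℂ h3
    simp only [inner_zero_left, add_zero] at h5
    refine h5.congr_of_eventuallyEq (Eventually.of_forall fun r => ?_)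
    simp only
    rw [hU.inner_left, ← mul_apply_eq_comp, ← hU.add]
    ring_nf
  have h6 := h1.unique h2
  rw [inner_smul_left, inner_neg_right, inner_smul_right, Complex.conj_I] at h6
  have h7 : Complex.I * inner ℂ (A φ) (U s χ) = Complex.I * inner ℂ (φ : E) (U s (A χ)) := by
    linear_combination -h6
  exact mul_left_cancel₀ Complex.I_ne_zero h7

/-- Two unitary groups whose generators agree weakly on sets with dense span coincide. -/
theorem unitaryGroup_eq {X Y : Type*} {φ φ' : X → E} {ψ ψ' : Y → E}
    (hφ : Dense (Submodule.span ℂ (Set.range φ) : Set E))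
    (hψ : Dense (Submodule.span ℂ (Set.range ψ) : Set E))
    (hU : ∀ t, U t ∈ unitary (E →L[ℂ] E)) (hV : V 0 = U 0)
    (hU' : ∀ x s, HasDerivAt (fun s => U s (φ x)) (Complex.I • U s (φ' x)) s)
    (hV' : ∀ y s, HasDerivAt (fun s => V s (ψ y)) (Complex.I • V s (ψ' y)) s)
    (h : ∀ x y s, inner ℂ (U s (φ' x)) (V s (ψ y)) = inner ℂ (U s (φ x)) (V s (ψ' y))) :
    U = V := by
  -- The mixed inner product has zero derivative by the weak agreement of the generators, so it
  -- keeps its value at `s = 0`, which is also the value with `U` on both sides.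
  have hconst : ∀ x y s, inner ℂ (U s (φ x)) (V s (ψ y)) = inner ℂ (U s (φ x)) (U s (ψ y)) := by
    intro x y s
    have hd : ∀ s, HasDerivAt (fun s => inner ℂ (U s (φ x)) (V s (ψ y))) 0 s := fun s => by
      refine ((hU' x s).inner ℂ (hV' y s)).congr_deriv ?_
      rw [inner_smul_left, inner_smul_right, h, Complex.conj_I]
      ring
    have := is_const_of_deriv_eq_zero (fun s => (hd s).differentiableAt) (fun s => (hd s).deriv) s 0
    rw [this, hV, inner_apply_of_mem_unitary (hU 0), inner_apply_of_mem_unitary (hU s)]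
  funext s
  refine (ContinuousLinearMap.ext_on (s := Set.range ψ) hψ ?_).symm
  rintro _ ⟨y, rfl⟩
  have h1 : ∀ v : E, inner ℂ v (ContinuousLinearMap.adjoint (U s) (V s (ψ y) - U s (ψ y))) = 0 := by
    have h2 : (innerSL ℂ).flip (ContinuousLinearMap.adjoint (U s) (V s (ψ y) - U s (ψ y))) = 0 := by
      refine ContinuousLinearMap.ext_on (s := Set.range φ) hφ ?_
      rintro _ ⟨x, rfl⟩
      simp only [ContinuousLinearMap.flip_apply, innerSL_apply_apply]
      rw [ContinuousLinearMap.adjoint_inner_right, inner_sub_right, hconst, sub_self]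
      rfl
    intro v
    have := congrArg (fun T => T v) h2
    simpa using this
  have h3 := inner_self_eq_zero.1 (h1 _)
  have h4 : U s * star (U s) = 1 := (Unitary.mem_iff.1 (hU s)).2
  have h5 := congrArg (U s) h3
  rw [← ContinuousLinearMap.star_eq_adjoint, ← mul_apply_eq_comp, h4] at h5
  simpa [sub_eq_zero] using h5

/-- A unitary group that is differentiable on a graph is differentiable on its closure. -/
theorem hasDerivAt_of_mem_closure (hzero : U 0 = 1) (hU : ∀ t, U t ∈ unitary (E →L[ℂ] E))
    (hcont : ∀ ψ, Continuous fun t => U t ψ) {G : Set (E × E)}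
    (hG : ∀ g ∈ G, ∀ s, HasDerivAt (fun t => U t g.1) (Complex.I • U s g.2) s) {ψ χ : E}
    (h : (ψ, χ) ∈ closure G) : HasDerivAt (fun t => U t ψ) (Complex.I • χ) 0 := by
  rw [hasDerivAt_iff_isLittleO_nhds_zero, Asymptotics.isLittleO_iff]
  intro ε hε
  have hc : Tendsto (fun t => U t χ) (𝓝 0) (𝓝 χ) := by
    simpa [hzero] using (hcont χ).tendsto 0
  obtain ⟨δ, hδ, hball⟩ := Metric.eventually_nhds_iff_ball.1 (Metric.tendsto_nhds.1 hc ε hε)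
  filter_upwards [Metric.ball_mem_nhds (0 : ℝ) hδ] with t ht
  simp only [zero_add, hzero, one_apply_eq_self]
  refine le_of_forall_pos_le_add fun η hη => ?_
  -- Replacing `(ψ, χ)` by a graph point at distance `ρ` costs `ρ |t|` in the mean value inequality
  -- and `2ρ` in the two values of the group, in total `ρ (2 + |t|) = η`.
  have hη' : 0 < η / (2 + |t|) := by positivity
  obtain ⟨⟨ψ', χ'⟩, hg, hd⟩ := Metric.mem_closure_iff.1 h _ hη'
  set ρ := η / (2 + |t|) with hρ
  have hd1 : ‖ψ - ψ'‖ < ρ := by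
    rw [← dist_eq_norm]; exact lt_of_le_of_lt (le_max_left _ _) hd
  have hd2 : ‖χ - χ'‖ < ρ := by
    rw [← dist_eq_norm]; exact lt_of_le_of_lt (le_max_right _ _) hd
  have hmv := (convex_ball (0 : ℝ) δ).norm_image_sub_le_of_norm_hasDerivWithin_le
    (f := fun s => U s ψ' - s • Complex.I • χ)
    (f' := fun s => Complex.I • U s χ' - Complex.I • χ) (C := ρ + ε) (x := 0) (y := t)
    (fun s _ => ((hG _ hg s).sub (by
      simpa using (hasDerivAt_id s).smul_const (Complex.I • χ))).hasDerivWithinAt)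
    (fun s hs => by
      have e1 : Complex.I • U s χ' - Complex.I • χ =
          Complex.I • (U s (χ' - χ) + (U s χ - χ)) := by
        rw [map_sub, ← smul_sub]
        congr 1
        abel
      rw [e1, norm_smul, Complex.norm_I, one_mul]
      refine (norm_add_le _ _).trans (add_le_add ?_ ?_)
      · rw [norm_apply_of_mem_unitary (hU s), norm_sub_rev]
        exact hd2.le
      · rw [← dist_eq_norm]
        exact (hball s hs).le)
    (Metric.mem_ball_self hδ) ht
  simp only [hzero, one_apply_eq_self, zero_smul, sub_zero] at hmv
  have e2 : U t ψ - ψ - t • Complex.I • χ =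
      (U t ψ' - t • Complex.I • χ - ψ') + (U t (ψ - ψ') - (ψ - ψ')) := by
    rw [map_sub]
    abel
  rw [e2]
  refine (norm_add_le _ _).trans ?_
  have e3 : ‖U t (ψ - ψ') - (ψ - ψ')‖ ≤ ρ + ρ := by
    refine (norm_sub_le _ _).trans ?_
    rw [norm_apply_of_mem_unitary (hU t)]
    linarith
  have e4 : ρ * (2 + |t|) = η := by
    rw [hρ]
    field_simp
  rw [Real.norm_eq_abs] at hmv ⊢
  nlinarith [abs_nonneg t]

end UnitaryGroups

/-! ### Closures of operators defined on Schwartz functions -/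

section Schwartz

variable {d L : ℕ}

theorem denseRange_incl (d L : ℕ) : DenseRange (incl d L) :=
  SchwartzMap.denseRange_toLpCLM (E := Config d L) (F := ℂ) (by simp)

theorem dense_span_incl (d L : ℕ) :
    Dense (Submodule.span ℂ (Set.range (incl d L)) : Set (HSpace d L)) :=
  Dense.mono Submodule.subset_span (denseRange_incl d L)

variable {T : 𝓢(Config d L, ℂ) →ₗ[ℂ] 𝓢(Config d L, ℂ)}

theorem mem_graph_onSchwartz {g : HSpace d L × HSpace d L} :
    g ∈ (onSchwartz T).graph ↔ ∃ φ, incl d L φ = g.1 ∧ incl d L (T φ) = g.2 := by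
  have key : ∀ (φ : 𝓢(Config d L, ℂ)) (h : incl d L φ ∈ (onSchwartz T).domain),
      onSchwartz T ⟨incl d L φ, h⟩ = incl d L (T φ) := fun φ h => by
    change incl d L (T ((LinearEquiv.ofInjective (incl d L) (incl_injective d L)).symm
      ⟨incl d L φ, h⟩)) = _
    congr 2
    rw [LinearEquiv.symm_apply_eq]
    rfl
  rw [LinearPMap.mem_graph_iff]
  constructor
  · rintro ⟨⟨y, φ, rfl⟩, h1, h2⟩
    exact ⟨φ, h1, by rw [← h2, ← key φ ⟨φ, rfl⟩]⟩
  · rintro ⟨φ, h1, h2⟩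
    exact ⟨⟨incl d L φ, φ, rfl⟩, h1, by rw [← h2, ← key φ ⟨φ, rfl⟩]⟩

theorem onSchwartz_closure_apply (T : 𝓢(Config d L, ℂ) →ₗ[ℂ] 𝓢(Config d L, ℂ))
    (φ : 𝓢(Config d L, ℂ)) : ∃ h : incl d L φ ∈ (onSchwartz T).closure.domain,
      (onSchwartz T).closure ⟨incl d L φ, h⟩ = incl d L (T φ) := by
  have h1 : (incl d L φ, incl d L (T φ)) ∈ (onSchwartz T).graph :=
    mem_graph_onSchwartz.2 ⟨φ, rfl, rfl⟩
  have h2 := LinearPMap.le_graph_of_le (onSchwartz T).le_closure h1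
  obtain ⟨y, hy1, hy2⟩ := LinearPMap.mem_graph_iff _ |>.1 h2
  simp only at hy1 hy2
  exact ⟨hy1 ▸ y.2, by rw [← hy2]; congr 1; exact Subtype.ext hy1.symm⟩

theorem mem_closure_graph_onSchwartz (ψ : (onSchwartz T).closure.domain) :
    ((ψ : HSpace d L), (onSchwartz T).closure ψ) ∈
      closure (Set.range fun φ => (incl d L φ, incl d L (T φ))) := by
  have h := mem_closure_graph (onSchwartz T) ψ
  have h2 : ((onSchwartz T).graph : Set (HSpace d L × HSpace d L)) =
      Set.range fun φ => (incl d L φ, incl d L (T φ)) := by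
    ext g
    rw [SetLike.mem_coe, mem_graph_onSchwartz]
    simp [Prod.ext_iff]
  rwa [h2] at h

/-- If a symmetric operator on Schwartz functions has a Hilbert basis of eigenvectors, then its
closure is diagonal in this basis. -/
theorem isDiagonalIn_closure {ι : Type} {b : HilbertBasis ι ℂ (HSpace d L)} {e : ι → ℝ}
    {v : ι → 𝓢(Config d L, ℂ)} (hv : ∀ i, incl d L (v i) = b i)
    (hT : ∀ i, T (v i) = (e i : ℂ) • v i)
    (hsymm : ∀ φ ψ, inner ℂ (incl d L (T φ)) (incl d L ψ) =
      inner ℂ (incl d L φ) (incl d L (T ψ))) :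
    IsDiagonalIn (onSchwartz T).closure b e := by
  refine ⟨fun i => ?_, fun ψ i => ?_⟩
  · obtain ⟨h1, h2⟩ := onSchwartz_closure_apply T (v i)
    rw [← hv i]
    exact ⟨h1, by rw [h2, hT, map_smul]⟩
  · have hcl : IsClosed {g : HSpace d L × HSpace d L |
        inner ℂ (b i) g.2 = e i * inner ℂ (b i) g.1} :=
      isClosed_eq (by fun_prop) (by fun_prop)
    refine closure_minimal ?_ hcl (mem_closure_graph_onSchwartz ψ)
    rintro _ ⟨φ, rfl⟩
    simp only [Set.mem_ofPred_eq]
    rw [← hv i, ← hsymm, hT, map_smul, inner_smul_left, Complex.conj_ofReal]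

/-- A one-parameter group of linear isometries of the Schwartz space, differentiable in `L²` at
`0` with derivative `i T`, is the restriction of `e^{itT}`. -/
theorem expI_closure_incl {w : ℝ → 𝓢(Config d L, ℂ) →ₗ[ℂ] 𝓢(Config d L, ℂ)}
    (hzero : w 0 = LinearMap.id) (hadd : ∀ s t, w (s + t) = w s ∘ₗ w t)
    (hiso : ∀ s φ, ‖incl d L (w s φ)‖ = ‖incl d L φ‖)
    (hcomm : ∀ s φ, T (w s φ) = w s (T φ))
    (hder : ∀ φ, HasDerivAt (fun s => incl d L (w s φ)) (Complex.I • incl d L (T φ)) 0) :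
    IsUnitaryGroup (onSchwartz T).closure (expI (onSchwartz T).closure) ∧
      ∀ s φ, expI (onSchwartz T).closure s (incl d L φ) = incl d L (w s φ) := by
  -- The candidate group: the extension of `w s` by isometry from the dense Schwartz space.
  let V : ℝ → HSpace d L →L[ℂ] HSpace d L := fun s =>
    LinearMap.extendOfNorm (incl d L ∘ₗ w s) (incl d L)
  have hV : ∀ s φ, V s (incl d L φ) = incl d L (w s φ) := fun s φ =>
    LinearMap.extendOfNorm_eq (denseRange_incl d L) ⟨1, fun φ => by
      simp [hiso]⟩ φ
  have hext : ∀ S S' : HSpace d L →L[ℂ] HSpace d L,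
      (∀ φ, S (incl d L φ) = S' (incl d L φ)) → S = S' := fun S S' h =>
    ContinuousLinearMap.ext_on (s := Set.range (incl d L)) (dense_span_incl d L) (by
      rintro _ ⟨φ, rfl⟩
      exact h φ)
  have hV0 : V 0 = 1 := hext _ _ fun φ => by simp [hV, hzero]
  have hVadd : ∀ s t, V (s + t) = V s * V t := fun s t => hext _ _ fun φ => by
    simp [hV, hadd]
  have hVnorm : ∀ s x, ‖V s x‖ = ‖x‖ := fun s x => by
    refine (denseRange_incl d L).induction_on (p := fun x => ‖V s x‖ = ‖x‖) x
      (isClosed_eq (by fun_prop) (by fun_prop)) fun φ => ?_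
    rw [hV, hiso]
  have hVu : ∀ s, V s ∈ unitary (HSpace d L →L[ℂ] HSpace d L) := fun s => by
    have h1 : star (V s) * V s = 1 := by
      rw [ContinuousLinearMap.star_eq_adjoint]
      exact (ContinuousLinearMap.norm_map_iff_adjoint_comp_self (V s)).1 (hVnorm s)
    have h2 : V s * V (-s) = 1 := by rw [← hVadd]; simp [hV0]
    have h3 : star (V s) = V (-s) := by
      calc star (V s) = star (V s) * (V s * V (-s)) := by rw [h2, mul_one]
        _ = V (-s) := by rw [← mul_assoc, h1, one_mul]
    rw [Unitary.mem_iff]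
    exact ⟨h1, by rw [h3, h2]⟩
  have hVder : ∀ φ s, HasDerivAt (fun s => V s (incl d L φ))
      (Complex.I • V s (incl d L (T φ))) s := fun φ s => by
    have h1 : HasFDerivAt (V s) ((V s).restrictScalars ℝ) (incl d L (w (s - s) φ)) :=
      ((V s).restrictScalars ℝ).hasFDerivAt
    have h2 : HasDerivAt (fun r => incl d L (w r φ)) (Complex.I • incl d L (T φ)) (s - s) := by
      rw [sub_self]
      exact hder φ
    have h4 := h1.comp_hasDerivAt s (h2.comp_sub_const s s)
    simp only [ContinuousLinearMap.coe_restrictScalars', map_smul] at h4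
    refine h4.congr_of_eventuallyEq (Eventually.of_forall fun r => ?_)
    simp only [Function.comp_apply]
    rw [← hV, ← mul_apply_eq_comp, ← hVadd]
    simp
  have hVcont : ∀ ψ, Continuous fun s => V s ψ := fun ψ => by
    refine continuous_of_uniform_approx_of_continuous fun u hu => ?_
    obtain ⟨ε, hε, hεu⟩ := Metric.mem_uniformity_dist.1 hu
    obtain ⟨φ, hφ⟩ := (denseRange_incl d L).exists_dist_lt ψ hε
    refine ⟨fun s => V s (incl d L φ),
      continuous_iff_continuousAt.2 fun s => (hVder φ s).continuousAt, fun s => hεu ?_⟩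
    rw [dist_eq_norm, ← map_sub, hVnorm, ← dist_eq_norm]
    exact hφ
  have hVgroup : IsUnitaryGroup (onSchwartz T).closure V := by
    refine ⟨hV0, hVadd, hVu, hVcont, fun ψ => ?_⟩
    refine hasDerivAt_of_mem_closure hV0 hVu hVcont ?_ (mem_closure_graph_onSchwartz ψ)
    rintro _ ⟨φ, rfl⟩ s
    exact hVder φ s
  have hW : IsUnitaryGroup (onSchwartz T).closure (expI (onSchwartz T).closure) :=
    isUnitaryGroup_expI ⟨V, hVgroup⟩
  have hW' : ∀ φ s, HasDerivAt (fun s => expI (onSchwartz T).closure s (incl d L φ))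
      (Complex.I • expI (onSchwartz T).closure s (incl d L (T φ))) s := fun φ s => by
    obtain ⟨h1, h2⟩ := onSchwartz_closure_apply T φ
    rw [← h2]
    exact hW.hasDerivAt_apply ⟨_, h1⟩ s
  -- `w s` preserves the Schwartz space and commutes with `T`, so both arguments stay in the domain
  -- and the symmetry of the generator gives the weak agreement that uniqueness needs.
  have heq : expI (onSchwartz T).closure = V := by
    refine unitaryGroup_eq (dense_span_incl d L) (dense_span_incl d L) hW.mem_unitary
      (hV0.trans hW.zero.symm) hW' hVder fun φ ψ s => ?_
    rw [hV, hV, ← hcomm, hW.inner_left, hW.inner_left]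
    obtain ⟨h1, h2⟩ := onSchwartz_closure_apply T φ
    obtain ⟨h3, h4⟩ := onSchwartz_closure_apply T (w s ψ)
    rw [← h2, ← h4]
    exact hW.inner_generator ⟨_, h1⟩ ⟨_, h3⟩ (-s)
  exact ⟨hW, fun s φ => by rw [heq, hV]⟩

end Schwartz

/-! ### Occupation numbers and convergence of Gibbs sums -/

section MultiIndex

variable {ι : Type} [Fintype ι] [DecidableEq ι]

theorem sub_add_single {α : ι → ℕ} {k : ι} (hk : α k ≠ 0) :
    α - Pi.single k 1 + Pi.single k 1 = α := by
  funext j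
  by_cases hj : j = k
  · subst hj
    simp
    omega
  · simp [hj]

theorem cast_sub_single_add_one {α : ι → ℕ} {k : ι} (hk : α k ≠ 0) :
    (((α - Pi.single k 1 : ι → ℕ) k : ℝ) + 1) = α k := by
  have : ((α - Pi.single k 1 : ι → ℕ) k) + 1 = α k := by
    simp
    omega
  exact_mod_cast this

theorem multiIndex_induction {P : (ι → ℕ) → Prop} (h0 : P 0)
    (hs : ∀ α k, P α → P (α + Pi.single k 1)) (α : ι → ℕ) : P α := by
  induction hn : ∑ k, α k generalizing α with
  | zero =>
    have : α = 0 := by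
      funext k
      simpa using (Finset.sum_eq_zero_iff.1 hn) k (Finset.mem_univ k)
    rwa [this]
  | succ n ih =>
    obtain ⟨k, -, hk⟩ : ∃ k ∈ Finset.univ, α k ≠ 0 := by
      by_contra hcon
      push Not at hcon
      rw [Finset.sum_eq_zero hcon] at hn
      omega
    have hα := (sub_add_single hk).symm
    have hsum : ∑ j, α j = ∑ j, (α - Pi.single k 1 : ι → ℕ) j + 1 := by
      conv_lhs => rw [hα]
      simp [Finset.sum_add_distrib]
    rw [hα]
    exact hs _ _ (ih _ (by omega))

/-- A product of nonnegative summable sequences is summable over multi-indices. -/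
theorem summable_prod_multiIndex {f : ι → ℕ → ℝ} (hf : ∀ k n, 0 ≤ f k n)
    (hs : ∀ k, Summable (f k)) : Summable fun α : ι → ℕ => ∏ k, f k (α k) := by
  refine summable_of_sum_le (c := ∏ k, ∑' n, f k n)
    (fun α => Finset.prod_nonneg fun k _ => hf k _) fun S => ?_
  let N : ℕ := S.sup fun α => ∑ k, α k
  have hS : S ⊆ Fintype.piFinset fun _ => Finset.range (N + 1) := fun α hα => by
    rw [Fintype.mem_piFinset]
    intro k
    rw [Finset.mem_range]
    have h1 : ∑ k, α k ≤ N := Finset.le_sup (f := fun α : ι → ℕ => ∑ k, α k) hα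
    have h2 : α k ≤ ∑ k, α k := Finset.single_le_sum (fun _ _ => Nat.zero_le _) (Finset.mem_univ k)
    omega
  calc ∑ α ∈ S, ∏ k, f k (α k)
      ≤ ∑ α ∈ Fintype.piFinset fun _ => Finset.range (N + 1), ∏ k, f k (α k) :=
        Finset.sum_le_sum_of_subset_of_nonneg hS fun α _ _ =>
          Finset.prod_nonneg fun k _ => hf k _
    _ = ∏ k, ∑ n ∈ Finset.range (N + 1), f k n :=
        (Finset.prod_univ_sum (fun _ => Finset.range (N + 1)) f).symm
    _ ≤ ∏ k, ∑' n, f k n := Finset.prod_le_prod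
        (fun k _ => Finset.sum_nonneg fun n _ => hf k n)
        fun k _ => (hs k).sum_le_tsum _ fun n _ => hf k n

theorem summable_exp_neg_odd_mul {x : ℝ} (hx : 0 < x) :
    Summable fun n : ℕ => Real.exp (-(x * (2 * n + 1))) * (n + 1) := by
  have hr : ‖Real.exp (-(2 * x))‖ < 1 := by
    rw [Real.norm_eq_abs, Real.abs_exp, Real.exp_lt_one_iff]
    linarith
  have h1 := (summable_pow_mul_geometric_of_norm_lt_one 1 hr).add
    (summable_geometric_of_norm_lt_one hr)
  refine (h1.mul_left (Real.exp (-x))).congr fun n => ?_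
  have h2 : Real.exp (-(x * (2 * n + 1))) = Real.exp (-x) * Real.exp (-(2 * x)) ^ n := by
    rw [← Real.exp_nat_mul, ← Real.exp_add]
    ring_nf
  rw [h2]
  ring

/-- The eigenvalues `∑ₖ γₖ (2 αₖ + 1)` of a system of harmonic oscillators. -/
def energy (γ : ι → ℝ) (α : ι → ℕ) : ℝ := ∑ k, γ k * (2 * α k + 1)

theorem energy_nonneg {γ : ι → ℝ} (hγ : ∀ k, 0 < γ k) (α : ι → ℕ) : 0 ≤ energy γ α :=
  Finset.sum_nonneg fun k _ => mul_nonneg (hγ k).le (by positivity)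

theorem energy_add_single (γ : ι → ℝ) (α : ι → ℕ) (k : ι) :
    energy γ (α + Pi.single k 1) = energy γ α + 2 * γ k := by
  unfold energy
  rw [← sub_eq_iff_eq_add', ← Finset.sum_sub_distrib]
  rw [Finset.sum_eq_single k]
  · simp
    ring
  · intro j _ hj
    simp [hj]
  · simp

/-- The weight `α k + 1` bounds the norms of `a k` and `c k` on occupation vectors, so this controls
all thermal sums containing one ladder operator. The comparison series has a factor `αⱼ + 1 ≥ 1` in
every mode and factorizes over the modes. -/
theorem summable_exp_energy_mul {γ : ι → ℝ} (hγ : ∀ k, 0 < γ k) {β : ℝ} (hβ : 0 < β) (k : ι) :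
    Summable fun α : ι → ℕ => Real.exp (-(β * energy γ α)) * (α k + 1) := by
  have h1 := summable_prod_multiIndex
    (f := fun k n => Real.exp (-((β * γ k) * (2 * n + 1))) * ((n : ℝ) + 1))
    (fun k n => by positivity) (fun k => summable_exp_neg_odd_mul (mul_pos hβ (hγ k)))
  refine Summable.of_nonneg_of_le (fun α => by positivity) (fun α => ?_) h1
  rw [Finset.prod_mul_distrib, ← Real.exp_sum]
  have h2 : ∑ x, -(β * γ x * (2 * (α x : ℝ) + 1)) = -(β * energy γ α) := by
    rw [energy, Finset.mul_sum, Finset.sum_neg_distrib]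
    congr 1
    exact Finset.sum_congr rfl fun j _ => by ring
  rw [h2]
  gcongr
  rw [← Finset.mul_prod_erase _ _ (Finset.mem_univ k)]
  refine le_mul_of_one_le_right (by positivity) ?_
  exact Finset.one_le_prod fun j _ => by simp

theorem summable_exp_energy {γ : ι → ℝ} (hγ : ∀ k, 0 < γ k) {β : ℝ} (hβ : 0 < β) :
    Summable fun α : ι → ℕ => Real.exp (-(β * energy γ α)) := by
  have h1 := summable_prod_multiIndex
    (f := fun k n => Real.exp (-((β * γ k) * (2 * n + 1))) * ((n : ℝ) + 1))
    (fun k n => by positivity) (fun k => summable_exp_neg_odd_mul (mul_pos hβ (hγ k)))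
  refine Summable.of_nonneg_of_le (fun α => by positivity) (fun α => ?_) h1
  rw [Finset.prod_mul_distrib, ← Real.exp_sum]
  have h2 : ∑ x, -(β * γ x * (2 * (α x : ℝ) + 1)) = -(β * energy γ α) := by
    rw [energy, Finset.mul_sum, Finset.sum_neg_distrib]
    congr 1
    exact Finset.sum_congr rfl fun j _ => by ring
  rw [h2]
  refine le_mul_of_one_le_right (by positivity) ?_
  exact Finset.one_le_prod fun j _ => by simp

end MultiIndex

/-! ### Canonical commutation relations and the occupation number basis -/

section Ladder

variable {E : Type} [NormedAddCommGroup E] [InnerProductSpace ℂ E] [CompleteSpace E]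
variable {D : Type} [AddCommGroup D] [Module ℂ D]
variable {ι : Type} [Fintype ι] [DecidableEq ι]

/-- Annihilation operators `a k`, creation operators `c k` and a cyclic vacuum vector `Ω`, on a
common domain `D` embedded into a Hilbert space by `J`. -/
structure IsLadderSystem (J : D →ₗ[ℂ] E) (a c : ι → D →ₗ[ℂ] D) (Ω : D) : Prop where
  adj : ∀ k φ ψ, inner ℂ (J (c k φ)) (J ψ) = inner ℂ (J φ) (J (a k ψ))
  ccr : ∀ k l ψ, a k (c l ψ) = c l (a k ψ) + if k = l then ψ else 0
  comm : ∀ k l ψ, c k (c l ψ) = c l (c k ψ)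
  vac : ∀ k, a k Ω = 0
  norm_vac : ‖J Ω‖ = 1
  cyclic : ∀ S : Submodule ℂ D, Ω ∈ S → (∀ k, ∀ φ ∈ S, a k φ ∈ S ∧ c k φ ∈ S) →
    ∀ x : E, (∀ φ ∈ S, inner ℂ (J φ) x = 0) → x = 0

namespace IsLadderSystem

variable {J : D →ₗ[ℂ] E} {a c : ι → D →ₗ[ℂ] D} {Ω : D}

theorem adj' (h : IsLadderSystem J a c Ω) (k : ι) (φ ψ : D) :
    inner ℂ (J (a k φ)) (J ψ) = inner ℂ (J φ) (J (c k ψ)) := by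
  rw [← inner_conj_symm, ← h.adj, inner_conj_symm]

theorem pairwise_commute_pow (h : IsLadderSystem J a c Ω) :
    Pairwise fun k l => ∀ x y : Multiplicative ℕ,
      Commute (powersHom (Module.End ℂ D) (c k) x) (powersHom (Module.End ℂ D) (c l) y) := by
  intro k l _ x y
  have : Commute (c k : Module.End ℂ D) (c l) := LinearMap.ext (h.comm k l)
  simpa [powersHom_apply] using this.pow_pow _ _

/-- The products of creation operators. -/
def creation (h : IsLadderSystem J a c Ω) : (ι → Multiplicative ℕ) →* Module.End ℂ D :=
  MonoidHom.noncommPiCoprod (fun k => powersHom (Module.End ℂ D) (c k)) h.pairwise_commute_pow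

/-- The normalized vector `∏ₖ (αₖ!)^{-1/2} (cₖ)^{αₖ} Ω`. -/
def vec (h : IsLadderSystem J a c Ω) (α : ι → ℕ) : D :=
  ((∏ k, √((α k).factorial : ℝ) : ℝ) : ℂ)⁻¹ • h.creation (fun k => Multiplicative.ofAdd (α k)) Ω

theorem vec_zero (h : IsLadderSystem J a c Ω) : h.vec 0 = Ω := by
  have : h.creation (fun k => Multiplicative.ofAdd ((0 : ι → ℕ) k)) = 1 := map_one h.creation
  rw [vec, this]
  simp

theorem creation_add_single (h : IsLadderSystem J a c Ω) (α : ι → ℕ) (k : ι) :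
    h.creation (fun j => Multiplicative.ofAdd ((α + Pi.single k 1 : ι → ℕ) j)) =
      c k * h.creation (fun j => Multiplicative.ofAdd (α j)) := by
  have h1 : (fun j => Multiplicative.ofAdd ((α + Pi.single k 1 : ι → ℕ) j)) =
      Pi.mulSingle k (Multiplicative.ofAdd 1) * fun j => Multiplicative.ofAdd (α j) := by
    funext j
    by_cases hj : j = k
    · subst hj
      simp [mul_comm]
    · simp [hj]
  rw [h1, map_mul]
  congr 1
  refine (MonoidHom.noncommPiCoprod_mulSingle _ k _).trans ?_
  simp

theorem c_vec (h : IsLadderSystem J a c Ω) (α : ι → ℕ) (k : ι) :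
    c k (h.vec α) = ((√((α k : ℝ) + 1) : ℝ) : ℂ) • h.vec (α + Pi.single k 1) := by
  have h1 : ∏ j, √(((α + Pi.single k 1 : ι → ℕ) j).factorial : ℝ) =
      √((α k : ℝ) + 1) * ∏ j, √((α j).factorial : ℝ) := by
    rw [← Finset.mul_prod_erase _ _ (Finset.mem_univ k),
      ← Finset.mul_prod_erase Finset.univ (fun j => √((α j).factorial : ℝ)) (Finset.mem_univ k),
      ← mul_assoc, ← Real.sqrt_mul (by positivity)]
    congr 1
    · simp [Nat.factorial_succ]
    · refine Finset.prod_congr rfl fun j hj => ?_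
      simp [(Finset.mem_erase.1 hj).1]
  have h2 : ((√((α k : ℝ) + 1) : ℝ) : ℂ) ≠ 0 :=
    Complex.ofReal_ne_zero.2 (Real.sqrt_pos.2 (by positivity)).ne'
  rw [vec, vec, h1, creation_add_single, map_smul, smul_smul]
  congr 1
  push_cast
  rw [mul_inv, ← mul_assoc, mul_inv_cancel₀ h2, one_mul]

/-- Induction on `α`, moving `a k` past one creation operator by the commutation relation. The
truncated subtraction in the index is harmless: when `α k = 0` the coefficient vanishes. -/
theorem a_vec (h : IsLadderSystem J a c Ω) (α : ι → ℕ) (k : ι) :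
    a k (h.vec α) = ((√(α k : ℝ) : ℝ) : ℂ) • h.vec (α - Pi.single k 1) := by
  induction α using multiIndex_induction with
  | h0 => simp [vec_zero, h.vac]
  | hs α l ih =>
    have h2 : ((√((α l : ℝ) + 1) : ℝ) : ℂ) ≠ 0 :=
      Complex.ofReal_ne_zero.2 (Real.sqrt_pos.2 (by positivity)).ne'
    have h3 : ((√((α l : ℝ) + 1) : ℝ) : ℂ) • a k (h.vec (α + Pi.single l 1)) =
        c l (a k (h.vec α)) + if k = l then h.vec α else 0 := by
      rw [← map_smul, ← c_vec, h.ccr]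
    have h4 : a k (h.vec (α + Pi.single l 1)) = ((√((α l : ℝ) + 1) : ℝ) : ℂ)⁻¹ •
        (c l (a k (h.vec α)) + if k = l then h.vec α else 0) := by
      rw [← h3, smul_smul, inv_mul_cancel₀ h2, one_smul]
    rw [h4, inv_smul_eq_iff₀ h2, ih, map_smul]
    by_cases hkl : k = l
    · subst hkl
      have h7 : ((√((α k : ℝ) + 1) : ℝ) : ℂ) * ((√((α k : ℝ) + 1) : ℝ) : ℂ) = (α k : ℂ) + 1 := by
        rw [← Complex.ofReal_mul, Real.mul_self_sqrt (by positivity)]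
        push_cast
        rfl
      have h8 : α + Pi.single k 1 - Pi.single k 1 = α := by simp
      have h9 : ((√(((α + Pi.single k 1 : ι → ℕ) k : ℕ) : ℝ) : ℝ) : ℂ) = ((√((α k : ℝ) + 1) : ℝ) : ℂ) := by
        simp
      rw [if_pos rfl, h8, h9, smul_smul, h7]
      by_cases h0 : α k = 0
      · simp [h0]
      · rw [c_vec, sub_add_single h0, cast_sub_single_add_one h0, smul_smul, ← Complex.ofReal_mul, Real.mul_self_sqrt (by positivity),
          add_smul, one_smul]
        norm_cast
    · have h5 : α - Pi.single k 1 + Pi.single l 1 = α + Pi.single l 1 - Pi.single k 1 := by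
        funext j
        by_cases hj : j = k
        · subst hj
          simp [hkl]
        · simp [hj]
      rw [if_neg hkl, add_zero, c_vec, h5, smul_smul, smul_smul, mul_comm]
      have h6 : (α - Pi.single k 1 : ι → ℕ) l = α l := by simp [Ne.symm hkl]
      have h7 : (α + Pi.single l 1 : ι → ℕ) k = α k := by simp [hkl]
      rw [h6, h7]

theorem c_a_vec (h : IsLadderSystem J a c Ω) (α : ι → ℕ) (k : ι) :
    c k (a k (h.vec α)) = (α k : ℂ) • h.vec α := by
  rw [a_vec, map_smul, c_vec]
  by_cases h0 : α k = 0
  · simp [h0]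
  · rw [sub_add_single h0, cast_sub_single_add_one h0, smul_smul, ← Complex.ofReal_mul, Real.mul_self_sqrt (by positivity)]
    norm_cast

/-- Norms follow by induction from `‖c v‖² = ⟨v, a c v⟩ = α k + 1`. Distinct multi-indices differ in
some `k`, and the two vectors are then eigenvectors of the symmetric operator `c k ∘ a k` for
different eigenvalues. -/
theorem orthonormal_vec (h : IsLadderSystem J a c Ω) : Orthonormal ℂ fun α => J (h.vec α) := by
  constructor
  · intro α
    induction α using multiIndex_induction with
    | h0 => simp only [vec_zero, h.norm_vac]
    | hs α k ih =>
      have h1 : inner ℂ (J (c k (h.vec α))) (J (c k (h.vec α))) = (α k : ℂ) + 1 := by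
        simp only at ih
        rw [h.adj, h.ccr, if_pos rfl, c_a_vec, map_add, map_smul, inner_add_right,
          inner_smul_right, inner_self_eq_norm_sq_to_K, ih]
        simp
      rw [c_vec, map_smul, inner_smul_left, inner_smul_right, inner_self_eq_norm_sq_to_K,
        Complex.conj_ofReal, ← mul_assoc, ← Complex.ofReal_mul,
        Real.mul_self_sqrt (by positivity)] at h1
      have h2 : (((α k : ℝ) + 1) * ‖J (h.vec (α + Pi.single k 1))‖ ^ 2 : ℝ) = (α k : ℝ) + 1 := by
        apply Complex.ofReal_injective
        push_cast
        simpa using h1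
      have h3 : ‖J (h.vec (α + Pi.single k 1))‖ ^ 2 = 1 := by
        have : (α k : ℝ) + 1 ≠ 0 := by positivity
        exact mul_left_cancel₀ this (h2.trans (mul_one _).symm)
      exact (pow_eq_one_iff_of_nonneg (norm_nonneg _) two_ne_zero).1 h3
  · intro α β hαβ
    obtain ⟨k, hk⟩ := Function.ne_iff.1 hαβ
    have h1 : inner ℂ (J (c k (a k (h.vec α)))) (J (h.vec β)) =
        inner ℂ (J (h.vec α)) (J (c k (a k (h.vec β)))) := by
      rw [h.adj, h.adj']
    rw [c_a_vec, c_a_vec, map_smul, map_smul, inner_smul_left, inner_smul_right,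
      Complex.conj_natCast] at h1
    have h2 : ((α k : ℂ) - β k) * inner ℂ (J (h.vec α)) (J (h.vec β)) = 0 := by
      linear_combination h1
    exact (mul_eq_zero.1 h2).resolve_left (sub_ne_zero.2 (by exact_mod_cast hk))

/-- The Hilbert basis of the normalized products of creation operators applied to the vacuum. -/
def basis (h : IsLadderSystem J a c Ω) : HilbertBasis (ι → ℕ) ℂ E :=
  HilbertBasis.mkOfOrthogonalEqBot h.orthonormal_vec (by
    rw [Submodule.eq_bot_iff]
    intro x hx
    refine h.cyclic (Submodule.span ℂ (Set.range h.vec)) ?_ ?_ x fun φ hφ => ?_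
    · exact Submodule.subset_span ⟨0, h.vec_zero⟩
    · intro k φ hφ
      induction hφ using Submodule.span_induction with
      | mem y hy =>
        obtain ⟨α, rfl⟩ := hy
        rw [a_vec, c_vec]
        exact ⟨Submodule.smul_mem _ _ (Submodule.subset_span ⟨_, rfl⟩),
          Submodule.smul_mem _ _ (Submodule.subset_span ⟨_, rfl⟩)⟩
      | zero => simp
      | add y z _ _ hy hz =>
        rw [map_add, map_add]
        exact ⟨add_mem hy.1 hz.1, add_mem hy.2 hz.2⟩
      | smul r y _ hy =>
        rw [map_smul, map_smul]
        exact ⟨Submodule.smul_mem _ _ hy.1, Submodule.smul_mem _ _ hy.2⟩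
    · refine (Submodule.mem_orthogonal _ _).1 hx _ ?_
      have : J φ ∈ Submodule.map J (Submodule.span ℂ (Set.range h.vec)) := ⟨φ, hφ, rfl⟩
      rwa [Submodule.map_span, ← Set.range_comp] at this)

theorem basis_apply (h : IsLadderSystem J a c Ω) (α : ι → ℕ) : h.basis α = J (h.vec α) := by
  simp [basis]

theorem sum_ca_vec (h : IsLadderSystem J a c Ω) (γ : ι → ℝ) (α : ι → ℕ) :
    ∑ k, (γ k : ℂ) • ((2 : ℂ) • c k (a k (h.vec α)) + h.vec α) = (energy γ α : ℂ) • h.vec α := by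
  simp only [c_a_vec, energy]
  push_cast
  rw [Finset.sum_smul]
  refine Finset.sum_congr rfl fun k _ => ?_
  module

end IsLadderSystem

end Ladder

/-! ### Weyl operators over a ladder system -/

section WeylGroups

variable {E : Type} [NormedAddCommGroup E] [InnerProductSpace ℂ E] [CompleteSpace E]
variable {D : Type} [AddCommGroup D] [Module ℂ D]
variable {ι : Type} [Fintype ι] [DecidableEq ι]
variable {J : D →ₗ[ℂ] E} {a c : ι → D →ₗ[ℂ] D} {Ω : D}

/-- The field operator `∑ₖ (conj ζₖ aₖ + ζₖ cₖ)`. -/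
def fieldOp (a c : ι → D →ₗ[ℂ] D) (ζ : ι → ℂ) : D →ₗ[ℂ] D :=
  ∑ k, (starRingEnd ℂ (ζ k) • a k + ζ k • c k)

theorem fieldOp_apply (ζ : ι → ℂ) (φ : D) :
    fieldOp a c ζ φ = ∑ k, (starRingEnd ℂ (ζ k) • a k φ + ζ k • c k φ) := by
  simp [fieldOp]

/-- `W` is the group `s ↦ exp(i s ∑ₖ (conj ζₖ aₖ + ζₖ cₖ))`, which restricts to the group `w` on
the domain `D` and shifts the ladder operators. -/
structure IsWeylGroup (J : D →ₗ[ℂ] E) (a c : ι → D →ₗ[ℂ] D) (ζ : ι → ℂ) (W : ℝ → E →L[ℂ] E)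
    (w : ℝ → D →ₗ[ℂ] D) : Prop where
  zero : W 0 = 1
  mem_unitary : ∀ s, W s ∈ unitary (E →L[ℂ] E)
  apply : ∀ s φ, W s (J φ) = J (w s φ)
  hasDerivAt : ∀ φ s, HasDerivAt (fun s => W s (J φ)) (Complex.I • W s (J (fieldOp a c ζ φ))) s
  a_apply : ∀ k s φ, a k (w s φ) = w s (a k φ) + (Complex.I * s * ζ k) • w s φ
  c_apply : ∀ k s φ, c k (w s φ) = w s (c k φ) - (Complex.I * s * starRingEnd ℂ (ζ k)) • w s φ

variable {ζ : ι → ℂ} {W : ℝ → E →L[ℂ] E} {w : ℝ → D →ₗ[ℂ] D}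

/-- The shifts of `a k` and `c k` enter with coefficients `conj ζ · ζ` and `-ζ · conj ζ` and cancel.
-/
theorem IsWeylGroup.fieldOp_comm (hW : IsWeylGroup J a c ζ W w) (s : ℝ) (φ : D) :
    fieldOp a c ζ (w s φ) = w s (fieldOp a c ζ φ) := by
  rw [fieldOp_apply, fieldOp_apply, map_sum]
  refine Finset.sum_congr rfl fun k _ => ?_
  rw [hW.a_apply, hW.c_apply, map_add, map_smul, map_smul]
  module

/-! ### Heisenberg evolution of Weyl operators -/

section Heisenberg

variable {A : E →ₗ.[ℂ] E} {γ : ι → ℝ}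

/-- The reindexing behind both the time evolution and the KMS relations: a sum containing `a k`
vanishes at `α k = 0`, and the shift turns it into a sum containing `c k`. -/
theorem tsum_eq_tsum_add_single (k : ι) {f : (ι → ℕ) → ℂ} (hf : ∀ α, α k = 0 → f α = 0) :
    ∑' α, f α = ∑' α : ι → ℕ, f (α + Pi.single k 1) := by
  refine ((add_left_injective (Pi.single k 1)).tsum_eq (fun α hα => ?_)).symm
  have h0 : α k ≠ 0 := fun h0 => hα (hf α h0)
  exact ⟨α - Pi.single k 1, sub_add_single h0⟩

/-- In the eigenbasis `a k` lowers the energy by `2 γ k`, which produces the phase. The statement is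
weak because `expI A t` need not map the image of `D` into itself, so `a k` cannot be applied after
the evolution. -/
theorem inner_c_evolution (h : IsLadderSystem J a c Ω) (hA : IsDiagonalIn A h.basis (energy γ))
    (t : ℝ) (k : ι) (η ξ : D) : inner ℂ (J (c k η)) (expI A t (J ξ)) =
      Complex.exp ((t * (2 * γ k) : ℝ) * Complex.I) * inner ℂ (J η) (expI A t (J (a k ξ))) := by
  rw [← (h.basis.hasSum_inner_mul_inner _ _).tsum_eq,
    ← (h.basis.hasSum_inner_mul_inner (J η) _).tsum_eq, ← tsum_mul_left]
  simp only [hA.inner_expI]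
  simp only [h.basis_apply, h.adj]
  simp only [← h.adj _ (h.vec _) ξ]
  rw [tsum_eq_tsum_add_single k (fun α h0 => by simp [h.a_vec, h0])]
  refine tsum_congr fun α => ?_
  rw [energy_add_single, h.a_vec, h.c_vec]
  have h8 : α + Pi.single k 1 - Pi.single k 1 = α := by simp
  have h9 : ((√(((α + Pi.single k 1 : ι → ℕ) k : ℕ) : ℝ) : ℝ) : ℂ) =
      ((√((α k : ℝ) + 1) : ℝ) : ℂ) := by
    simp
  rw [h8, h9, map_smul, map_smul, inner_smul_left, inner_smul_right, Complex.conj_ofReal,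
    mul_add, Complex.ofReal_add, add_mul, Complex.exp_add]
  ring

theorem inner_a_evolution (h : IsLadderSystem J a c Ω) (hA : IsDiagonalIn A h.basis (energy γ))
    (t : ℝ) (k : ι) (η ξ : D) : inner ℂ (J (a k η)) (expI A t (J ξ)) =
      Complex.exp (-((t * (2 * γ k) : ℝ) * Complex.I)) *
        inner ℂ (J η) (expI A t (J (c k ξ))) := by
  have hU := isUnitaryGroup_expI ⟨_, hA.isUnitaryGroup⟩
  have h1 := inner_c_evolution h hA (-t) k ξ η
  have h2 := congrArg (starRingEnd ℂ) h1
  rw [map_mul, inner_conj_symm, inner_conj_symm, hU.inner_left, hU.inner_left, neg_neg] at h2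
  rw [h2, ← mul_assoc, ← Complex.exp_conj, ← Complex.exp_add, map_mul, Complex.conj_ofReal,
    Complex.conj_I]
  simp

theorem inner_fieldOp_evolution (h : IsLadderSystem J a c Ω)
    (hA : IsDiagonalIn A h.basis (energy γ)) (t : ℝ) (η ξ : D) :
    inner ℂ (J (fieldOp a c (fun k => Complex.exp ((t * (2 * γ k) : ℝ) * Complex.I) * ζ k) η))
        (expI A t (J ξ)) = inner ℂ (J η) (expI A t (J (fieldOp a c ζ ξ))) := by
  simp only [fieldOp_apply, map_sum, sum_inner, inner_sum, map_add, map_smul, inner_add_left,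
    inner_add_right, inner_smul_left, inner_smul_right]
  refine Finset.sum_congr rfl fun k _ => ?_
  have h1 : Complex.exp (-((t * (2 * γ k) : ℝ) * Complex.I)) *
      Complex.exp ((t * (2 * γ k) : ℝ) * Complex.I) = 1 := by
    rw [← Complex.exp_add]
    simp
  have h2 : starRingEnd ℂ (Complex.exp ((t * (2 * γ k) : ℝ) * Complex.I)) =
      Complex.exp (-((t * (2 * γ k) : ℝ) * Complex.I)) := by
    rw [← Complex.exp_conj, map_mul, Complex.conj_ofReal, Complex.conj_I, mul_neg]
  rw [inner_a_evolution h hA, inner_c_evolution h hA, Complex.conj_conj, map_mul, h2]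
  linear_combination (ζ k * inner ℂ (J η) (expI A t (J (c k ξ))) +
    starRingEnd ℂ (ζ k) * inner ℂ (J η) (expI A t (J (a k ξ)))) * h1

/-- The Heisenberg evolution of a Weyl operator is a Weyl operator. -/
theorem evolution_weyl (h : IsLadderSystem J a c Ω) (hA : IsDiagonalIn A h.basis (energy γ))
    (t : ℝ) {W' : ℝ → E →L[ℂ] E} {w' : ℝ → D →ₗ[ℂ] D} (hW : IsWeylGroup J a c ζ W w)
    (hW' : IsWeylGroup J a c (fun k => Complex.exp ((t * (2 * γ k) : ℝ) * Complex.I) * ζ k) W' w')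
    (s : ℝ) : expI A t * W s * expI A (-t) = W' s := by
  have hU := isUnitaryGroup_expI ⟨_, hA.isUnitaryGroup⟩
  have hinv : ∀ x, expI A (-t) (expI A t x) = x := fun x => by
    rw [← mul_apply_eq_comp, ← hU.add]
    simp [hU.zero]
  have hdense : Dense (Submodule.span ℂ (Set.range h.basis) : Set E) := by
    rw [dense_iff_closure_eq, ← Submodule.topologicalClosure_coe, h.basis.dense_span]
    rfl
  -- Uniqueness is tested on eigenvectors, since `expI A (-t)` only multiplies them by the phase `κ
  -- α` and so keeps them in the image of `D`, where `W` is known.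
  let κ : (ι → ℕ) → ℂ := fun α => Complex.exp (((-t) * energy γ α : ℝ) * Complex.I)
  have hκ : ∀ α, expI A (-t) (h.basis α) = J (κ α • h.vec α) := fun α => by
    rw [hA.expI_apply, map_smul, h.basis_apply]
  have key := unitaryGroup_eq (U := W') (V := fun s => expI A t * W s * expI A (-t))
    (φ := fun η : Submodule.span ℂ (Set.range h.vec) => J η)
    (φ' := fun η => J (fieldOp a c (fun k => Complex.exp ((t * (2 * γ k) : ℝ) * Complex.I) * ζ k) η))
    (ψ := h.basis) (ψ' := fun α => expI A t (J (fieldOp a c ζ (κ α • h.vec α))))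
    ?_ hdense hW'.mem_unitary ?_ ?_ ?_ ?_
  · exact (congrFun key s).symm
  · refine hdense.mono (Submodule.span_mono ?_)
    rintro _ ⟨α, rfl⟩
    exact ⟨⟨h.vec α, Submodule.subset_span ⟨α, rfl⟩⟩, (h.basis_apply α).symm⟩
  · rw [hW.zero, hW'.zero, mul_one, ← hU.add]
    simp [hU.zero]
  · exact fun η s => hW'.hasDerivAt η s
  · intro α s
    simp only [mul_apply_eq_comp, hκ, hinv]
    have h1 := hW.hasDerivAt (κ α • h.vec α) s
    have h2 : HasFDerivAt (expI A t) ((expI A t).restrictScalars ℝ) (W s (J (κ α • h.vec α))) :=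
      ((expI A t).restrictScalars ℝ).hasFDerivAt
    refine (h2.comp_hasDerivAt s h1).congr_deriv ?_
    simp
  · intro η α s
    simp only [mul_apply_eq_comp, hκ, hinv]
    rw [hW'.apply, hW'.apply, hW.apply, hW.apply, ← hW'.fieldOp_comm, ← hW.fieldOp_comm,
      inner_fieldOp_evolution h hA]

end Heisenberg

/-! ### KMS relations and the Gaussian thermal expectation -/

section Thermal

variable {β : ℝ} {γ : ι → ℝ}

/-- The function `coth (β γ)`, in terms of `e^{-2βγ}`. -/
def cothFactor (β γ : ℝ) : ℝ := (1 + Real.exp (-(2 * β * γ))) / (1 - Real.exp (-(2 * β * γ)))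

theorem norm_a_vec_le (h : IsLadderSystem J a c Ω) (α : ι → ℕ) (k : ι) :
    ‖J (a k (h.vec α))‖ ≤ α k + 1 := by
  rw [h.a_vec, map_smul, norm_smul, h.orthonormal_vec.1, mul_one, Complex.norm_real,
    Real.norm_of_nonneg (Real.sqrt_nonneg _)]
  exact Real.sqrt_le_iff.2 ⟨by positivity, by nlinarith [(α k).cast_nonneg (α := ℝ)]⟩

theorem norm_c_vec_le (h : IsLadderSystem J a c Ω) (α : ι → ℕ) (k : ι) :
    ‖J (c k (h.vec α))‖ ≤ α k + 1 := by
  rw [h.c_vec, map_smul, norm_smul, h.orthonormal_vec.1, mul_one, Complex.norm_real,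
    Real.norm_of_nonneg (Real.sqrt_nonneg _)]
  exact Real.sqrt_le_iff.2 ⟨by positivity, by nlinarith [(α k).cast_nonneg (α := ℝ)]⟩

theorem summable_gibbs_inner {X : Type*} {x : X → ℝ} (hx : ∀ i, 0 ≤ x i) {y : X → ℝ}
    (hy : Summable fun i => x i * y i) {u v : X → E} (hu : ∀ i, ‖u i‖ = 1) (hv : ∀ i, ‖v i‖ ≤ y i) :
    Summable fun i => (x i : ℂ) * inner ℂ (u i) (v i) := by
  refine Summable.of_norm_bounded hy fun i => ?_
  rw [norm_mul, Complex.norm_real, Real.norm_of_nonneg (hx i)]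
  refine mul_le_mul_of_nonneg_left ((norm_inner_le_norm _ _).trans ?_) (hx i)
  rw [hu, one_mul]
  exact hv i

/-- The Gibbs weights. -/
def gibbs (β : ℝ) (γ : ι → ℝ) (α : ι → ℕ) : ℝ := Real.exp (-(β * energy γ α))

theorem gibbs_add_single (β : ℝ) (γ : ι → ℝ) (α : ι → ℕ) (k : ι) :
    gibbs β γ (α + Pi.single k 1) = Real.exp (-(2 * β * γ k)) * gibbs β γ α := by
  rw [gibbs, gibbs, energy_add_single, ← Real.exp_add]
  ring_nf

theorem gibbs_nonneg (β : ℝ) (γ : ι → ℝ) (α : ι → ℕ) : 0 ≤ gibbs β γ α := (Real.exp_pos _).le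

/-- The KMS relation for an annihilation operator. -/
theorem kms_a (h : IsLadderSystem J a c Ω) (B : E →L[ℂ] E) (k : ι) :
    ∑' α, (gibbs β γ α : ℂ) * inner ℂ (J (h.vec α)) (B (J (a k (h.vec α)))) =
      Real.exp (-(2 * β * γ k)) *
        ∑' α, (gibbs β γ α : ℂ) * inner ℂ (J (c k (h.vec α))) (B (J (h.vec α))) := by
  rw [tsum_eq_tsum_add_single k (fun α h0 => by simp [h.a_vec, h0]), ← tsum_mul_left]
  refine tsum_congr fun α => ?_
  rw [gibbs_add_single, h.a_vec, h.c_vec]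
  have h8 : α + Pi.single k 1 - Pi.single k 1 = α := by simp
  have h9 : ((√(((α + Pi.single k 1 : ι → ℕ) k : ℕ) : ℝ) : ℝ) : ℂ) =
      ((√((α k : ℝ) + 1) : ℝ) : ℂ) := by
    simp
  rw [h8, h9, map_smul, map_smul, map_smul, inner_smul_left, inner_smul_right, Complex.conj_ofReal]
  push_cast
  ring

/-- The KMS relation for a creation operator. -/
theorem kms_c (h : IsLadderSystem J a c Ω) (B : E →L[ℂ] E) (k : ι) :
    ∑' α, (gibbs β γ α : ℂ) * inner ℂ (J (a k (h.vec α))) (B (J (h.vec α))) =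
      Real.exp (-(2 * β * γ k)) *
        ∑' α, (gibbs β γ α : ℂ) * inner ℂ (J (h.vec α)) (B (J (c k (h.vec α)))) := by
  rw [tsum_eq_tsum_add_single k (fun α h0 => by simp [h.a_vec, h0]), ← tsum_mul_left]
  refine tsum_congr fun α => ?_
  rw [gibbs_add_single, h.a_vec, h.c_vec]
  have h8 : α + Pi.single k 1 - Pi.single k 1 = α := by simp
  have h9 : ((√(((α + Pi.single k 1 : ι → ℕ) k : ℕ) : ℝ) : ℝ) : ℂ) =
      ((√((α k : ℝ) + 1) : ℝ) : ℂ) := by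
    simp
  rw [h8, h9, map_smul, map_smul, map_smul, inner_smul_left, inner_smul_right, Complex.conj_ofReal]
  push_cast
  ring

/-- The unnormalized thermal expectation of a Weyl operator. -/
def weylSum (h : IsLadderSystem J a c Ω) (β : ℝ) (γ : ι → ℝ) (W : E →L[ℂ] E) : ℂ :=
  ∑' α, (gibbs β γ α : ℂ) * inner ℂ (J (h.vec α)) (W (J (h.vec α)))

theorem norm_weyl_apply (hW : IsWeylGroup J a c ζ W w) (s : ℝ) (x : E) : ‖W s x‖ = ‖x‖ :=
  norm_apply_of_mem_unitary (hW.mem_unitary s) x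

theorem summable_weylSum (h : IsLadderSystem J a c Ω) (hβ : 0 < β) (hγ : ∀ k, 0 < γ k)
    (hW : IsWeylGroup J a c ζ W w) (s : ℝ) :
    Summable fun α => (gibbs β γ α : ℂ) * inner ℂ (J (h.vec α)) (W s (J (h.vec α))) := by
  refine summable_gibbs_inner (y := fun _ => 1) (gibbs_nonneg β γ) ?_ h.orthonormal_vec.1
    fun α => ?_
  · simpa [gibbs] using summable_exp_energy hγ hβ
  · rw [norm_weyl_apply hW, h.orthonormal_vec.1]

theorem summable_weyl_a (h : IsLadderSystem J a c Ω) (hβ : 0 < β) (hγ : ∀ k, 0 < γ k)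
    (hW : IsWeylGroup J a c ζ W w) (s : ℝ) (k : ι) :
    Summable fun α => (gibbs β γ α : ℂ) * inner ℂ (J (h.vec α)) (W s (J (a k (h.vec α)))) := by
  refine summable_gibbs_inner (gibbs_nonneg β γ) (summable_exp_energy_mul hγ hβ k)
    h.orthonormal_vec.1 fun α => ?_
  rw [norm_weyl_apply hW]
  exact norm_a_vec_le h α k

theorem summable_weyl_c (h : IsLadderSystem J a c Ω) (hβ : 0 < β) (hγ : ∀ k, 0 < γ k)
    (hW : IsWeylGroup J a c ζ W w) (s : ℝ) (k : ι) :
    Summable fun α => (gibbs β γ α : ℂ) * inner ℂ (J (h.vec α)) (W s (J (c k (h.vec α)))) := by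
  refine summable_gibbs_inner (gibbs_nonneg β γ) (summable_exp_energy_mul hγ hβ k)
    h.orthonormal_vec.1 fun α => ?_
  rw [norm_weyl_apply hW]
  exact norm_c_vec_le h α k

theorem exp_neg_two_mul_lt_one {β γ : ℝ} (hβ : 0 < β) (hγ : 0 < γ) :
    Real.exp (-(2 * β * γ)) < 1 := by
  rw [Real.exp_lt_one_iff]
  have := mul_pos hβ hγ
  nlinarith

/-- In the KMS relation, the creation operator on the left of the inner product moves over as `a k`
and then through `W`, leaving a shift. The sum is thus expressed through itself, and solving for it
gives the factor `1 - exp(-2βγ)`. -/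
theorem tsum_weyl_a (h : IsLadderSystem J a c Ω) (hβ : 0 < β) (hγ : ∀ k, 0 < γ k)
    (hW : IsWeylGroup J a c ζ W w) (s : ℝ) (k : ι) :
    (1 - Real.exp (-(2 * β * γ k)) : ℂ) *
      ∑' α, (gibbs β γ α : ℂ) * inner ℂ (J (h.vec α)) (W s (J (a k (h.vec α)))) =
      Real.exp (-(2 * β * γ k)) * (Complex.I * s * ζ k) * weylSum h β γ (W s) := by
  have h1 : ∑' α, (gibbs β γ α : ℂ) * inner ℂ (J (c k (h.vec α))) (W s (J (h.vec α))) =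
      ∑' α, (gibbs β γ α : ℂ) * inner ℂ (J (h.vec α)) (W s (J (a k (h.vec α)))) +
        (Complex.I * s * ζ k) * weylSum h β γ (W s) := by
    rw [weylSum, ← tsum_mul_left, ← (summable_weyl_a h hβ hγ hW s k).tsum_add
      ((summable_weylSum h hβ hγ hW s).mul_left _)]
    refine tsum_congr fun α => ?_
    rw [hW.apply, hW.apply, h.adj, hW.a_apply, map_add, map_smul, inner_add_right, inner_smul_right]
    ring
  have h2 := kms_a (β := β) (γ := γ) h (W s) k
  rw [h1] at h2
  linear_combination h2

theorem tsum_weyl_c (h : IsLadderSystem J a c Ω) (hβ : 0 < β) (hγ : ∀ k, 0 < γ k)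
    (hW : IsWeylGroup J a c ζ W w) (s : ℝ) (k : ι) :
    (1 - Real.exp (-(2 * β * γ k)) : ℂ) *
      ∑' α, (gibbs β γ α : ℂ) * inner ℂ (J (h.vec α)) (W s (J (c k (h.vec α)))) =
      (Complex.I * s * starRingEnd ℂ (ζ k)) * weylSum h β γ (W s) := by
  have h1 : ∑' α, (gibbs β γ α : ℂ) * inner ℂ (J (a k (h.vec α))) (W s (J (h.vec α))) =
      ∑' α, (gibbs β γ α : ℂ) * inner ℂ (J (h.vec α)) (W s (J (c k (h.vec α)))) -
        (Complex.I * s * starRingEnd ℂ (ζ k)) * weylSum h β γ (W s) := by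
    rw [weylSum, ← tsum_mul_left, ← (summable_weyl_c h hβ hγ hW s k).tsum_sub
      ((summable_weylSum h hβ hγ hW s).mul_left _)]
    refine tsum_congr fun α => ?_
    rw [hW.apply, hW.apply, h.adj', hW.c_apply, map_sub, map_smul, inner_sub_right,
      inner_smul_right]
    ring
  have h2 := kms_c (β := β) (γ := γ) h (W s) k
  rw [h1] at h2
  linear_combination h2

/-- Differentiating term by term, dominated through `summable_exp_energy_mul`, inserts the field
operator. The KMS relations evaluate the contributions of `a k` and `c k` as proportional to
`exp(-2βγ)` and to `1`, both over `1 - exp(-2βγ)`; their sum is the coth factor. -/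
theorem hasDerivAt_weylSum (h : IsLadderSystem J a c Ω) (hβ : 0 < β) (hγ : ∀ k, 0 < γ k)
    (hW : IsWeylGroup J a c ζ W w) (s : ℝ) :
    HasDerivAt (fun s => weylSum h β γ (W s))
      (-((∑ k, ‖ζ k‖ ^ 2 * cothFactor β (γ k) : ℝ) * s * weylSum h β γ (W s))) s := by
  have hsum : ∀ s, Summable fun α =>
      (gibbs β γ α : ℂ) * inner ℂ (J (h.vec α)) (W s (J (h.vec α))) :=
    summable_weylSum h hβ hγ hW
  have hfield : ∀ α, ‖J (fieldOp a c ζ (h.vec α))‖ ≤ ∑ k, 2 * ‖ζ k‖ * (α k + 1) := fun α => by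
    rw [fieldOp_apply, map_sum]
    refine norm_sum_le_of_le _ fun k _ => ?_
    rw [map_add, map_smul, map_smul]
    refine (norm_add_le _ _).trans ?_
    rw [norm_smul, norm_smul, RCLike.norm_conj]
    have h1 := norm_a_vec_le h α k
    have h2 := norm_c_vec_le h α k
    nlinarith [norm_nonneg (ζ k)]
  have hbd : Summable fun α => gibbs β γ α * ∑ k, 2 * ‖ζ k‖ * ((α k : ℝ) + 1) := by
    simp only [Finset.mul_sum]
    refine summable_sum fun k _ => ?_
    refine ((summable_exp_energy_mul hγ hβ k).mul_left (2 * ‖ζ k‖)).congr fun α => ?_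
    rw [gibbs]
    ring
  have hd := hasDerivAt_tsum hbd
    (g := fun α s => (gibbs β γ α : ℂ) * inner ℂ (J (h.vec α)) (W s (J (h.vec α))))
    (g' := fun α s => (gibbs β γ α : ℂ) *
      inner ℂ (J (h.vec α)) (Complex.I • W s (J (fieldOp a c ζ (h.vec α)))))
    (fun α s => by
      have := (hasDerivAt_const s (J (h.vec α))).inner ℂ (hW.hasDerivAt (h.vec α) s)
      simp only [inner_zero_left, add_zero] at this
      exact this.const_mul _)
    (fun α s => by
      rw [norm_mul, Complex.norm_real, Real.norm_of_nonneg (gibbs_nonneg β γ α)]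
      refine mul_le_mul_of_nonneg_left ((norm_inner_le_norm _ _).trans ?_) (gibbs_nonneg β γ α)
      rw [h.orthonormal_vec.1, one_mul, norm_smul, Complex.norm_I, one_mul, norm_weyl_apply hW]
      exact hfield α)
    (hsum 0) s
  refine hd.congr_deriv ?_
  have h1 : ∀ α, (gibbs β γ α : ℂ) *
      inner ℂ (J (h.vec α)) (Complex.I • W s (J (fieldOp a c ζ (h.vec α)))) =
      ∑ k, (Complex.I * starRingEnd ℂ (ζ k) * ((gibbs β γ α : ℂ) *
          inner ℂ (J (h.vec α)) (W s (J (a k (h.vec α))))) +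
        Complex.I * ζ k * ((gibbs β γ α : ℂ) *
          inner ℂ (J (h.vec α)) (W s (J (c k (h.vec α)))))) := fun α => by
    simp only [fieldOp_apply, map_sum, map_add, map_smul, inner_smul_right, inner_sum,
      inner_add_right, Finset.mul_sum]
    refine Finset.sum_congr rfl fun k _ => ?_
    ring
  have hsa := summable_weyl_a h hβ hγ hW s
  have hsc := summable_weyl_c h hβ hγ hW s
  simp only [h1]
  rw [Summable.tsum_finsetSum fun k _ => ((hsa k).mul_left _).add ((hsc k).mul_left _)]
  push_cast
  rw [Finset.sum_mul, Finset.sum_mul, ← Finset.sum_neg_distrib]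
  refine Finset.sum_congr rfl fun k _ => ?_
  rw [((hsa k).mul_left _).tsum_add ((hsc k).mul_left _), tsum_mul_left, tsum_mul_left]
  have hne : (1 - Real.exp (-(2 * β * γ k)) : ℂ) ≠ 0 := by
    have := exp_neg_two_mul_lt_one hβ (hγ k)
    rw [← Complex.ofReal_one, ← Complex.ofReal_sub]
    exact Complex.ofReal_ne_zero.2 (by linarith)
  refine mul_left_cancel₀ hne ?_
  have e1 := tsum_weyl_a h hβ hγ hW s k
  have e2 := tsum_weyl_c h hβ hγ hW s k
  have e3 : (1 - Real.exp (-(2 * β * γ k)) : ℂ) * (cothFactor β (γ k) : ℂ) =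
      1 + Real.exp (-(2 * β * γ k)) := by
    rw [cothFactor]
    push_cast at hne ⊢
    field_simp
  have e4 : ζ k * starRingEnd ℂ (ζ k) = (‖ζ k‖ : ℂ) ^ 2 := RCLike.mul_conj _
  have e5 := Complex.I_mul_I
  linear_combination (Complex.I * starRingEnd ℂ (ζ k)) * e1 + (Complex.I * ζ k) * e2 +
    (‖ζ k‖ : ℂ) ^ 2 * s * weylSum h β γ (W s) * e3 +
    (Complex.I * Complex.I * s * weylSum h β γ (W s) * (1 + Real.exp (-(2 * β * γ k)))) * e4 +
    (‖ζ k‖ : ℂ) ^ 2 * s * weylSum h β γ (W s) * (1 + Real.exp (-(2 * β * γ k))) * e5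

/-- With `K` the covariance, `y' = -K s y` makes `exp(K s² / 2) y(s)` constant; compare `s = 1` with
`s = 0`. -/
theorem weylSum_eq (h : IsLadderSystem J a c Ω) (hβ : 0 < β) (hγ : ∀ k, 0 < γ k)
    (hW : IsWeylGroup J a c ζ W w) :
    weylSum h β γ (W 1) = weylSum h β γ 1 *
      Complex.exp (-((∑ k, ‖ζ k‖ ^ 2 * cothFactor β (γ k) : ℝ) / 2)) := by
  set K : ℝ := ∑ k, ‖ζ k‖ ^ 2 * cothFactor β (γ k) with hK
  have hd : ∀ s, HasDerivAt (fun s : ℝ => Complex.exp ((K / 2 : ℝ) * s ^ 2) * weylSum h β γ (W s))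
      0 s := fun s => by
    have h1 : HasDerivAt (fun s : ℝ => ((K / 2 : ℝ) : ℂ) * (s : ℂ) ^ 2) (K * s) s := by
      have h3 : HasDerivAt (fun s : ℝ => K / 2 * s ^ 2) (K * s) s := by
        refine ((hasDerivAt_pow 2 s).const_mul (K / 2)).congr_deriv ?_
        simp
        ring
      have h4 := h3.ofReal_comp
      push_cast at h4 ⊢
      exact h4
    refine (h1.cexp.mul (hasDerivAt_weylSum h hβ hγ hW s)).congr_deriv ?_
    rw [← hK]
    ring
  have := is_const_of_deriv_eq_zero (fun s => (hd s).differentiableAt) (fun s => (hd s).deriv) 1 0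
  simp only [hW.zero, Complex.ofReal_one, one_pow, mul_one, Complex.ofReal_zero, ne_eq,
    OfNat.ofNat_ne_zero, not_false_eq_true, zero_pow, mul_zero, Complex.exp_zero, one_mul] at this
  rw [← this, mul_comm, ← mul_assoc, ← Complex.exp_add]
  simp

theorem weylSum_one_ne_zero (h : IsLadderSystem J a c Ω) (hβ : 0 < β) (hγ : ∀ k, 0 < γ k) :
    weylSum h β γ 1 ≠ 0 := by
  have h1 : weylSum h β γ 1 = ((∑' α, gibbs β γ α : ℝ) : ℂ) := by
    rw [weylSum, Complex.ofReal_tsum]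
    refine tsum_congr fun α => ?_
    have := h.orthonormal_vec.1 α
    simp only at this
    simp [inner_self_eq_norm_sq_to_K, this]
  rw [h1]
  refine Complex.ofReal_ne_zero.2 (ne_of_gt ?_)
  exact (summable_exp_energy hγ hβ).tsum_pos (gibbs_nonneg β γ) 0 (Real.exp_pos _)

end Thermal

end WeylGroups

/-! ### Position and momentum operators on Schwartz functions -/

section PositionMomentum

variable {d L : ℕ}

/-- The linear combination `∑ₓ uₓ qₓ` of position operators. -/
def position (u : Config d L) : 𝓢(Config d L, ℂ) →ₗ[ℂ] 𝓢(Config d L, ℂ) :=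
  ∑ x, ((u x : ℝ) : ℂ) • posOp x

/-- The linear combination `∑ₓ vₓ pₓ` of momentum operators. -/
def momentum (v : Config d L) : 𝓢(Config d L, ℂ) →ₗ[ℂ] 𝓢(Config d L, ℂ) :=
  ∑ x, ((v x : ℝ) : ℂ) • momOp x

theorem schwartz_sum_apply {κ : Type*} (s : Finset κ) (f : κ → 𝓢(Config d L, ℂ))
    (q : Config d L) : (∑ i ∈ s, f i) q = ∑ i ∈ s, f i q := by
  classical
  induction s using Finset.induction_on with
  | empty => simp
  | insert i s hi ih => rw [Finset.sum_insert hi, Finset.sum_insert hi, ← ih]; rfl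

theorem position_apply (u : Config d L) (ψ : 𝓢(Config d L, ℂ)) (q : Config d L) :
    position u ψ q = ((inner ℝ u q : ℝ) : ℂ) * ψ q := by
  simp only [position, LinearMap.sum_apply, LinearMap.smul_apply, schwartz_sum_apply,
    smul_apply, posOp_apply, smul_eq_mul, PiLp.inner_apply]
  push_cast
  rw [Finset.sum_mul]
  refine Finset.sum_congr rfl fun x _ => ?_
  simp
  ring

theorem momentum_apply (v : Config d L) (ψ : 𝓢(Config d L, ℂ)) (q : Config d L) :
    momentum v ψ q = -Complex.I * fderiv ℝ ψ q v := by
  have hv : v = ∑ x, v x • EuclideanSpace.single x (1 : ℝ) := by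
    ext y
    simp [Finset.sum_apply, Pi.single_apply]
  simp only [momentum, LinearMap.sum_apply, LinearMap.smul_apply, schwartz_sum_apply,
    smul_apply, momOp_apply, smul_eq_mul]
  conv_rhs => rw [hv, map_sum, Finset.mul_sum]
  refine Finset.sum_congr rfl fun x _ => ?_
  rw [ψ.differentiableAt.lineDeriv_eq_fderiv, map_smul, Complex.real_smul]
  ring

theorem position_comm (u u' : Config d L) (ψ : 𝓢(Config d L, ℂ)) :
    position u (position u' ψ) = position u' (position u ψ) := by
  ext q
  simp only [position_apply]
  ring

theorem hasFDerivAt_inner_ofReal (u q : Config d L) :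
    HasFDerivAt (fun q : Config d L => ((inner ℝ u q : ℝ) : ℂ))
      (Complex.ofRealCLM ∘L innerSL ℝ u) q :=
  (Complex.ofRealCLM ∘L innerSL ℝ u).hasFDerivAt

theorem momentum_position (u v : Config d L) (ψ : 𝓢(Config d L, ℂ)) :
    momentum v (position u ψ) = position u (momentum v ψ) -
      (Complex.I * ((inner ℝ u v : ℝ) : ℂ)) • ψ := by
  ext q
  have h1 : (position u ψ : Config d L → ℂ) = fun q => ((inner ℝ u q : ℝ) : ℂ) * ψ q :=
    funext (position_apply u ψ)
  rw [momentum_apply, sub_apply, smul_apply, position_apply,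
    momentum_apply, h1, ((hasFDerivAt_inner_ofReal u q).fun_mul (ψ.hasFDerivAt q)).fderiv]
  simp
  ring

/-- Symmetry of the second derivative. -/
theorem momentum_comm (v v' : Config d L) (ψ : 𝓢(Config d L, ℂ)) :
    momentum v (momentum v' ψ) = momentum v' (momentum v ψ) := by
  have key : ∀ v v' q, momentum v (momentum v' ψ) q = -fderiv ℝ (fderiv ℝ ψ) q v v' := by
    intro v v' q
    have h1 : (momentum v' ψ : Config d L → ℂ) = fun q => -Complex.I * fderiv ℝ ψ q v' :=
      funext (momentum_apply v' ψ)
    have h2 : DifferentiableAt ℝ (fderiv ℝ ψ) q :=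
      ((ψ.smooth 2).fderiv_right (m := 1) (by norm_num)).differentiable (by norm_num) q
    have h3 : HasFDerivAt (fun q => fderiv ℝ ψ q v') ((fderiv ℝ (fderiv ℝ ψ) q).flip v') q := by
      have := h2.hasFDerivAt.clm_apply (hasFDerivAt_const v' q)
      simpa using this
    rw [momentum_apply, h1, (h3.const_mul (-Complex.I)).fderiv]
    simp only [smul_apply, ContinuousLinearMap.flip_apply, smul_eq_mul]
    linear_combination (fderiv ℝ (fderiv ℝ ψ) q v v') * Complex.I_mul_I
  ext q
  rw [key, key]
  have hs : IsSymmSndFDerivAt ℝ ψ q :=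
    (ψ.smooth 2).contDiffAt.isSymmSndFDerivAt (by simp)
  rw [hs v v']

theorem inner_incl (φ ψ : 𝓢(Config d L, ℂ)) :
    inner ℂ (incl d L φ) (incl d L ψ) = ∫ q, starRingEnd ℂ (φ q) * ψ q := by
  have h := SchwartzMap.inner_toL2_toL2_eq φ ψ (volume : Measure (Config d L))
  refine h.trans (integral_congr_ae (Eventually.of_forall fun q => ?_))
  simp [mul_comm]

theorem norm_incl_sq (φ : 𝓢(Config d L, ℂ)) : ‖incl d L φ‖ ^ 2 = ∫ q, ‖φ q‖ ^ 2 := by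
  have h := inner_incl φ φ
  rw [inner_self_eq_norm_sq_to_K] at h
  have h2 : ∀ q, starRingEnd ℂ (φ q) * φ q = ((‖φ q‖ ^ 2 : ℝ) : ℂ) := fun q => by
    rw [mul_comm, RCLike.mul_conj]
    simp
  simp only [h2] at h
  rw [integral_complex_ofReal] at h
  apply Complex.ofReal_injective
  push_cast
  simpa using h

theorem inner_position (u : Config d L) (φ ψ : 𝓢(Config d L, ℂ)) :
    inner ℂ (incl d L (position u φ)) (incl d L ψ) =
      inner ℂ (incl d L φ) (incl d L (position u ψ)) := by
  rw [inner_incl, inner_incl]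
  refine integral_congr_ae (Eventually.of_forall fun q => ?_)
  simp only [position_apply, map_mul, Complex.conj_ofReal]
  ring

/-- Integration by parts; its sign is compensated by conjugating the factor `-i`. -/
theorem inner_momentum (v : Config d L) (φ ψ : 𝓢(Config d L, ℂ)) :
    inner ℂ (incl d L (momentum v φ)) (incl d L ψ) =
      inner ℂ (incl d L φ) (incl d L (momentum v ψ)) := by
  have h := SchwartzMap.integral_bilinear_lineDerivOp_right_eq_neg_left
    (μ := (volume : Measure (Config d L))) φ ψ
    ((ContinuousLinearMap.mul ℝ ℂ).comp (Complex.conjCLE : ℂ →L[ℝ] ℂ)) v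
  simp only [ContinuousLinearMap.comp_apply, ContinuousLinearMap.mul_apply',
    ContinuousLinearEquiv.coe_coe, Complex.conjCLE_apply,
    SchwartzMap.lineDerivOp_apply_eq_fderiv] at h
  rw [inner_incl, inner_incl]
  simp only [momentum_apply, map_mul, map_neg, Complex.conj_I, neg_neg]
  calc ∫ q, Complex.I * starRingEnd ℂ (fderiv ℝ φ q v) * ψ q
      = Complex.I * ∫ q, starRingEnd ℂ (fderiv ℝ φ q v) * ψ q := by
        rw [← integral_const_mul]
        exact integral_congr_ae (Eventually.of_forall fun q => mul_assoc _ _ _)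
    _ = -Complex.I * ∫ q, starRingEnd ℂ (φ q) * fderiv ℝ ψ q v := by
        rw [h]
        ring
    _ = _ := by
        rw [← integral_const_mul]
        exact integral_congr_ae (Eventually.of_forall fun q => by ring)

end PositionMomentum

/-! ### Weyl operators as phases times translations -/

section WeylSchwartz

variable {d L : ℕ}

theorem hasTemperateGrowth_exp_I : (fun s : ℝ => Complex.exp (s * Complex.I)).HasTemperateGrowth := by
  have hder : ∀ n : ℕ, iteratedDeriv n (fun s : ℝ => Complex.exp (s * Complex.I)) =
      fun s : ℝ => Complex.I ^ n * Complex.exp (s * Complex.I) := by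
    intro n
    induction n with
    | zero => simp
    | succ n ih =>
      rw [iteratedDeriv_succ, ih]
      funext s
      have h2 : HasDerivAt (fun t : ℝ => (t : ℂ) * Complex.I) Complex.I s := by
        simpa using (hasDerivAt_id s).ofReal_comp.mul_const Complex.I
      rw [(h2.cexp.const_mul (Complex.I ^ n)).deriv]
      ring
  refine ⟨(Complex.ofRealCLM.contDiff.mul contDiff_const).cexp, fun n => ⟨0, 1, fun s => ?_⟩⟩
  rw [norm_iteratedFDeriv_eq_norm_iteratedDeriv, hder]
  simp

/-- The phase `exp(i (s u·q + s² u·v / 2))`. -/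
def weylPhase (u v : Config d L) (s : ℝ) (q : Config d L) : ℂ :=
  Complex.exp ((s * inner ℝ u q + s ^ 2 / 2 * inner ℝ u v : ℝ) * Complex.I)

theorem hasTemperateGrowth_weylPhase (u v : Config d L) (s : ℝ) :
    (weylPhase u v s).HasTemperateGrowth := by
  have h1 : (fun q : Config d L => s * inner ℝ u q + s ^ 2 / 2 * inner ℝ u v).HasTemperateGrowth := by
    fun_prop
  exact hasTemperateGrowth_exp_I.comp h1

/-- The operator `exp(i s (∑ₓ uₓ qₓ + vₓ pₓ))` on Schwartz functions. -/
def weylSchwartz (u v : Config d L) (s : ℝ) : 𝓢(Config d L, ℂ) →ₗ[ℂ] 𝓢(Config d L, ℂ) :=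
  (SchwartzMap.smulLeftCLM ℂ (weylPhase u v s)).toLinearMap ∘ₗ
    (SchwartzMap.compSubConstCLM ℂ (-(s • v))).toLinearMap

theorem weylSchwartz_apply (u v : Config d L) (s : ℝ) (φ : 𝓢(Config d L, ℂ)) (q : Config d L) :
    weylSchwartz u v s φ q = weylPhase u v s q * φ (q + s • v) := by
  simp [weylSchwartz, SchwartzMap.smulLeftCLM_apply_apply (hasTemperateGrowth_weylPhase u v s)]

theorem norm_weylPhase (u v : Config d L) (s : ℝ) (q : Config d L) : ‖weylPhase u v s q‖ = 1 :=
  Complex.norm_exp_ofReal_mul_I _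

theorem weylSchwartz_zero (u v : Config d L) : weylSchwartz u v 0 = LinearMap.id := by
  ext φ q
  simp [weylSchwartz_apply, weylPhase]

theorem weylSchwartz_add (u v : Config d L) (s t : ℝ) :
    weylSchwartz u v (s + t) = weylSchwartz u v s ∘ₗ weylSchwartz u v t := by
  ext φ q
  simp only [LinearMap.comp_apply, weylSchwartz_apply, weylPhase]
  rw [← mul_assoc, ← Complex.exp_add, add_smul, add_assoc q, ← add_mul, ← Complex.ofReal_add]
  -- The quadratic term `s² / 2 · ⟨u, v⟩` of the phase is chosen to absorb the cross term `s t ⟨u,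
  -- v⟩` that the translation creates.
  congr 4
  rw [inner_add_right, inner_smul_right]
  ring

/-- The Weyl relation. -/
theorem weylSchwartz_mul (u v u' v' : Config d L) (φ : 𝓢(Config d L, ℂ)) :
    weylSchwartz u v 1 (weylSchwartz u' v' 1 φ) =
      Complex.exp (((inner ℝ u' v - inner ℝ u v') / 2 : ℝ) * Complex.I) •
        weylSchwartz (u + u') (v + v') 1 φ := by
  ext q
  rw [smul_apply]
  simp only [weylSchwartz_apply, weylPhase, smul_eq_mul]
  rw [← mul_assoc, ← mul_assoc, ← Complex.exp_add, ← Complex.exp_add, one_smul, one_smul, one_smul,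
    add_assoc q, ← add_mul, ← Complex.ofReal_add, ← add_mul, ← Complex.ofReal_add]
  congr 4
  simp only [inner_add_right, inner_add_left]
  rw [real_inner_comm v' u', real_inner_comm v u']
  ring

theorem norm_incl_weylSchwartz (u v : Config d L) (s : ℝ) (φ : 𝓢(Config d L, ℂ)) :
    ‖incl d L (weylSchwartz u v s φ)‖ = ‖incl d L φ‖ := by
  rw [← sq_eq_sq₀ (norm_nonneg _) (norm_nonneg _), norm_incl_sq, norm_incl_sq]
  simp only [weylSchwartz_apply, norm_mul, norm_weylPhase, one_mul]
  exact integral_add_right_eq_self (fun q => ‖φ q‖ ^ 2) (s • v)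

theorem position_weylSchwartz (u v u' : Config d L) (s : ℝ) (φ : 𝓢(Config d L, ℂ)) :
    position u' (weylSchwartz u v s φ) = weylSchwartz u v s (position u' φ) -
      ((s * inner ℝ u' v : ℝ) : ℂ) • weylSchwartz u v s φ := by
  ext q
  simp only [sub_apply, smul_apply, weylSchwartz_apply, position_apply,
    smul_eq_mul, inner_add_right, inner_smul_right]
  push_cast
  ring

theorem hasFDerivAt_weylPhase (u v : Config d L) (s : ℝ) (q : Config d L) :
    HasFDerivAt (weylPhase u v s)
      ((weylPhase u v s q * (s * Complex.I)) • (Complex.ofRealCLM ∘L innerSL ℝ u)) q := by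
  have h2 : HasFDerivAt (fun q : Config d L =>
      ((s * inner ℝ u q + s ^ 2 / 2 * inner ℝ u v : ℝ) : ℂ) * Complex.I)
      ((s * Complex.I) • (Complex.ofRealCLM ∘L innerSL ℝ u)) q := by
    have h3 := (((hasFDerivAt_inner_ofReal u q).const_mul (s : ℂ)).add_const
      (((s ^ 2 / 2 * inner ℝ u v : ℝ)) : ℂ)).mul_const Complex.I
    rw [smul_smul, mul_comm Complex.I] at h3
    refine h3.congr_of_eventuallyEq (Eventually.of_forall fun q => ?_)
    simp only
    push_cast
    ring
  have h4 := h2.cexp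
  rw [smul_smul] at h4
  exact h4

theorem momentum_weylSchwartz (u v v' : Config d L) (s : ℝ) (φ : 𝓢(Config d L, ℂ)) :
    momentum v' (weylSchwartz u v s φ) = weylSchwartz u v s (momentum v' φ) +
      ((s * inner ℝ u v' : ℝ) : ℂ) • weylSchwartz u v s φ := by
  ext q
  have h1 : (weylSchwartz u v s φ : Config d L → ℂ) =
      fun q => weylPhase u v s q * φ (q + s • v) := funext (weylSchwartz_apply u v s φ)
  have h2 : HasFDerivAt (fun q => φ (q + s • v)) (fderiv ℝ φ (q + s • v)) q := by
    have := (φ.hasFDerivAt (q + s • v)).comp q ((hasFDerivAt_id q).add_const (s • v))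
    simpa [Function.comp_def] using this
  rw [add_apply, smul_apply, weylSchwartz_apply, weylSchwartz_apply,
    momentum_apply, momentum_apply, h1, ((hasFDerivAt_weylPhase u v s q).fun_mul h2).fderiv]
  simp
  linear_combination (-(weylPhase u v s q * s * (inner ℝ u v' : ℝ) * φ (q + s • v))) *
    Complex.I_mul_I

/-- The generator of the Weyl group. -/
def phaseField (u v : Config d L) : 𝓢(Config d L, ℂ) →ₗ[ℂ] 𝓢(Config d L, ℂ) :=
  position u + momentum v

/-- Position and momentum are shifted by `-s ⟨u, v⟩` and `+s ⟨u, v⟩`, which cancel in the sum. -/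
theorem phaseField_weylSchwartz (u v : Config d L) (s : ℝ) (φ : 𝓢(Config d L, ℂ)) :
    phaseField u v (weylSchwartz u v s φ) = weylSchwartz u v s (phaseField u v φ) := by
  simp only [phaseField, LinearMap.add_apply, position_weylSchwartz, momentum_weylSchwartz, map_add]
  abel

theorem hasDerivAt_weylSchwartz_apply (u v : Config d L) (φ : 𝓢(Config d L, ℂ)) (q : Config d L)
    (s : ℝ) : HasDerivAt (fun s => weylSchwartz u v s φ q)
      (weylSchwartz u v s (Complex.I • phaseField u v φ) q) s := by
  have h1 : HasDerivAt (fun s => weylPhase u v s q)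
      (weylPhase u v s q * ((inner ℝ u (q + s • v) : ℝ) * Complex.I)) s := by
    have h3 : HasDerivAt (fun s : ℝ => s * inner ℝ u q + s ^ 2 / 2 * inner ℝ u v)
        (inner ℝ u (q + s • v)) s := by
      refine (((hasDerivAt_id s).mul_const (inner ℝ u q)).add
        (((hasDerivAt_pow 2 s).div_const 2).mul_const (inner ℝ u v))).congr_deriv ?_
      rw [inner_add_right, inner_smul_right]
      simp
    exact (h3.ofReal_comp.mul_const Complex.I).cexp
  have h2 : HasDerivAt (fun s => φ (q + s • v)) (fderiv ℝ φ (q + s • v) v) s := by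
    have h3 : HasDerivAt (fun s : ℝ => q + s • v) v s := by
      simpa using ((hasDerivAt_id s).smul_const v).const_add q
    exact (φ.hasFDerivAt (q + s • v)).comp_hasDerivAt s h3
  have h4 := h1.mul h2
  refine (h4.congr_of_eventuallyEq (Eventually.of_forall fun s => ?_)).congr_deriv ?_
  · exact weylSchwartz_apply u v s φ q
  · rw [weylSchwartz_apply, smul_apply, phaseField, LinearMap.add_apply,
      add_apply, position_apply, momentum_apply, smul_eq_mul]
    linear_combination (weylPhase u v s q * fderiv ℝ φ (q + s • v) v) * Complex.I_mul_I

/-- The inequality `1 + ‖q‖ ≤ (1 + ‖q + r v‖)(1 + ‖v‖)` makes the decay uniform over translations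
with `|r| ≤ 1`. -/
theorem schwartz_decay_translate (χ : 𝓢(Config d L, ℂ)) (v : Config d L) (N : ℕ) :
    ∃ C : ℝ, 0 ≤ C ∧ ∀ r : ℝ, |r| ≤ 1 → ∀ q, ‖χ (q + r • v)‖ ≤ C * ((1 + ‖q‖) ^ N)⁻¹ := by
  let M : ℝ := 2 ^ N * (Finset.Iic (N, 0)).sup
    (fun m => SchwartzMap.seminorm ℝ m.1 m.2) χ
  have hM : ∀ q, (1 + ‖q‖) ^ N * ‖χ q‖ ≤ M := fun q => by
    have := SchwartzMap.one_add_le_sup_seminorm_apply (𝕜 := ℝ) (m := (N, 0)) (k := N) (n := 0)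
      le_rfl le_rfl χ q
    simpa using this
  have hM0 : 0 ≤ M := le_trans (by positivity) (hM 0)
  refine ⟨M * (1 + ‖v‖) ^ N, by positivity, fun r hr q => ?_⟩
  have h1 : 1 + ‖q‖ ≤ (1 + ‖q + r • v‖) * (1 + ‖v‖) := by
    have h2 : ‖q‖ ≤ ‖q + r • v‖ + ‖v‖ := by
      have h3 : ‖q‖ ≤ ‖q + r • v‖ + ‖r • v‖ := by
        have := norm_sub_le (q + r • v) (r • v)
        simpa using this
      have h4 : ‖r • v‖ ≤ ‖v‖ := by
        rw [norm_smul]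
        exact mul_le_of_le_one_left (norm_nonneg v) hr
      linarith
    nlinarith [norm_nonneg v, norm_nonneg (q + r • v), mul_nonneg (norm_nonneg (q + r • v)) (norm_nonneg v)]
  rw [← div_eq_mul_inv, le_div_iff₀ (by positivity)]
  calc ‖χ (q + r • v)‖ * (1 + ‖q‖) ^ N
      ≤ ‖χ (q + r • v)‖ * ((1 + ‖q + r • v‖) * (1 + ‖v‖)) ^ N := by gcongr
    _ = (1 + ‖q + r • v‖) ^ N * ‖χ (q + r • v)‖ * (1 + ‖v‖) ^ N := by rw [mul_pow]; ring
    _ ≤ M * (1 + ‖v‖) ^ N := by gcongr; exact hM _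

/-- Pointwise in `q` the difference quotient converges, and the mean value inequality bounds it by
the evolved derivative, which decays uniformly for small times. Dominated convergence of the squared
modulus gives the limit in `L²`. -/
theorem hasDerivAt_incl_weylSchwartz (u v : Config d L) (φ : 𝓢(Config d L, ℂ)) :
    HasDerivAt (fun s => incl d L (weylSchwartz u v s φ))
      (Complex.I • incl d L (phaseField u v φ)) 0 := by
  set χ : 𝓢(Config d L, ℂ) := Complex.I • phaseField u v φ with hχ
  rw [← map_smul, ← hχ, hasDerivAt_iff_tendsto_slope_zero]
  have hw0 : weylSchwartz u v 0 φ = φ := by rw [weylSchwartz_zero]; rfl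
  have hw0' : weylSchwartz u v 0 χ = χ := by rw [weylSchwartz_zero]; rfl
  let F : ℝ → 𝓢(Config d L, ℂ) := fun s => (s : ℂ)⁻¹ • (weylSchwartz u v s φ - φ) - χ
  have hF : ∀ s : ℝ, s⁻¹ • (incl d L (weylSchwartz u v (0 + s) φ) - incl d L (weylSchwartz u v 0 φ)) -
      incl d L χ = incl d L (F s) := fun s => by
    rw [zero_add, hw0, map_sub (incl d L) _ χ, map_smul (incl d L) ((s : ℂ)⁻¹), map_sub (incl d L), ← Complex.ofReal_inv]
    congr 1
  rw [tendsto_iff_norm_sub_tendsto_zero]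
  simp only [hF]
  have hFq : ∀ s q, F s q = (s : ℂ)⁻¹ * (weylSchwartz u v s φ q - φ q) - χ q := fun s q => rfl
  -- One power more than the dimension makes `(1 + ‖q‖)^(-N)` integrable; the second such factor in
  -- the square is simply bounded by `1`.
  set N := Module.finrank ℝ (Config d L) + 1 with hN
  obtain ⟨C, hC, hbound⟩ := schwartz_decay_translate χ v N
  have hwχ : ∀ r : ℝ, |r| ≤ 1 → ∀ q, ‖weylSchwartz u v r χ q‖ ≤ C * ((1 + ‖q‖) ^ N)⁻¹ :=
    fun r hr q => by
      rw [weylSchwartz_apply, norm_mul, norm_weylPhase, one_mul]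
      exact hbound r hr q
  have hFbound : ∀ s : ℝ, s ≠ 0 → |s| ≤ 1 → ∀ q, ‖F s q‖ ≤ 2 * (C * ((1 + ‖q‖) ^ N)⁻¹) :=
    fun s hs0 hs q => by
      have h1 := (convex_Icc (-1 : ℝ) 1).norm_image_sub_le_of_norm_hasDerivWithin_le
        (f := fun s => weylSchwartz u v s φ q) (x := 0) (y := s)
        (fun r _ => (hasDerivAt_weylSchwartz_apply u v φ q r).hasDerivWithinAt)
        (fun r hr => hwχ r (abs_le.2 hr) q) ⟨by norm_num, by norm_num⟩ (abs_le.1 hs)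
      rw [hw0, sub_zero] at h1
      have h2 := hwχ 0 (by norm_num) q
      rw [hw0'] at h2
      rw [hFq, two_mul]
      refine (norm_sub_le _ _).trans (add_le_add ?_ h2)
      rw [norm_mul, norm_inv, Complex.norm_real, inv_mul_le_iff₀ (norm_pos_iff.2 hs0), mul_comm]
      exact h1
  have hsq : Tendsto (fun s => ∫ q, ‖F s q‖ ^ 2) (𝓝[≠] 0) (𝓝 (∫ _ : Config d L, (0 : ℝ))) := by
    refine tendsto_integral_filter_of_dominated_convergence
      (fun q => (2 * C) ^ 2 * (1 + ‖q‖) ^ (-(N : ℝ))) ?_ ?_ ?_ ?_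
    · refine Eventually.of_forall fun s => ?_
      exact ((F s).continuous.norm.pow 2).aestronglyMeasurable
    · have h1 : ∀ᶠ s : ℝ in 𝓝[≠] 0, |s| ≤ 1 := by
        have : Metric.closedBall (0 : ℝ) 1 ∈ 𝓝[≠] (0 : ℝ) :=
          mem_nhdsWithin_of_mem_nhds (Metric.closedBall_mem_nhds 0 one_pos)
        filter_upwards [this] with s hs
        simpa using hs
      filter_upwards [h1, self_mem_nhdsWithin] with s hs hs0
      refine Eventually.of_forall fun q => ?_
      rw [Real.norm_of_nonneg (by positivity), Real.rpow_neg (by positivity), Real.rpow_natCast]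
      have h3 := hFbound s hs0 hs q
      have h4 : ((1 + ‖q‖) ^ N)⁻¹ ≤ 1 := inv_le_one_of_one_le₀ (one_le_pow₀ (by simp))
      have h5 : 0 ≤ ((1 + ‖q‖) ^ N)⁻¹ := by positivity
      calc ‖F s q‖ ^ 2 ≤ (2 * (C * ((1 + ‖q‖) ^ N)⁻¹)) ^ 2 := by gcongr
        _ = (2 * C) ^ 2 * (((1 + ‖q‖) ^ N)⁻¹ * ((1 + ‖q‖) ^ N)⁻¹) := by ring
        _ ≤ (2 * C) ^ 2 * (((1 + ‖q‖) ^ N)⁻¹ * 1) := by gcongr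
        _ = _ := by ring
    · refine (integrable_one_add_norm ?_).const_mul _
      rw [hN]
      push_cast
      linarith
    · refine Eventually.of_forall fun q => ?_
      have h1 := hasDerivAt_iff_tendsto_slope_zero.1 (hasDerivAt_weylSchwartz_apply u v φ q 0)
      rw [hw0'] at h1
      have h2 := ((h1.sub_const (χ q)).norm.pow 2)
      simp only [sub_self, norm_zero, ne_eq, OfNat.ofNat_ne_zero, not_false_eq_true, zero_pow] at h2
      refine h2.congr fun s => ?_
      rw [zero_add, hw0, hFq, Complex.real_smul, Complex.ofReal_inv]
  simp only [← norm_incl_sq, integral_zero] at hsq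
  have h2 := (Real.continuous_sqrt.tendsto 0).comp hsq
  simpa [Function.comp_def, Real.sqrt_sq] using h2

theorem isUnitaryGroup_weyl (u v : Config d L) :
    IsUnitaryGroup (onSchwartz (phaseField u v)).closure
        (expI (onSchwartz (phaseField u v)).closure) ∧
      ∀ s φ, expI (onSchwartz (phaseField u v)).closure s (incl d L φ) =
        incl d L (weylSchwartz u v s φ) :=
  expI_closure_incl (weylSchwartz_zero u v) (weylSchwartz_add u v) (norm_incl_weylSchwartz u v)
    (phaseField_weylSchwartz u v) (hasDerivAt_incl_weylSchwartz u v)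

end WeylSchwartz

/-! ### Gaussians as Schwartz functions -/

section Gaussian

open scoped ContDiff

/-- The exponential series gives `(1 + r)^M ≤ M! exp(1 + r)`, and `1 + r - r² / 2` has maximum `3 /
2`, attained at `r = 1`. -/
theorem one_add_pow_mul_exp_le (M : ℕ) {r : ℝ} (hr : 0 ≤ r) :
    (1 + r) ^ M * Real.exp (-(r ^ 2 / 2)) ≤ M.factorial * Real.exp (3 / 2) := by
  have h1 : (1 + r) ^ M ≤ M.factorial * Real.exp (1 + r) := by
    have := Real.pow_div_factorial_le_exp (1 + r) (by linarith) M
    rwa [div_le_iff₀ (by positivity), mul_comm] at this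
  calc (1 + r) ^ M * Real.exp (-(r ^ 2 / 2))
      ≤ M.factorial * Real.exp (1 + r) * Real.exp (-(r ^ 2 / 2)) := by gcongr
    _ = M.factorial * Real.exp (1 + r - r ^ 2 / 2) := by
        rw [mul_assoc, ← Real.exp_add]
        ring_nf
    _ ≤ M.factorial * Real.exp (3 / 2) := by
        gcongr
        nlinarith [sq_nonneg (r - 1)]

variable {V : Type} [NormedAddCommGroup V] [InnerProductSpace ℝ V]

theorem hasTemperateGrowth_neg_norm_sq : (fun q : V => -(‖q‖ ^ 2 / 2)).HasTemperateGrowth := by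
  have h : (fun q : V => -(‖q‖ ^ 2 / 2)) = fun q : V => (-(1 / 2) : ℝ) * ‖q‖ ^ 2 := by
    funext q
    ring
  rw [h]
  fun_prop

theorem norm_iteratedFDeriv_gaussian_le (n : ℕ) : ∃ (k : ℕ) (C : ℝ), 0 ≤ C ∧ ∀ q : V,
    ‖iteratedFDeriv ℝ n (fun q : V => Real.exp (-(‖q‖ ^ 2 / 2))) q‖ ≤
      C * ((1 + ‖q‖) ^ k * Real.exp (-(‖q‖ ^ 2 / 2))) := by
  obtain ⟨k, C, hC, hbd⟩ :=
    (hasTemperateGrowth_neg_norm_sq (V := V)).norm_iteratedFDeriv_le_uniform n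
  -- In the bound for derivatives of a composition, `C + 1` rather than `C` ensures `D ≥ 1`, so that
  -- `D ≤ D ^ i` for every `i ≥ 1`.
  refine ⟨k * n, n.factorial * (C + 1) ^ n, by positivity, fun q => ?_⟩
  have h := norm_iteratedFDeriv_comp_le (𝕜 := ℝ) (g := Real.exp)
    (f := fun q : V => -(‖q‖ ^ 2 / 2)) (n := n) (N := ∞) Real.contDiff_exp
    hasTemperateGrowth_neg_norm_sq.1 (mod_cast le_top) q
    (C := Real.exp (-(‖q‖ ^ 2 / 2))) (D := (C + 1) * (1 + ‖q‖) ^ k)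
    (fun i _ => by
      rw [norm_iteratedFDeriv_eq_norm_iteratedDeriv, iteratedDeriv_eq_iterate, Real.iter_deriv_exp,
        Real.norm_eq_abs, Real.abs_exp])
    (fun i hi hin => by
      have h1 : 1 ≤ (C + 1) * (1 + ‖q‖) ^ k := by
        have : 1 ≤ (1 + ‖q‖) ^ k := one_le_pow₀ (by simp)
        nlinarith
      refine (hbd i hin q).trans (le_trans ?_ (le_self_pow₀ h1 (by omega)))
      gcongr
      linarith)
  refine h.trans (le_of_eq ?_)
  rw [mul_pow, ← pow_mul]
  ring

/-- The real Gaussian `q ↦ exp(-‖q‖²/2)` as a Schwartz function. -/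
def gaussianReal (V : Type) [NormedAddCommGroup V] [InnerProductSpace ℝ V] : 𝓢(V, ℝ) where
  toFun q := Real.exp (-(‖q‖ ^ 2 / 2))
  smooth' := Real.contDiff_exp.comp hasTemperateGrowth_neg_norm_sq.1
  decay' m n := by
    obtain ⟨k, C, hC, hbd⟩ := norm_iteratedFDeriv_gaussian_le (V := V) n
    refine ⟨C * ((m + k).factorial * Real.exp (3 / 2)), fun q => ?_⟩
    have h1 : ‖q‖ ^ m ≤ (1 + ‖q‖) ^ m := by
      gcongr
      linarith
    calc ‖q‖ ^ m * ‖iteratedFDeriv ℝ n (fun q : V => Real.exp (-(‖q‖ ^ 2 / 2))) q‖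
        ≤ (1 + ‖q‖) ^ m * (C * ((1 + ‖q‖) ^ k * Real.exp (-(‖q‖ ^ 2 / 2)))) := by
          gcongr
          exact hbd q
      _ = C * ((1 + ‖q‖) ^ (m + k) * Real.exp (-(‖q‖ ^ 2 / 2))) := by rw [pow_add]; ring
      _ ≤ _ := by
          exact mul_le_mul_of_nonneg_left (one_add_pow_mul_exp_le (m + k) (norm_nonneg q)) hC

/-- The Gaussian `q ↦ exp(-‖T q‖²/2)`. -/
def gaussian (T : V ≃L[ℝ] V) : 𝓢(V, ℂ) :=
  SchwartzMap.postcompCLM (𝕜 := ℝ) Complex.ofRealCLM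
    (SchwartzMap.compCLMOfContinuousLinearEquiv ℝ T (gaussianReal V))

theorem gaussian_apply (T : V ≃L[ℝ] V) (q : V) :
    gaussian T q = (Real.exp (-(‖T q‖ ^ 2 / 2)) : ℂ) := rfl

theorem hasFDerivAt_gaussian (T : V ≃L[ℝ] V) (q : V) :
    HasFDerivAt (gaussian T) (-(gaussian T q) •
      (Complex.ofRealCLM ∘L (innerSL ℝ (T q)) ∘L (T : V →L[ℝ] V))) q := by
  have h1 : HasFDerivAt (fun q => ‖T q‖ ^ 2) (2 • (innerSL ℝ (T q)).comp (T : V →L[ℝ] V)) q :=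
    HasFDerivAt.norm_sq T.hasFDerivAt
  have h2 : HasFDerivAt (fun q => -(‖T q‖ ^ 2 / 2)) (-((innerSL ℝ (T q)).comp (T : V →L[ℝ] V))) q := by
    have h3 := h1.const_mul (-(1 / 2) : ℝ)
    refine (h3.congr_of_eventuallyEq (Eventually.of_forall fun q => by ring)).congr_fderiv ?_
    ext v
    simp
  have h4 := (Complex.ofRealCLM.hasFDerivAt).comp q h2.exp
  refine h4.congr_fderiv ?_
  ext v
  simp [gaussian_apply]

end Gaussian

/-! ### Ladder operators of normal modes -/

section Modes

variable {d L : ℕ}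

/-- Dual bases `A k` and `B k`, and positive frequencies `γ k`. -/
structure IsNormalModes (A B : box d L → Config d L) (γ : box d L → ℝ) : Prop where
  pos : ∀ k, 0 < γ k
  dual : ∀ k l, inner ℝ (B k) (A l) = if k = l then 1 else 0
  expand_left : ∀ u, ∑ k, inner ℝ u (A k) • B k = u
  expand_right : ∀ v, ∑ k, inner ℝ v (B k) • A k = v

variable {A B : box d L → Config d L} {γ : box d L → ℝ}

/-- The annihilation operators of the normal modes. -/
def annihilation (A B : box d L → Config d L) (γ : box d L → ℝ) (k : box d L) :
    𝓢(Config d L, ℂ) →ₗ[ℂ] 𝓢(Config d L, ℂ) :=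
  ((√(γ k / 2) : ℝ) : ℂ) • position (B k) +
    (Complex.I * ((√(2 * γ k))⁻¹ : ℝ)) • momentum (A k)

/-- The creation operators of the normal modes. -/
def creationOp (A B : box d L → Config d L) (γ : box d L → ℝ) (k : box d L) :
    𝓢(Config d L, ℂ) →ₗ[ℂ] 𝓢(Config d L, ℂ) :=
  ((√(γ k / 2) : ℝ) : ℂ) • position (B k) -
    (Complex.I * ((√(2 * γ k))⁻¹ : ℝ)) • momentum (A k)

theorem sqrt_half_mul_inv {x : ℝ} (hx : 0 < x) : √(x / 2) * (√(2 * x))⁻¹ = 1 / 2 := by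
  have h1 : √(2 * x) = 2 * √(x / 2) := by
    have : 2 * x = 2 ^ 2 * (x / 2) := by ring
    rw [this, Real.sqrt_mul (by norm_num), Real.sqrt_sq (by norm_num)]
  have h2 : √(x / 2) ≠ 0 := (Real.sqrt_pos.2 (by positivity)).ne'
  rw [h1]
  field_simp

theorem position_eq (hm : IsNormalModes A B γ) (k : box d L) :
    position (B k) = (((√(2 * γ k))⁻¹ : ℝ) : ℂ) • (annihilation A B γ k + creationOp A B γ k) := by
  have h1 : (((√(2 * γ k))⁻¹ : ℝ) : ℂ) * ((√(γ k / 2) : ℝ) : ℂ) = 1 / 2 := by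
    rw [← Complex.ofReal_mul, mul_comm, sqrt_half_mul_inv (hm.pos k)]
    simp
  have h2 : annihilation A B γ k + creationOp A B γ k =
      (2 * ((√(γ k / 2) : ℝ) : ℂ)) • position (B k) := by
    rw [annihilation, creationOp]
    module
  rw [h2, smul_smul]
  have h3 : (((√(2 * γ k))⁻¹ : ℝ) : ℂ) * (2 * ((√(γ k / 2) : ℝ) : ℂ)) = 1 := by
    linear_combination 2 * h1
  rw [h3, one_smul]

theorem momentum_eq (hm : IsNormalModes A B γ) (k : box d L) :
    momentum (A k) = (-Complex.I * ((√(γ k / 2) : ℝ) : ℂ)) •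
      (annihilation A B γ k - creationOp A B γ k) := by
  have h1 : ((√(γ k / 2) : ℝ) : ℂ) * (((√(2 * γ k))⁻¹ : ℝ) : ℂ) = 1 / 2 := by
    rw [← Complex.ofReal_mul, sqrt_half_mul_inv (hm.pos k)]
    simp
  have h2 : annihilation A B γ k - creationOp A B γ k =
      (2 * (Complex.I * ((√(2 * γ k))⁻¹ : ℝ))) • momentum (A k) := by
    rw [annihilation, creationOp]
    module
  rw [h2, smul_smul]
  have h3 : (-Complex.I * ((√(γ k / 2) : ℝ) : ℂ)) * (2 * (Complex.I * ((√(2 * γ k))⁻¹ : ℝ))) = 1 := by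
    linear_combination (-2 * Complex.I * Complex.I) * h1 - Complex.I_mul_I
  rw [h3, one_smul]

theorem position_sum_smul (c : box d L → ℝ) (w : box d L → Config d L) :
    position (∑ k, c k • w k) = ∑ k, (c k : ℂ) • position (w k) := by
  ext φ q
  simp only [LinearMap.sum_apply, LinearMap.smul_apply, schwartz_sum_apply, smul_apply,
    position_apply, sum_inner, inner_smul_left, smul_eq_mul]
  push_cast
  rw [Finset.sum_mul]
  exact Finset.sum_congr rfl fun k _ => by simp [mul_assoc]

theorem momentum_sum_smul (c : box d L → ℝ) (w : box d L → Config d L) :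
    momentum (∑ k, c k • w k) = ∑ k, (c k : ℂ) • momentum (w k) := by
  ext φ q
  simp only [LinearMap.sum_apply, LinearMap.smul_apply, schwartz_sum_apply, smul_apply,
    momentum_apply, map_sum, map_smul, smul_eq_mul, Complex.real_smul]
  rw [Finset.mul_sum]
  exact Finset.sum_congr rfl fun k _ => by ring

/-- The coefficients of the field operator `∑ₓ uₓ qₓ + vₓ pₓ` in terms of ladder operators. -/
def modeCoeff (A B : box d L → Config d L) (γ : box d L → ℝ) (u v : Config d L) (k : box d L) : ℂ :=
  (((√(2 * γ k))⁻¹ * inner ℝ u (A k) : ℝ) : ℂ) + ((√(γ k / 2) * inner ℝ v (B k) : ℝ) : ℂ) * Complex.I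

theorem phaseField_eq_fieldOp (hm : IsNormalModes A B γ) (u v : Config d L) :
    phaseField u v =
      fieldOp (annihilation A B γ) (creationOp A B γ) (modeCoeff A B γ u v) := by
  have h1 : position u = ∑ k, (inner ℝ u (A k) : ℂ) • position (B k) := by
    rw [← position_sum_smul, hm.expand_left]
  have h2 : momentum v = ∑ k, (inner ℝ v (B k) : ℂ) • momentum (A k) := by
    rw [← momentum_sum_smul, hm.expand_right]
  rw [phaseField, h1, h2, fieldOp, ← Finset.sum_add_distrib]
  refine Finset.sum_congr rfl fun k _ => ?_
  rw [position_eq hm, momentum_eq hm, modeCoeff, map_add, map_mul, Complex.conj_ofReal,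
    Complex.conj_ofReal, Complex.conj_I]
  push_cast
  module

theorem annihilation_apply (k : box d L) (φ : 𝓢(Config d L, ℂ)) : annihilation A B γ k φ =
    ((√(γ k / 2) : ℝ) : ℂ) • position (B k) φ +
      (Complex.I * ((√(2 * γ k))⁻¹ : ℝ)) • momentum (A k) φ := rfl

theorem creationOp_apply (k : box d L) (φ : 𝓢(Config d L, ℂ)) : creationOp A B γ k φ =
    ((√(γ k / 2) : ℝ) : ℂ) • position (B k) φ -
      (Complex.I * ((√(2 * γ k))⁻¹ : ℝ)) • momentum (A k) φ := rfl

theorem inner_creationOp (k : box d L) (φ ψ : 𝓢(Config d L, ℂ)) :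
    inner ℂ (incl d L (creationOp A B γ k φ)) (incl d L ψ) =
      inner ℂ (incl d L φ) (incl d L (annihilation A B γ k ψ)) := by
  rw [creationOp_apply, annihilation_apply, map_sub, map_add, map_smul, map_smul, map_smul,
    map_smul, inner_sub_left, inner_add_right, inner_smul_left, inner_smul_left, inner_smul_right,
    inner_smul_right, inner_position, inner_momentum, map_mul, Complex.conj_ofReal,
    Complex.conj_ofReal, Complex.conj_I]
  ring

theorem annihilation_creationOp (hm : IsNormalModes A B γ) (k l : box d L)
    (ψ : 𝓢(Config d L, ℂ)) : annihilation A B γ k (creationOp A B γ l ψ) =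
      creationOp A B γ l (annihilation A B γ k ψ) + if k = l then ψ else 0 := by
  have hkl : (if k = l then ψ else 0) = ((if k = l then 1 else 0 : ℂ)) • ψ := by
    split_ifs <;> simp
  rw [hkl]
  simp only [annihilation_apply, creationOp_apply, map_sub, map_add, map_smul, momentum_position,
    hm.dual, position_comm (B k) (B l), momentum_comm (A k) (A l)]
  have h1 : ((√(γ k / 2) : ℝ) : ℂ) * (((√(2 * γ k))⁻¹ : ℝ) : ℂ) = 1 / 2 := by
    rw [← Complex.ofReal_mul, sqrt_half_mul_inv (hm.pos k)]
    simp
  by_cases h : k = l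
  · subst h
    simp only [if_true, Complex.ofReal_one, mul_one]
    ext q
    simp only [smul_apply, add_apply, sub_apply, smul_eq_mul]
    linear_combination (-2 * Complex.I * Complex.I * ψ q) * h1 - ψ q * Complex.I_mul_I
  · simp only [if_neg h, if_neg (Ne.symm h), Complex.ofReal_zero, mul_zero, zero_smul, sub_zero,
      add_zero]
    module

theorem creationOp_comm (hm : IsNormalModes A B γ) (k l : box d L)
    (ψ : 𝓢(Config d L, ℂ)) : creationOp A B γ k (creationOp A B γ l ψ) =
      creationOp A B γ l (creationOp A B γ k ψ) := by
  simp only [creationOp_apply, map_sub, map_smul, momentum_position, hm.dual,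
    position_comm (B k) (B l), momentum_comm (A k) (A l)]
  by_cases h : k = l
  · subst h
    module
  · simp only [if_neg h, if_neg (Ne.symm h), Complex.ofReal_zero, mul_zero, zero_smul, sub_zero]
    module

theorem annihilation_weylSchwartz (u v : Config d L) (k : box d L)
    (s : ℝ) (φ : 𝓢(Config d L, ℂ)) : annihilation A B γ k (weylSchwartz u v s φ) =
      weylSchwartz u v s (annihilation A B γ k φ) +
        (Complex.I * s * modeCoeff A B γ u v k) • weylSchwartz u v s φ := by
  simp only [annihilation_apply, position_weylSchwartz, momentum_weylSchwartz, map_add, map_smul,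
    modeCoeff, real_inner_comm v (B k)]
  ext q
  simp only [smul_apply, add_apply, sub_apply, smul_eq_mul]
  push_cast
  linear_combination (-(s * (√(γ k / 2) : ℝ) * (inner ℝ v (B k) : ℝ) : ℂ) *
    weylSchwartz u v s φ q) * Complex.I_mul_I

theorem creationOp_weylSchwartz (u v : Config d L) (k : box d L)
    (s : ℝ) (φ : 𝓢(Config d L, ℂ)) : creationOp A B γ k (weylSchwartz u v s φ) =
      weylSchwartz u v s (creationOp A B γ k φ) -
        (Complex.I * s * starRingEnd ℂ (modeCoeff A B γ u v k)) • weylSchwartz u v s φ := by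
  simp only [creationOp_apply, position_weylSchwartz, momentum_weylSchwartz, map_add, map_sub,
    map_smul, map_mul, modeCoeff, real_inner_comm v (B k), Complex.conj_ofReal, Complex.conj_I]
  ext q
  simp only [smul_apply, add_apply, sub_apply, smul_eq_mul]
  push_cast
  linear_combination (-(s * (√(γ k / 2) : ℝ) * (inner ℝ v (B k) : ℝ) : ℂ) *
    weylSchwartz u v s φ q) * Complex.I_mul_I

/-- The group of Weyl operators, as a Weyl group of the normal modes. -/
theorem isWeylGroup (hm : IsNormalModes A B γ) (u v : Config d L) :
    IsWeylGroup (incl d L) (annihilation A B γ) (creationOp A B γ) (modeCoeff A B γ u v)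
      (expI (onSchwartz (phaseField u v)).closure) (weylSchwartz u v) := by
  obtain ⟨h1, h2⟩ := isUnitaryGroup_weyl u v
  refine ⟨h1.zero, h1.mem_unitary, h2, fun φ s => ?_, annihilation_weylSchwartz u v,
    creationOp_weylSchwartz u v⟩
  rw [← phaseField_eq_fieldOp hm]
  obtain ⟨h3, h4⟩ := onSchwartz_closure_apply (phaseField u v) φ
  rw [← h4]
  exact h1.hasDerivAt_apply ⟨_, h3⟩ s

end Modes

/-! ### Vanishing moments and injectivity of the Fourier transform -/

section Moments

open scoped ContDiff

variable {V : Type} [NormedAddCommGroup V] [InnerProductSpace ℝ V] [FiniteDimensional ℝ V]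
  [MeasurableSpace V] [BorelSpace V]

/-- Expand the exponential in its power series; the exponential moments dominate the partial sums,
so each term integrates to zero separately. -/
theorem integral_exp_mul_eq_zero_of_moments {F : V → ℂ} (hF : AEStronglyMeasurable F)
    (hint : ∀ ξ : V, Integrable fun q => Real.exp |inner ℝ ξ q| * ‖F q‖)
    (hmom : ∀ (ξ : V) (n : ℕ), ∫ q, ((inner ℝ ξ q : ℝ) : ℂ) ^ n * F q = 0) (ξ : V) :
    ∫ q, Complex.exp ((inner ℝ ξ q : ℝ) * Complex.I) * F q = 0 := by
  have hcont : Continuous fun q : V => ((inner ℝ ξ q : ℝ) : ℂ) := by fun_prop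
  have hs : ∀ q : V, HasSum (fun n : ℕ => |inner ℝ ξ q| ^ n / n.factorial * ‖F q‖)
      (Real.exp |inner ℝ ξ q| * ‖F q‖) := fun q => by
    have := NormedSpace.expSeries_div_hasSum_exp (𝔸 := ℝ) |inner ℝ ξ q|
    rw [← Real.exp_eq_exp_ℝ] at this
    exact this.mul_right _
  have h := hasSum_integral_of_dominated_convergence (μ := (volume : Measure V))
    (F := fun (n : ℕ) q => (((inner ℝ ξ q : ℝ) : ℂ) * Complex.I) ^ n / n.factorial * F q)
    (f := fun q => Complex.exp ((inner ℝ ξ q : ℝ) * Complex.I) * F q)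
    (fun n q => |inner ℝ ξ q| ^ n / n.factorial * ‖F q‖)
    (fun n => (((hcont.mul continuous_const).pow n).div_const _).aestronglyMeasurable.mul hF)
    (fun n => Eventually.of_forall fun q => by simp)
    (Eventually.of_forall fun q => (hs q).summable)
    (by simpa only [(hs _).tsum_eq] using hint ξ)
    (Eventually.of_forall fun q => by
      have := NormedSpace.expSeries_div_hasSum_exp (𝔸 := ℂ) (((inner ℝ ξ q : ℝ) : ℂ) * Complex.I)
      rw [← Complex.exp_eq_exp_ℂ] at this
      exact this.mul_right _)
  have h0 : ∀ n : ℕ, ∫ q, (((inner ℝ ξ q : ℝ) : ℂ) * Complex.I) ^ n / n.factorial * F q = 0 :=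
    fun n => by
      have : ∀ q, (((inner ℝ ξ q : ℝ) : ℂ) * Complex.I) ^ n / n.factorial * F q =
          (Complex.I ^ n / n.factorial) * (((inner ℝ ξ q : ℝ) : ℂ) ^ n * F q) := fun q => by
        rw [mul_pow]
        ring
      simp only [this]
      rw [integral_const_mul, hmom, mul_zero]
  simp only [h0] at h
  exact (hasSum_zero.unique h).symm

/-- An integrable function whose Fourier transform vanishes is zero almost everywhere. -/
theorem ae_eq_zero_of_fourier_eq_zero {F : V → ℂ} (hF : Integrable F)
    (h : ∀ ξ : V, ∫ q, Complex.exp ((inner ℝ ξ q : ℝ) * Complex.I) * F q = 0) :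
    ∀ᵐ q, F q = 0 := by
  have hfou : ∀ ξ, Real.instFourierTransform.fourier F ξ = 0 := fun ξ => by
    rw [Real.fourier_eq']
    have := h ((-2 * Real.pi) • ξ)
    simp only [inner_smul_left] at this
    simpa [real_inner_comm, mul_assoc] using this
  refine ae_eq_zero_of_integral_contDiff_smul_eq_zero hF.locallyIntegrable fun g hg hgs => ?_
  have hgs' : HasCompactSupport fun q => (g q : ℂ) := hgs.comp_left Complex.ofReal_zero
  let χ : 𝓢(V, ℂ) := hgs'.toSchwartzMap (Complex.ofRealCLM.contDiff.comp hg)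
  let η : 𝓢(V, ℂ) := FourierTransformInv.fourierInv χ
  have hη : FourierTransform.fourier η = χ := FourierTransform.fourier_fourierInv_eq χ
  -- Writing the test function as the Fourier transform of a Schwartz function moves the transform
  -- onto `F`, where it vanishes.
  have key := VectorFourier.integral_fourierIntegral_smul_eq_flip (L := innerₗ V)
    (μ := (volume : Measure V)) (ν := (volume : Measure V)) (e := Real.fourierChar)
    Real.continuous_fourierChar continuous_inner hF η.integrable
  have hl : ∀ ξ, VectorFourier.fourierIntegral Real.fourierChar volume (innerₗ V) F ξ = 0 := hfou
  simp only [hl, zero_smul, integral_zero, flip_innerₗ] at key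
  rw [key]
  refine integral_congr_ae (Eventually.of_forall fun q => ?_)
  have h1 : VectorFourier.fourierIntegral Real.fourierChar volume (innerₗ V) η q = χ q := by
    rw [← hη]
    rfl
  change _ = F q • _
  rw [h1]
  change g q • F q = F q * (g q : ℂ)
  rw [Complex.real_smul, mul_comm]

/-- Split the Gaussian into two halves. One absorbs the exponential through `a ‖T q‖ ≤ a² + ‖T q‖² /
4`; the other is square integrable and pairs with `x`. -/
theorem integrable_exp_mul_gaussian (T : V ≃L[ℝ] V) {x : V → ℂ} (hx : MemLp x 2) (ξ : V) :
    Integrable fun q => Real.exp |inner ℝ ξ q| * ‖gaussian T q * x q‖ := by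
  have hg : MemLp (fun q => Real.exp (-(‖T q‖ ^ 2 / 4))) 2 (volume : Measure V) := by
    rw [memLp_two_iff_integrable_sq (by fun_prop)]
    have := (gaussian T).integrable (μ := (volume : Measure V)) |>.norm
    refine this.congr (Eventually.of_forall fun q => ?_)
    simp only [gaussian_apply]
    rw [Complex.norm_real, Real.norm_eq_abs, Real.abs_exp, ← Real.exp_nat_mul]
    congr 1
    push_cast
    ring
  set a : ℝ := ‖ξ‖ * ‖(T.symm : V →L[ℝ] V)‖ with ha
  refine ((hg.integrable_mul hx.norm).const_mul (Real.exp (a ^ 2))).mono' ?_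
    (Eventually.of_forall fun q => ?_)
  · refine AEStronglyMeasurable.mul (by fun_prop) (AEStronglyMeasurable.norm ?_)
    exact (gaussian T).continuous.aestronglyMeasurable.mul hx.1
  · have hq : |inner ℝ ξ q| ≤ a * ‖T q‖ := by
      refine (abs_real_inner_le_norm ξ q).trans ?_
      have : ‖q‖ ≤ ‖(T.symm : V →L[ℝ] V)‖ * ‖T q‖ := by
        simpa using (T.symm : V →L[ℝ] V).le_opNorm (T q)
      rw [ha, mul_assoc]
      gcongr
    simp only [gaussian_apply, norm_mul, Complex.norm_real, Real.norm_eq_abs, Real.abs_exp,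
      Pi.mul_apply, abs_norm]
    rw [← mul_assoc, ← mul_assoc, ← Real.exp_add, ← Real.exp_add]
    refine mul_le_mul_of_nonneg_right (Real.exp_le_exp.2 ?_) (norm_nonneg _)
    nlinarith [sq_nonneg (a - ‖T q‖ / 2)]

end Moments

/-! ### The Gaussian ground state and completeness of the eigenbasis -/

section Vacuum

variable {d L : ℕ} {A B : box d L → Config d L} {γ : box d L → ℝ}

theorem inner_incl_left (φ : 𝓢(Config d L, ℂ)) (x : HSpace d L) :
    inner ℂ (incl d L φ) x = ∫ q, starRingEnd ℂ (φ q) * x q := by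
  rw [L2.inner_def]
  refine integral_congr_ae ?_
  filter_upwards [SchwartzMap.coeFn_toLp φ 2 (volume : Measure (Config d L))] with q hq
  have : (incl d L φ : Config d L → ℂ) q = φ q := hq
  rw [this]
  simp [mul_comm]

/-- The vectors obtained from a Gaussian by applying position operators are total. -/
theorem eq_zero_of_inner_gaussian (T : Config d L ≃L[ℝ] Config d L)
    (S : Submodule ℂ 𝓢(Config d L, ℂ)) (hT : gaussian T ∈ S)
    (hS : ∀ u, ∀ φ ∈ S, position u φ ∈ S) (x : HSpace d L)
    (hx : ∀ φ ∈ S, inner ℂ (incl d L φ) x = 0) : x = 0 := by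
  have hpow : ∀ (ξ : Config d L) (n : ℕ), ∃ φ ∈ S, ∀ q,
      φ q = ((inner ℝ ξ q : ℝ) : ℂ) ^ n * gaussian T q := fun ξ n => by
    induction n with
    | zero => exact ⟨_, hT, fun q => by simp⟩
    | succ n ih =>
      obtain ⟨φ, hφ, hq⟩ := ih
      refine ⟨_, hS ξ φ hφ, fun q => ?_⟩
      rw [position_apply, hq, pow_succ]
      ring
  have hxm : MemLp x 2 := Lp.memLp x
  have hmeas : AEStronglyMeasurable (fun q => gaussian T q * x q) :=
    (gaussian T).continuous.aestronglyMeasurable.mul hxm.1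
  have hint := integrable_exp_mul_gaussian T hxm
  have hmom : ∀ (ξ : Config d L) (n : ℕ),
      ∫ q, ((inner ℝ ξ q : ℝ) : ℂ) ^ n * (gaussian T q * x q) = 0 := fun ξ n => by
    obtain ⟨φ, hφ, hq⟩ := hpow ξ n
    rw [← hx φ hφ, inner_incl_left]
    refine integral_congr_ae (Eventually.of_forall fun q => ?_)
    simp only [hq, gaussian_apply, map_mul, map_pow, Complex.conj_ofReal]
    ring
  have h0 : ∀ᵐ q, gaussian T q * x q = 0 := by
    refine ae_eq_zero_of_fourier_eq_zero ?_ (integral_exp_mul_eq_zero_of_moments hmeas hint hmom)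
    have := hint 0
    simp only [inner_zero_left, abs_zero, Real.exp_zero, one_mul] at this
    exact (integrable_norm_iff hmeas).1 this
  refine (Lp.eq_zero_iff_ae_eq_zero).2 ?_
  filter_upwards [h0] with q hq
  refine (mul_eq_zero.1 hq).resolve_left ?_
  rw [gaussian_apply]
  exact_mod_cast (Real.exp_pos _).ne'

/-- The coordinates `q ↦ (√γₖ ⟨Bₖ, q⟩)ₖ`. -/
def modeCoords (B : box d L → Config d L) (γ : box d L → ℝ) : Config d L →ₗ[ℝ] Config d L where
  toFun q := WithLp.toLp 2 fun k => √(γ k) * inner ℝ (B k) q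
  map_add' q q' := by
    ext k
    simp [inner_add_right, mul_add]
  map_smul' s q := by
    ext k
    simp [inner_smul_right]
    ring

theorem IsNormalModes.injective_modeCoords (hm : IsNormalModes A B γ) :
    Function.Injective (modeCoords B γ) := by
  refine (injective_iff_map_eq_zero _).2 fun q hq => ?_
  rw [← hm.expand_right q]
  refine Finset.sum_eq_zero fun k _ => ?_
  have h1 : √(γ k) * inner ℝ (B k) q = 0 := congrArg (fun v : Config d L => v k) hq
  have h2 := (mul_eq_zero.1 h1).resolve_left (Real.sqrt_pos.2 (hm.pos k)).ne'
  rw [real_inner_comm, h2, zero_smul]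

/-- The normal mode coordinates as an equivalence. -/
def IsNormalModes.coords (hm : IsNormalModes A B γ) : Config d L ≃L[ℝ] Config d L :=
  (LinearEquiv.ofInjectiveEndo (modeCoords B γ) hm.injective_modeCoords).toContinuousLinearEquiv

theorem IsNormalModes.coords_apply (hm : IsNormalModes A B γ) (q : Config d L) (k : box d L) :
    hm.coords q k = √(γ k) * inner ℝ (B k) q := rfl

theorem IsNormalModes.inner_coords (hm : IsNormalModes A B γ) (q : Config d L) (k : box d L) :
    inner ℝ (hm.coords q) (hm.coords (A k)) = γ k * inner ℝ (B k) q := by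
  rw [PiLp.inner_apply, Finset.sum_eq_single k]
  · simp only [hm.coords_apply, hm.dual, if_true, mul_one]
    simp only [RCLike.inner_apply, conj_trivial]
    rw [← mul_assoc, Real.mul_self_sqrt (hm.pos k).le]
  · intro l _ hl
    simp [hm.coords_apply, hm.dual, hl]
  · simp

/-- The logarithmic derivative of the Gaussian along `A k` is `-γ k ⟨B k, q⟩`, which cancels the
position part of the annihilation operator. -/
theorem annihilation_gaussian (hm : IsNormalModes A B γ) (k : box d L) :
    annihilation A B γ k (gaussian hm.coords) = 0 := by
  ext q
  have hs : √(γ k / 2) = (√(2 * γ k))⁻¹ * γ k := by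
    have h1 : √(2 * γ k) * √(γ k / 2) = γ k := by
      rw [← Real.sqrt_mul (by linarith [hm.pos k])]
      rw [show 2 * γ k * (γ k / 2) = γ k ^ 2 by ring, Real.sqrt_sq (hm.pos k).le]
    have h2 : √(2 * γ k) ≠ 0 := (Real.sqrt_pos.2 (by linarith [hm.pos k])).ne'
    rw [eq_inv_mul_iff_mul_eq₀ h2, h1]
  rw [annihilation_apply, add_apply, smul_apply, smul_apply, position_apply, momentum_apply,
    (hasFDerivAt_gaussian hm.coords q).fderiv, hs]
  have : (hm.coords : Config d L →L[ℝ] Config d L) (A k) = hm.coords (A k) := rfl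
  simp only [smul_apply, ContinuousLinearMap.comp_apply, innerSL_apply_apply, this,
    hm.inner_coords, Complex.ofRealCLM_apply, smul_eq_mul, zero_apply]
  push_cast
  linear_combination ((((√(2 * γ k) : ℝ) : ℂ)⁻¹) * γ k * (inner ℝ (B k) q : ℝ) *
    gaussian hm.coords q : ℂ) * Complex.I_mul_I

/-- The ground state. -/
def vacuum (hm : IsNormalModes A B γ) : 𝓢(Config d L, ℂ) :=
  ((‖incl d L (gaussian hm.coords)‖⁻¹ : ℝ) : ℂ) • gaussian hm.coords

theorem gaussian_ne_zero (T : Config d L ≃L[ℝ] Config d L) : gaussian T ≠ 0 := fun h => by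
  have h1 := congrArg (fun φ : 𝓢(Config d L, ℂ) => φ 0) h
  simp [gaussian_apply] at h1

/-- The substance is cyclicity. Every position operator is a combination of the sums `a k + c k`, so
an invariant subspace containing the vacuum contains all powers of linear forms times the Gaussian,
and these are total. -/
theorem isLadderSystem (hm : IsNormalModes A B γ) :
    IsLadderSystem (incl d L) (annihilation A B γ) (creationOp A B γ) (vacuum hm) := by
  have hne : ‖incl d L (gaussian hm.coords)‖ ≠ 0 := by
    rw [norm_ne_zero_iff]
    exact fun h => gaussian_ne_zero hm.coords (incl_injective d L (h.trans (map_zero _).symm))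
  refine ⟨inner_creationOp, annihilation_creationOp hm, creationOp_comm hm, fun k => ?_, ?_,
    fun S hΩ hS x hx => ?_⟩
  · rw [vacuum, map_smul, annihilation_gaussian, smul_zero]
  · rw [vacuum, map_smul, norm_smul, Complex.norm_real, norm_inv, norm_norm, inv_mul_cancel₀ hne]
  · refine eq_zero_of_inner_gaussian hm.coords S ?_ (fun u φ hφ => ?_) x hx
    · have := S.smul_mem (‖incl d L (gaussian hm.coords)‖ : ℂ) hΩ
      rwa [vacuum, smul_smul, ← Complex.ofReal_mul, mul_inv_cancel₀ hne, Complex.ofReal_one,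
        one_smul] at this
    · rw [← hm.expand_left u, position_sum_smul, LinearMap.sum_apply]
      refine S.sum_mem fun k _ => S.smul_mem _ ?_
      rw [position_eq hm]
      exact S.smul_mem _ (S.add_mem (hS k φ hφ).1 (hS k φ hφ).2)

end Vacuum

/-! ### Spectral decomposition of a real symmetric matrix in coordinates -/

section Diagonalization

variable {n : Type} [Fintype n] [DecidableEq n] {M : Matrix n n ℝ}

/-- The orthogonal matrix of eigenvectors. -/
def eigenMatrix (hM : M.IsHermitian) : Matrix n n ℝ := hM.eigenvectorUnitary

theorem sum_eigenMatrix_row (hM : M.IsHermitian) (x y : n) :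
    ∑ k, eigenMatrix hM x k * eigenMatrix hM y k = if x = y then 1 else 0 := by
  have h := Matrix.mem_unitaryGroup_iff.1 hM.eigenvectorUnitary.2
  have h1 := congrFun (congrFun h x) y
  rw [Matrix.mul_apply, Matrix.one_apply] at h1
  rw [← h1]
  exact Finset.sum_congr rfl fun k _ => by simp [eigenMatrix]

theorem sum_eigenMatrix_col (hM : M.IsHermitian) (k l : n) :
    ∑ x, eigenMatrix hM x k * eigenMatrix hM x l = if k = l then 1 else 0 := by
  have h := Matrix.mem_unitaryGroup_iff'.1 hM.eigenvectorUnitary.2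
  have h1 := congrFun (congrFun h k) l
  rw [Matrix.mul_apply, Matrix.one_apply] at h1
  rw [← h1]
  exact Finset.sum_congr rfl fun k _ => by simp [eigenMatrix]

theorem sum_eigenvalues_mul (hM : M.IsHermitian) (x y : n) :
    ∑ k, hM.eigenvalues k * (eigenMatrix hM x k * eigenMatrix hM y k) = M x y := by
  have h := congrFun (congrFun hM.spectral_theorem x) y
  rw [h, Unitary.conjStarAlgAut_apply, Matrix.mul_apply]
  refine Finset.sum_congr rfl fun k _ => ?_
  rw [Matrix.mul_diagonal]
  simp [eigenMatrix]
  ring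

end Diagonalization

/-! ### Normal modes of the oscillator system -/

section Concrete

variable {d : ℕ} {p : Params d} {L : ℕ}

theorem hOne_apply (x y : box d L) :
    hOne p L x y = √(1 / (2 * p.m x)) * h₀ p L x y * √(1 / (2 * p.m y)) := by
  rw [hOne, sqrtMu, Matrix.mul_diagonal, Matrix.diagonal_mul]

theorem posDef_hOne (hm : ∀ x : box d L, 0 < p.m x) (h : (h₀ p L).PosDef) : (hOne p L).PosDef := by
  have h1 : (sqrtMu p L).conjTranspose = sqrtMu p L := by
    simp [sqrtMu]
  have h2 := h.mul_mul_conjTranspose_same (B := sqrtMu p L) (by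
    refine Matrix.vecMul_injective_of_isUnit ?_
    rw [Matrix.isUnit_iff_isUnit_det, sqrtMu, Matrix.det_diagonal, isUnit_iff_ne_zero,
      Finset.prod_ne_zero_iff]
    exact fun x _ => (Real.sqrt_pos.2 (by have := hm x; positivity)).ne')
  rwa [h1] at h2

/-- The frequencies of the normal modes. -/
def freq (p : Params d) (L : ℕ) (k : box d L) : ℝ := √((hOne_isHermitian p L).eigenvalues k)

/-- The momentum components of the normal modes. -/
def modeA (p : Params d) (L : ℕ) (k : box d L) : Config d L :=
  WithLp.toLp 2 fun x => √(1 / (2 * p.m x)) * eigenMatrix (hOne_isHermitian p L) x k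

/-- The position components of the normal modes. -/
def modeB (p : Params d) (L : ℕ) (k : box d L) : Config d L :=
  WithLp.toLp 2 fun x => √(2 * p.m x) * eigenMatrix (hOne_isHermitian p L) x k

theorem sqrt_mul_sqrt_one_div {m : ℝ} (hm : 0 < m) : √(2 * m) * √(1 / (2 * m)) = 1 := by
  rw [← Real.sqrt_mul (by positivity), mul_one_div_cancel (by positivity), Real.sqrt_one]

theorem freq_sq (hm : ∀ x : box d L, 0 < p.m x) (h : (h₀ p L).PosDef) (k : box d L) :
    freq p L k ^ 2 = (hOne_isHermitian p L).eigenvalues k :=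
  Real.sq_sqrt ((posDef_hOne hm h).eigenvalues_pos k).le

/-- The modes are the columns of `μ^{1/2} O` and `μ^{-1/2} O`; orthogonality of `O` makes the two
families dual bases. -/
theorem isNormalModes (hm : ∀ x : box d L, 0 < p.m x) (h : (h₀ p L).PosDef) :
    IsNormalModes (modeA p L) (modeB p L) (freq p L) := by
  have hs : ∀ x : box d L, √(2 * p.m x) * √(1 / (2 * p.m x)) = 1 := fun x =>
    sqrt_mul_sqrt_one_div (hm x)
  refine ⟨fun k => Real.sqrt_pos.2 ((posDef_hOne hm h).eigenvalues_pos k), fun k l => ?_,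
    fun u => ?_, fun v => ?_⟩
  · rw [PiLp.inner_apply, ← sum_eigenMatrix_col (hOne_isHermitian p L)]
    refine Finset.sum_congr rfl fun x _ => ?_
    simp only [modeA, modeB, RCLike.inner_apply, conj_trivial]
    linear_combination (eigenMatrix (hOne_isHermitian p L) x k *
      eigenMatrix (hOne_isHermitian p L) x l) * hs x
  · ext x
    simp only [WithLp.ofLp_sum, Finset.sum_apply, PiLp.smul_apply, smul_eq_mul, PiLp.inner_apply,
      modeA, modeB, RCLike.inner_apply, conj_trivial, Finset.sum_mul]
    rw [Finset.sum_comm, Finset.sum_eq_single x]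
    · have := sum_eigenMatrix_row (hOne_isHermitian p L) x x
      rw [if_pos rfl] at this
      calc _ = ∑ k, (u x * (√(2 * p.m x) * √(1 / (2 * p.m x)))) *
            (eigenMatrix (hOne_isHermitian p L) x k * eigenMatrix (hOne_isHermitian p L) x k) :=
            Finset.sum_congr rfl fun k _ => by ring
        _ = _ := by rw [← Finset.mul_sum, this, hs, mul_one, mul_one]
    · intro y _ hy
      have := sum_eigenMatrix_row (hOne_isHermitian p L) y x
      rw [if_neg hy] at this
      calc _ = ∑ k, (u y * (√(2 * p.m x) * √(1 / (2 * p.m y)))) *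
            (eigenMatrix (hOne_isHermitian p L) y k * eigenMatrix (hOne_isHermitian p L) x k) :=
            Finset.sum_congr rfl fun k _ => by ring
        _ = _ := by rw [← Finset.mul_sum, this, mul_zero]
    · simp
  · ext x
    simp only [WithLp.ofLp_sum, Finset.sum_apply, PiLp.smul_apply, smul_eq_mul, PiLp.inner_apply,
      modeA, modeB, RCLike.inner_apply, conj_trivial, Finset.sum_mul]
    rw [Finset.sum_comm, Finset.sum_eq_single x]
    · have := sum_eigenMatrix_row (hOne_isHermitian p L) x x
      rw [if_pos rfl] at this
      calc _ = ∑ k, (v x * (√(2 * p.m x) * √(1 / (2 * p.m x)))) *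
            (eigenMatrix (hOne_isHermitian p L) x k * eigenMatrix (hOne_isHermitian p L) x k) :=
            Finset.sum_congr rfl fun k _ => by ring
        _ = _ := by rw [← Finset.mul_sum, this, hs, mul_one, mul_one]
    · intro y _ hy
      have := sum_eigenMatrix_row (hOne_isHermitian p L) y x
      rw [if_neg hy] at this
      calc _ = ∑ k, (v y * (√(2 * p.m y) * √(1 / (2 * p.m x)))) *
            (eigenMatrix (hOne_isHermitian p L) y k * eigenMatrix (hOne_isHermitian p L) x k) :=
            Finset.sum_congr rfl fun k _ => by ring
        _ = _ := by rw [← Finset.mul_sum, this, mul_zero]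
    · simp

/-- In matrix form, `(μ^{1/2} O)(μ^{1/2} O)ᵀ = μ`: the kinetic energy is a plain sum of squares in
the modes. -/
theorem sum_momentum_modeA (hm : ∀ x : box d L, 0 < p.m x) (ψ : 𝓢(Config d L, ℂ)) :
    ∑ k, momentum (modeA p L k) (momentum (modeA p L k) ψ) =
      ∑ x : box d L, ((1 / (2 * p.m x) : ℝ) : ℂ) • momOp x (momOp x ψ) := by
  have h1 : ∀ k, momentum (modeA p L k) (momentum (modeA p L k) ψ) =
      ∑ x, ∑ y, ((modeA p L k x * modeA p L k y : ℝ) : ℂ) • momOp x (momOp y ψ) := fun k => by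
    have h2 : ∀ (v : Config d L) (φ : 𝓢(Config d L, ℂ)),
        momentum v φ = ∑ x, (v x : ℂ) • momOp x φ := fun v φ => by
      rw [momentum, LinearMap.sum_apply]
      rfl
    rw [h2]
    refine Finset.sum_congr rfl fun x _ => ?_
    rw [h2, map_sum, Finset.smul_sum]
    refine Finset.sum_congr rfl fun y _ => ?_
    rw [map_smul, smul_smul, Complex.ofReal_mul]
  simp only [h1]
  rw [Finset.sum_comm]
  refine Finset.sum_congr rfl fun x _ => ?_
  rw [Finset.sum_comm, Finset.sum_eq_single x]
  · rw [← Finset.sum_smul, ← Complex.ofReal_sum]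
    congr 2
    have := sum_eigenMatrix_row (hOne_isHermitian p L) x x
    rw [if_pos rfl] at this
    have hp := hm x
    calc ∑ k, modeA p L k x * modeA p L k x = ∑ k, (√(1 / (2 * p.m x)) * √(1 / (2 * p.m x))) *
          (eigenMatrix (hOne_isHermitian p L) x k * eigenMatrix (hOne_isHermitian p L) x k) :=
          Finset.sum_congr rfl fun k _ => by simp only [modeA]; ring
      _ = _ := by rw [← Finset.mul_sum, this, Real.mul_self_sqrt (by positivity), mul_one]
  · intro y _ hy
    rw [← Finset.sum_smul, ← Complex.ofReal_sum]
    have := sum_eigenMatrix_row (hOne_isHermitian p L) x y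
    rw [if_neg (Ne.symm hy)] at this
    have h0 : ∑ k, modeA p L k x * modeA p L k y = 0 := by
      calc ∑ k, modeA p L k x * modeA p L k y = ∑ k, (√(1 / (2 * p.m x)) * √(1 / (2 * p.m y))) *
          (eigenMatrix (hOne_isHermitian p L) x k * eigenMatrix (hOne_isHermitian p L) y k) :=
          Finset.sum_congr rfl fun k _ => by simp only [modeA]; ring
        _ = _ := by rw [← Finset.mul_sum, this, mul_zero]
    rw [h0, Complex.ofReal_zero, zero_smul]
  · simp

/-- In matrix form, `μ^{-1/2} O diag(γ²) Oᵀ μ^{-1/2} = μ^{-1/2} h_L μ^{-1/2} = h_{0,L}`, so the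
modes also diagonalize the potential energy. -/
theorem sum_freq_sq_modeB (hm : ∀ x : box d L, 0 < p.m x) (h : (h₀ p L).PosDef)
    (q : Config d L) : ∑ k, freq p L k ^ 2 * (inner ℝ (modeB p L k) q) ^ 2 =
      ∑ x, ∑ y, h₀ p L x y * (q x * q y) := by
  have hs : ∀ x : box d L, √(2 * p.m x) * √(1 / (2 * p.m x)) = 1 := fun x =>
    sqrt_mul_sqrt_one_div (hm x)
  have h1 : ∀ k, freq p L k ^ 2 * (inner ℝ (modeB p L k) q) ^ 2 =
      ∑ x : box d L, ∑ y : box d L, (√(2 * p.m x) * √(2 * p.m y) * (q x * q y)) *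
        ((hOne_isHermitian p L).eigenvalues k * (eigenMatrix (hOne_isHermitian p L) x k *
          eigenMatrix (hOne_isHermitian p L) y k)) := fun k => by
    rw [freq_sq hm h, sq, PiLp.inner_apply, Finset.sum_mul_sum, Finset.mul_sum]
    refine Finset.sum_congr rfl fun x _ => ?_
    rw [Finset.mul_sum]
    refine Finset.sum_congr rfl fun y _ => ?_
    simp only [modeB, RCLike.inner_apply, conj_trivial]
    ring
  simp only [h1]
  rw [Finset.sum_comm]
  refine Finset.sum_congr rfl fun x _ => ?_
  rw [Finset.sum_comm]
  refine Finset.sum_congr rfl fun y _ => ?_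
  rw [← Finset.mul_sum, sum_eigenvalues_mul, hOne_apply]
  linear_combination (h₀ p L x y * (q x * q y)) * (√(2 * p.m y) * √(1 / (2 * p.m y)) * hs x + hs y)

/-- The couplings of nearest neighbors. -/
def edgeWeight (p : Params d) (L : ℕ) (x y : box d L) : ℝ :=
  if dist₁ (x : Fin d → ℤ) y = 1 then p.lam s(↑x, ↑y) else 0

theorem edgeWeight_comm (x y : box d L) : edgeWeight p L x y = edgeWeight p L y x := by
  simp only [edgeWeight, dist₁_comm (x : Fin d → ℤ) y, Sym2.eq_swap (a := (x : Fin d → ℤ))]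

theorem h₀_apply (x y : box d L) : h₀ p L x y =
    (if x = y then p.k x / 2 + ∑ u, edgeWeight p L x u else 0) - edgeWeight p L x y := by
  by_cases hxy : x = y
  · subst hxy
    have : edgeWeight p L x x = 0 := by simp [edgeWeight, dist₁]
    rw [this, sub_zero]
    simp only [h₀, Matrix.of_apply, if_true, edgeWeight, dist₁_comm (x : Fin d → ℤ)]
  · simp only [h₀, Matrix.of_apply, if_neg hxy, edgeWeight]
    split_ifs <;> simp

theorem potential_eq (p : Params d) (L : ℕ) (q : box d L → ℝ) :
    ∑ x : box d L, p.k x / 2 * q x ^ 2 + 1 / 2 * ∑ x : box d L, ∑ y : box d L,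
      (if dist₁ (x : Fin d → ℤ) y = 1 then p.lam s(↑x, ↑y) * (q x - q y) ^ 2 else 0) =
      ∑ x, ∑ y, h₀ p L x y * (q x * q y) := by
  let l := edgeWeight p L
  have hl : ∀ x y, l x y = l y x := edgeWeight_comm
  have h2 : ∀ x y : box d L, (if dist₁ (x : Fin d → ℤ) y = 1 then
      p.lam s(↑x, ↑y) * (q x - q y) ^ 2 else 0) =
      l x y * q x ^ 2 + l y x * q y ^ 2 - 2 * (l x y * (q x * q y)) := fun x y => by
    rw [hl y x]
    simp only [l, edgeWeight]
    split_ifs <;> ring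
  have hh : ∀ x y, h₀ p L x y = (if x = y then p.k x / 2 + ∑ u, l x u else 0) - l x y :=
    h₀_apply
  simp only [h2, hh, sub_mul, ite_mul, zero_mul, Finset.sum_sub_distrib, Finset.sum_add_distrib,
    Finset.sum_ite_eq, Finset.mem_univ, if_true]
  rw [Finset.sum_comm (f := fun x y => l y x * q y ^ 2)]
  simp only [add_mul, Finset.sum_add_distrib, Finset.sum_mul, ← Finset.mul_sum]
  have h3 : ∀ x, q x * q x = q x ^ 2 := fun x => (sq _).symm
  simp only [h3]
  ring

/-- The Hamiltonian as a sum over the normal modes. -/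
theorem hamSchwartz_eq (hm : ∀ x : box d L, 0 < p.m x) (h : (h₀ p L).PosDef)
    (ψ : 𝓢(Config d L, ℂ)) : hamSchwartz p L ψ =
      ∑ k, (freq p L k : ℂ) • ((2 : ℂ) • creationOp (modeA p L) (modeB p L) (freq p L) k
        (annihilation (modeA p L) (modeB p L) (freq p L) k ψ) + ψ) := by
  have hN := isNormalModes hm h
  -- Each mode satisfies `γ (2 c a + 1) = P² + γ² Q²`; the commutator contributes `-γ`, which the
  -- ground state energy cancels.
  have hk : ∀ k, (freq p L k : ℂ) • ((2 : ℂ) • creationOp (modeA p L) (modeB p L) (freq p L) k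
        (annihilation (modeA p L) (modeB p L) (freq p L) k ψ) + ψ) =
      momentum (modeA p L k) (momentum (modeA p L k) ψ) +
        ((freq p L k ^ 2 : ℝ) : ℂ) • position (modeB p L k) (position (modeB p L k) ψ) :=
    fun k => by
      have hg := hN.pos k
      have h1 : (√(freq p L k / 2) : ℂ) * (√(freq p L k / 2) : ℂ) = freq p L k / 2 := by
        rw [← Complex.ofReal_mul, Real.mul_self_sqrt (by positivity)]
        simp
      have h2 : ((√(2 * freq p L k))⁻¹ : ℂ) * ((√(2 * freq p L k))⁻¹ : ℂ) *
          freq p L k = 1 / 2 := by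
        rw [← mul_inv, ← Complex.ofReal_mul, Real.mul_self_sqrt (by positivity)]
        have : (freq p L k : ℂ) ≠ 0 := by exact_mod_cast hg.ne'
        push_cast
        field_simp
      have h3 : (√(freq p L k / 2) : ℂ) * ((√(2 * freq p L k))⁻¹ : ℂ) = 1 / 2 := by
        rw [← Complex.ofReal_inv, ← Complex.ofReal_mul, sqrt_half_mul_inv hg]
        simp
      simp only [creationOp_apply, annihilation_apply, map_add, map_smul, momentum_position,
        hN.dual, if_true]
      ext q
      simp only [smul_apply, add_apply, sub_apply, smul_eq_mul]
      push_cast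
      have hI := Complex.I_mul_I
      set Q2 := position (modeB p L k) (position (modeB p L k) ψ) q
      set QP := position (modeB p L k) (momentum (modeA p L k) ψ) q
      set P2 := momentum (modeA p L k) (momentum (modeA p L k) ψ) q
      set s := (√(freq p L k / 2) : ℂ)
      set r := ((√(2 * freq p L k))⁻¹ : ℂ)
      set g := (freq p L k : ℂ)
      linear_combination (2 * g * Q2) * h1 - 2 * P2 * Complex.I * Complex.I * h2 +
        2 * g * Complex.I * Complex.I * ψ q * h3 - P2 * hI + g * ψ q * hI
  simp only [hk, Finset.sum_add_distrib, sum_momentum_modeA hm]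
  ext q
  have hpot := congrArg (fun r : ℝ => (r : ℂ) * ψ q)
    ((potential_eq p L q).trans (sum_freq_sq_modeB hm h q).symm)
  simp only [hamSchwartz, LinearMap.add_apply, LinearMap.smul_apply, LinearMap.sum_apply,
    add_apply, smul_apply, schwartz_sum_apply, LinearMap.comp_apply, Finset.sum_add_distrib,
    smul_eq_mul]
  have h4 : ∀ x y : box d L, (if dist₁ (x : Fin d → ℤ) y = 1 then
        ((p.lam s(↑x, ↑y) : ℝ) : ℂ) • ((posOp x - posOp y) ∘ₗ (posOp x - posOp y))
      else 0 : 𝓢(Config d L, ℂ) →ₗ[ℂ] 𝓢(Config d L, ℂ)) ψ q =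
      ((if dist₁ (x : Fin d → ℤ) y = 1 then p.lam s(↑x, ↑y) * (q x - q y) ^ 2 else 0 : ℝ) : ℂ) *
        ψ q := fun x y => by
    split_ifs
    · simp only [LinearMap.smul_apply, LinearMap.comp_apply, LinearMap.sub_apply, smul_apply,
        sub_apply, posOp_apply, map_sub, smul_eq_mul]
      push_cast
      ring
    · simp
  simp only [h4, posOp_apply, position_apply]
  push_cast at hpot ⊢
  simp only [add_mul, Finset.sum_mul, Finset.mul_sum, mul_assoc] at hpot ⊢
  rw [add_assoc]
  congr 1
  convert hpot using 1
  · congr 1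
    refine Finset.sum_congr rfl fun x _ => ?_
    ring
  · refine Finset.sum_congr rfl fun x _ => ?_
    ring

end Concrete

/-! ### Products of Weyl operators and their mode coefficients -/

section WeylProducts

variable {d L : ℕ} {A B : box d L → Config d L} {γ : box d L → ℝ}

/-- The Weyl operator `exp(i (∑ₓ uₓ qₓ + vₓ pₓ))`. -/
def weylOp (u v : Config d L) : HSpace d L →L[ℂ] HSpace d L :=
  expI (onSchwartz (phaseField u v)).closure 1

theorem weyl_eq (f : box d L → ℂ) :
    weyl f = weylOp (WithLp.toLp 2 fun x => (f x).re) (WithLp.toLp 2 fun x => (f x).im) := by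
  rw [weyl, weylOp, field, phaseField, position, momentum, Finset.sum_add_distrib]

theorem weylOp_mul (u v u' v' : Config d L) : weylOp u v * weylOp u' v' =
    Complex.exp (((inner ℝ u' v - inner ℝ u v') / 2 : ℝ) * Complex.I) •
      weylOp (u + u') (v + v') := by
  refine ContinuousLinearMap.ext_on (dense_span_incl d L) ?_
  rintro _ ⟨φ, rfl⟩
  rw [mul_apply_eq_comp, smul_apply, weylOp, weylOp, weylOp, (isUnitaryGroup_weyl u' v').2,
    (isUnitaryGroup_weyl u v).2, (isUnitaryGroup_weyl (u + u') (v + v')).2, weylSchwartz_mul,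
    map_smul]

theorem modeCoeff_add (u v u' v' : Config d L) (k : box d L) :
    modeCoeff A B γ (u + u') (v + v') k = modeCoeff A B γ u v k + modeCoeff A B γ u' v' k := by
  simp only [modeCoeff, inner_add_left, mul_add]
  push_cast
  ring

theorem IsNormalModes.inner_eq (hm : IsNormalModes A B γ) (u v : Config d L) :
    inner ℝ u v = ∑ k, inner ℝ u (A k) * inner ℝ v (B k) := by
  conv_lhs => rw [← hm.expand_right v]
  rw [inner_sum]
  exact Finset.sum_congr rfl fun k _ => by rw [inner_smul_right, mul_comm]

/-- The Weyl phase in terms of the mode coefficients. -/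
theorem sum_im_modeCoeff (hm : IsNormalModes A B γ) (u v u' v' : Config d L) :
    ∑ k, (starRingEnd ℂ (modeCoeff A B γ u v k) * modeCoeff A B γ u' v' k).im =
      -((inner ℝ u' v - inner ℝ u v') / 2) := by
  rw [hm.inner_eq u' v, hm.inner_eq u v', ← Finset.sum_sub_distrib, Finset.sum_div,
    ← Finset.sum_neg_distrib]
  refine Finset.sum_congr rfl fun k _ => ?_
  have h1 := sqrt_half_mul_inv (hm.pos k)
  simp only [modeCoeff, Complex.mul_im, map_add, map_mul, Complex.conj_ofReal, Complex.conj_I,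
    Complex.add_re, Complex.add_im, Complex.mul_re, Complex.ofReal_re, Complex.ofReal_im,
    Complex.neg_re, Complex.neg_im, Complex.I_re, Complex.I_im]
  linear_combination (inner ℝ u (A k) * inner ℝ v' (B k) - inner ℝ u' (A k) * inner ℝ v (B k)) * h1

/-- Lets the time-evolved coefficients be realized by a Weyl operator with real `u` and `v`, so that
the Weyl relation applies to it. -/
theorem IsNormalModes.exists_modeCoeff_eq (hm : IsNormalModes A B γ) (η : box d L → ℂ) :
    ∃ u v, modeCoeff A B γ u v = η := by
  refine ⟨∑ k, (√(2 * γ k) * (η k).re) • B k, ∑ k, ((√(γ k / 2))⁻¹ * (η k).im) • A k, ?_⟩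
  funext l
  have h1 : √(2 * γ l) ≠ 0 := (Real.sqrt_pos.2 (by linarith [hm.pos l])).ne'
  have h2 : √(γ l / 2) ≠ 0 := (Real.sqrt_pos.2 (by linarith [hm.pos l])).ne'
  have hd : ∀ k, inner ℝ (A k) (B l) = if k = l then 1 else 0 := fun k => by
    rw [real_inner_comm, hm.dual]
    simp only [eq_comm]
  simp only [modeCoeff, sum_inner, inner_smul_left, hm.dual, hd, conj_trivial, mul_ite, mul_one,
    mul_zero, Finset.sum_ite_eq', Finset.mem_univ, if_true]
  rw [← mul_assoc, ← mul_assoc, inv_mul_cancel₀ h1, mul_inv_cancel₀ h2, one_mul, one_mul,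
    Complex.re_add_im]

end WeylProducts

/-! ### Thermal correlations through the two-point function -/

section Thermal

variable {d : ℕ} {p : Params d} {L : ℕ} {β : ℝ}

/-- The mode coefficients of `f`. -/
def zetaCoeff (p : Params d) (L : ℕ) (f : box d L → ℂ) (k : box d L) : ℂ :=
  modeCoeff (modeA p L) (modeB p L) (freq p L) (WithLp.toLp 2 fun x => (f x).re)
    (WithLp.toLp 2 fun x => (f x).im) k

/-- The covariance of the mode coefficients `ζ` in the thermal state. -/
def thermalNormSq (p : Params d) (L : ℕ) (β : ℝ) (ζ : box d L → ℂ) : ℝ :=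
  ∑ k, ‖ζ k‖ ^ 2 * cothFactor β (freq p L k)

/-- The thermal two-point function of the fields with mode coefficients `ζ` and `ξ`. -/
def twoPoint (p : Params d) (L : ℕ) (β : ℝ) (ζ ξ : box d L → ℂ) : ℂ :=
  ∑ k, (((starRingEnd ℂ (ζ k) * ξ k).im : ℂ) * Complex.I +
    (cothFactor β (freq p L k) : ℂ) * ((starRingEnd ℂ (ζ k) * ξ k).re : ℂ))

/-- The mode coefficients evolved to time `t`. -/
def evolve (p : Params d) (L : ℕ) (t : ℝ) (ζ : box d L → ℂ) (k : box d L) : ℂ :=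
  Complex.exp ((t * (2 * freq p L k) : ℝ) * Complex.I) * ζ k

theorem isDiagonalIn_ham (hm : ∀ x : box d L, 0 < p.m x) (h : (h₀ p L).PosDef) :
    IsDiagonalIn (ham p L) (isLadderSystem (isNormalModes hm h)).basis (energy (freq p L)) := by
  set hl := isLadderSystem (isNormalModes hm h)
  refine isDiagonalIn_closure (v := hl.vec) (fun i => (hl.basis_apply i).symm) (fun i => ?_)
    (fun φ ψ => ?_)
  · rw [hamSchwartz_eq hm h, hl.sum_ca_vec]
  · simp only [hamSchwartz_eq hm h, map_sum, map_smul, map_add, sum_inner, inner_sum,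
      inner_smul_left, inner_smul_right, inner_add_left, inner_add_right, Complex.conj_ofReal]
    refine Finset.sum_congr rfl fun k _ => ?_
    rw [hl.adj, hl.adj', Complex.conj_ofNat]

theorem thermal_eq (hm : ∀ x : box d L, 0 < p.m x) (h : (h₀ p L).PosDef) (hβ : 0 < β)
    (X : HSpace d L →L[ℂ] HSpace d L) : thermal p L β X =
      weylSum (isLadderSystem (isNormalModes hm h)) β (freq p L) X /
        weylSum (isLadderSystem (isNormalModes hm h)) β (freq p L) 1 := by
  set hl := isLadderSystem (isNormalModes hm h)
  have hγ := (isNormalModes hm h).pos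
  have hX : ∀ X : HSpace d L →L[ℂ] HSpace d L, trace (X * expNeg (ham p L) β) =
      weylSum hl β (freq p L) X := fun X => by
    refine (trace_eq hl.basis (hasTrace_mul hl.basis (gibbs_nonneg β (freq p L))
      (summable_exp_energy hγ hβ) (fun i =>
        (isDiagonalIn_ham hm h).expNeg_apply (energy_nonneg hγ) hβ.le i) X)).trans ?_
    rw [weylSum]
    simp only [hl.basis_apply]
  rw [thermal, hX, ← hX 1, one_mul]

theorem thermal_weylOp (hm : ∀ x : box d L, 0 < p.m x) (h : (h₀ p L).PosDef) (hβ : 0 < β)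
    (u v : Config d L) : thermal p L β (weylOp u v) = Complex.exp (-((thermalNormSq p L β
      (modeCoeff (modeA p L) (modeB p L) (freq p L) u v) : ℝ) / 2)) := by
  have hN := isNormalModes hm h
  rw [thermal_eq hm h hβ, weylOp, weylSum_eq _ hβ hN.pos (isWeylGroup hN u v),
    mul_div_cancel_left₀ _ (weylSum_one_ne_zero _ hβ hN.pos), thermalNormSq]

theorem thermal_smul (c : ℂ) (hm : ∀ x : box d L, 0 < p.m x) (h : (h₀ p L).PosDef) (hβ : 0 < β)
    (X : HSpace d L →L[ℂ] HSpace d L) : thermal p L β (c • X) = c * thermal p L β X := by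
  rw [thermal_eq hm h hβ, thermal_eq hm h hβ, ← mul_div_assoc]
  congr 1
  rw [weylSum, weylSum, ← tsum_mul_left]
  refine tsum_congr fun α => ?_
  rw [smul_apply, inner_smul_right]
  ring

theorem heisenberg_weylOp (hm : ∀ x : box d L, 0 < p.m x) (h : (h₀ p L).PosDef)
    {u v u' v' : Config d L} {t : ℝ}
    (hu : modeCoeff (modeA p L) (modeB p L) (freq p L) u' v' =
      evolve p L t (modeCoeff (modeA p L) (modeB p L) (freq p L) u v)) :
    heisenberg p L t (weylOp u v) = weylOp u' v' := by
  have hN := isNormalModes hm h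
  have hW := isWeylGroup hN u' v'
  rw [hu] at hW
  exact evolution_weyl (isLadderSystem hN) (isDiagonalIn_ham hm h) t (isWeylGroup hN u v) hW 1

theorem norm_add_sq_eq (z w : ℂ) :
    ‖z + w‖ ^ 2 = ‖z‖ ^ 2 + ‖w‖ ^ 2 + 2 * (starRingEnd ℂ z * w).re := by
  simp only [← Complex.normSq_eq_norm_sq, Complex.normSq_apply, Complex.add_re, Complex.add_im,
    Complex.mul_re, Complex.conj_re, Complex.conj_im]
  ring

theorem norm_evolve (t : ℝ) (ζ : box d L → ℂ) (k : box d L) : ‖evolve p L t ζ k‖ = ‖ζ k‖ := by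
  rw [evolve, norm_mul, Complex.norm_exp_ofReal_mul_I, one_mul]

theorem thermalNormSq_evolve (t : ℝ) (ζ : box d L → ℂ) :
    thermalNormSq p L β (evolve p L t ζ) = thermalNormSq p L β ζ := by
  simp only [thermalNormSq, norm_evolve]

theorem thermalNormSq_add (ζ ξ : box d L → ℂ) :
    thermalNormSq p L β (fun k => ζ k + ξ k) = thermalNormSq p L β ζ + thermalNormSq p L β ξ +
      2 * (twoPoint p L β ζ ξ).re := by
  simp only [thermalNormSq, twoPoint, norm_add_sq_eq, Complex.re_sum, Complex.add_re,
    Complex.mul_re, Complex.ofReal_re, Complex.ofReal_im, Complex.I_re, Complex.I_im]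
  rw [← Finset.sum_add_distrib, Finset.mul_sum, ← Finset.sum_add_distrib]
  exact Finset.sum_congr rfl fun k _ => by ring

theorem twoPoint_im (ζ ξ : box d L → ℂ) :
    (twoPoint p L β ζ ξ).im = ∑ k, (starRingEnd ℂ (ζ k) * ξ k).im := by
  simp only [twoPoint, Complex.im_sum]
  refine Finset.sum_congr rfl fun k _ => ?_
  rw [← Complex.ofReal_mul]
  simp

/-- The thermal correlation of Weyl operators in terms of the two-point function. -/
theorem thermalCorr_eq (hm : ∀ x : box d L, 0 < p.m x) (h : (h₀ p L).PosDef) (hβ : 0 < β)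
    (f g : box d L → ℂ) (t : ℝ) : thermalCorr p L β f g t =
      Complex.exp (-((thermalNormSq p L β (zetaCoeff p L f) +
        thermalNormSq p L β (zetaCoeff p L g) : ℝ) / 2)) *
      (Complex.exp (-(twoPoint p L β (evolve p L t (zetaCoeff p L f)) (zetaCoeff p L g))) - 1) := by
  have hN := isNormalModes hm h
  obtain ⟨u, v, huv⟩ := hN.exists_modeCoeff_eq (evolve p L t (zetaCoeff p L f))
  have hg : modeCoeff (modeA p L) (modeB p L) (freq p L) (WithLp.toLp 2 fun x => (g x).re)
    (WithLp.toLp 2 fun x => (g x).im) = zetaCoeff p L g := rfl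
  have hf : modeCoeff (modeA p L) (modeB p L) (freq p L) (WithLp.toLp 2 fun x => (f x).re)
    (WithLp.toLp 2 fun x => (f x).im) = zetaCoeff p L f := rfl
  have him := sum_im_modeCoeff hN u v (WithLp.toLp 2 fun x => (g x).re)
    (WithLp.toLp 2 fun x => (g x).im)
  rw [huv, hg, ← twoPoint_im (β := β)] at him
  rw [thermalCorr, weyl_eq, weyl_eq, heisenberg_weylOp hm h huv, weylOp_mul,
    thermal_smul _ hm h hβ, thermal_weylOp hm h hβ, thermal_weylOp hm h hβ, thermal_weylOp hm h hβ,
    hf, hg]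
  have hadd : modeCoeff (modeA p L) (modeB p L) (freq p L) (u + WithLp.toLp 2 fun x => (g x).re)
      (v + WithLp.toLp 2 fun x => (g x).im) = fun k => evolve p L t (zetaCoeff p L f) k +
        zetaCoeff p L g k := by
    funext k
    rw [modeCoeff_add, huv, hg]
  -- The cross term of the covariance supplies the real part of the two-point function and the Weyl
  -- phase supplies its imaginary part, so together they form `exp(-z)`.
  rw [hadd, thermalNormSq_add, thermalNormSq_evolve, mul_sub, mul_one, ← Complex.exp_add,
    ← Complex.exp_add, ← Complex.exp_add]
  congr 2
  · rw [eq_neg_iff_add_eq_zero, add_comm, ← eq_neg_iff_add_eq_zero] at him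
    rw [him]
    conv_rhs => rw [← Complex.re_add_im (twoPoint p L β _ _)]
    push_cast
    ring
  · push_cast
    ring

end Thermal

/-! ### The spectral functions in the two-point function and their size -/

section Kernels

/-- The real-linear form `w ↦ i Im w + c Re w`. -/
def thermalForm (c : ℝ) (w : ℂ) : ℂ := (w.im : ℂ) * Complex.I + (c : ℂ) * (w.re : ℂ)

theorem thermalForm_add (c : ℝ) (w w' : ℂ) :
    thermalForm c (w + w') = thermalForm c w + thermalForm c w' := by
  simp only [thermalForm, Complex.add_re, Complex.add_im]
  push_cast
  ring

theorem thermalForm_real_mul (c a : ℝ) (w : ℂ) :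
    thermalForm c (a * w) = a * thermalForm c w := by
  simp only [thermalForm, Complex.re_ofReal_mul, Complex.im_ofReal_mul]
  push_cast
  ring

theorem norm_thermalForm_le {c : ℝ} (hc : 1 ≤ c) (w : ℂ) : ‖thermalForm c w‖ ≤ c * ‖w‖ := by
  refine abs_le_of_sq_le_sq' ?_ (by positivity) |>.2
  have h1 : ‖thermalForm c w‖ ^ 2 = w.im ^ 2 + c ^ 2 * w.re ^ 2 := by
    rw [← Complex.normSq_eq_norm_sq, Complex.normSq_apply]
    simp [thermalForm]
    ring
  have h2 : ‖w‖ ^ 2 = w.re ^ 2 + w.im ^ 2 := by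
    rw [← Complex.normSq_eq_norm_sq, Complex.normSq_apply]
    ring
  rw [h1, mul_pow, h2]
  nlinarith [mul_nonneg (show 0 ≤ c ^ 2 - 1 by nlinarith) (sq_nonneg w.im)]

theorem one_le_cothFactor {β γ : ℝ} (hβ : 0 < β) (hγ : 0 < γ) : 1 ≤ cothFactor β γ := by
  have h1 := exp_neg_two_mul_lt_one hβ hγ
  rw [cothFactor, le_div_iff₀ (by linarith)]
  linarith [Real.exp_pos (-(2 * β * γ))]

/-- The factor `coth(βγ)` blows up like `1 / (βγ)` at zero frequency, and one factor `γ` tames it.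
With `x = exp(-2βγ)` the bound reduces to `(1 + 2βγ) x ≤ 1`, that is to `1 + y ≤ exp y`. -/
theorem cothFactor_mul_le {β γ : ℝ} (hβ : 0 < β) (hγ : 0 < γ) :
    γ * cothFactor β γ ≤ γ + 1 / β := by
  have h1 := exp_neg_two_mul_lt_one hβ hγ
  have h2 := Real.add_one_le_exp (2 * β * γ)
  have h3 : Real.exp (2 * β * γ) * Real.exp (-(2 * β * γ)) = 1 := by
    rw [← Real.exp_add]
    simp
  set x := Real.exp (-(2 * β * γ)) with hx
  have hx0 : 0 < x := Real.exp_pos _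
  have h4 : (2 * β * γ + 1) * x ≤ 1 := (mul_le_mul_of_nonneg_right h2 hx0.le).trans h3.le
  rw [cothFactor, ← hx, ← mul_div_assoc, div_le_iff₀ (by linarith)]
  have h5 : γ * (1 + x) * β ≤ (γ + 1 / β) * (1 - x) * β := by
    have : (γ + 1 / β) * (1 - x) * β = (γ * β + 1) * (1 - x) := by
      field_simp
    rw [this]
    nlinarith
  exact le_of_mul_le_mul_right h5 hβ

/-- The oscillating factor `exp(-2 i t √s)`. -/
def oscillation (t s : ℝ) : ℂ := Complex.exp ((-(t * (2 * √s)) : ℝ) * Complex.I)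

theorem norm_oscillation (t s : ℝ) : ‖oscillation t s‖ = 1 := Complex.norm_exp_ofReal_mul_I _

/-- The functions of `h_L` that occur in the thermal two-point function. -/
def kernel (β t : ℝ) (i : Fin 3) (s : ℝ) : ℂ :=
  ![((2 * √s)⁻¹ : ℝ) * thermalForm (cothFactor β (√s)) (oscillation t s),
    ((√s / 2 : ℝ) : ℂ) * thermalForm (cothFactor β (√s)) (oscillation t s),
    ((1 / 2 : ℝ) : ℂ) * thermalForm (cothFactor β (√s)) (Complex.I * oscillation t s)] i

theorem continuousOn_kernel {β : ℝ} (hβ : 0 < β) (t : ℝ) (i : Fin 3) :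
    ContinuousOn (kernel β t i) (Set.Ioi 0) := by
  have hc : ContinuousOn (fun s => cothFactor β (√s)) (Set.Ioi 0) := by
    refine ContinuousOn.div (by fun_prop) (by fun_prop) fun s hs => ?_
    have := exp_neg_two_mul_lt_one hβ (Real.sqrt_pos.2 hs)
    exact ne_of_gt (by linarith)
  have hc' : ContinuousOn (fun s => ((cothFactor β (√s) : ℝ) : ℂ)) (Set.Ioi 0) :=
    Complex.continuous_ofReal.comp_continuousOn hc
  have ho : Continuous (oscillation t) := by
    unfold oscillation
    fun_prop
  have hf : ∀ w : ℝ → ℂ, Continuous w →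
      ContinuousOn (fun s => thermalForm (cothFactor β (√s)) (w s)) (Set.Ioi 0) := fun w hw =>
    ContinuousOn.add (by fun_prop) (hc'.mul (by fun_prop))
  have hi : ContinuousOn (fun s : ℝ => (((2 * √s)⁻¹ : ℝ) : ℂ)) (Set.Ioi 0) := by
    refine Complex.continuous_ofReal.comp_continuousOn (ContinuousOn.inv₀ (by fun_prop) ?_)
    intro s hs
    have := Real.sqrt_pos.2 hs
    positivity
  unfold kernel
  fin_cases i
  · exact hi.mul (hf _ ho)
  · exact ContinuousOn.mul (by fun_prop) (hf _ ho)
  · exact continuousOn_const.mul (hf _ (continuous_const.mul ho))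

/-- With `s = γ²`, multiplication by `s` leaves `a · γ coth(βγ)` where `a` is `1/2`, `γ²/2` or
`γ/2`. The first kernel behaves like `γ⁻¹ coth(βγ) ~ 1 / (β s)` near zero, which is why the weight
`h_L⁻¹` appears in the correlator. -/
theorem mul_norm_kernel_le {β : ℝ} (hβ : 0 < β) (t : ℝ) (i : Fin 3) {s Γ : ℝ} (hs : 0 < s)
    (hΓ : 1 ≤ Γ) (hsΓ : s ≤ Γ ^ 2) : s * ‖kernel β t i s‖ ≤ Γ ^ 2 * (Γ + 1 / β) := by
  set γ := √s with hγ
  have hγ0 : 0 < γ := Real.sqrt_pos.2 hs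
  have hs2 : s = γ ^ 2 := (Real.sq_sqrt hs.le).symm
  have hγΓ : γ ≤ Γ := Real.sqrt_le_iff.2 ⟨by linarith, hsΓ⟩
  have h1 : γ * cothFactor β γ ≤ Γ + 1 / β := (cothFactor_mul_le hβ hγ0).trans (by linarith)
  have hc1 := one_le_cothFactor hβ hγ0
  have hf : ∀ w : ℂ, ‖w‖ = 1 → ‖thermalForm (cothFactor β γ) w‖ ≤ cothFactor β γ := fun w hw => by
    simpa [hw] using norm_thermalForm_le hc1 w
  have ho := hf _ (norm_oscillation t s)
  have ho' := hf (Complex.I * oscillation t s) (by simp [norm_oscillation])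
  have hb : (0 : ℝ) ≤ Γ + 1 / β := by positivity
  have hΓ2 : 1 ≤ Γ ^ 2 := by nlinarith
  have key : ∀ (a b : ℝ), 0 ≤ a → a ≤ Γ ^ 2 → b ≤ cothFactor β γ → a * γ * b ≤
      Γ ^ 2 * (Γ + 1 / β) := fun a b ha haΓ hbc => by
    calc a * γ * b ≤ a * γ * cothFactor β γ := by gcongr
      _ = a * (γ * cothFactor β γ) := by ring
      _ ≤ a * (Γ + 1 / β) := by gcongr
      _ ≤ _ := by gcongr
  have hγ2 : γ ^ 2 ≤ Γ ^ 2 := by gcongr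
  fin_cases i
  · change s * ‖(((2 * γ)⁻¹ : ℝ) : ℂ) * thermalForm (cothFactor β γ) (oscillation t s)‖ ≤ _
    rw [norm_mul, Complex.norm_real, Real.norm_of_nonneg (by positivity), hs2]
    refine le_trans (le_of_eq ?_) (key (1 / 2) _ (by norm_num) (by linarith) ho)
    rw [← hs2]
    field_simp
    rw [hs2]
  · change s * ‖((γ / 2 : ℝ) : ℂ) * thermalForm (cothFactor β γ) (oscillation t s)‖ ≤ _
    rw [norm_mul, Complex.norm_real, Real.norm_of_nonneg (by positivity)]
    refine le_trans (le_of_eq ?_) (key (γ ^ 2 / 2) _ (by positivity) (by nlinarith) ho)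
    rw [hs2]
    ring
  · change s * ‖((1 / 2 : ℝ) : ℂ) * thermalForm (cothFactor β γ) (Complex.I * oscillation t s)‖ ≤ _
    rw [norm_mul, Complex.norm_real, Real.norm_of_nonneg (by positivity)]
    refine le_trans (le_of_eq ?_) (key (γ / 2) _ (by positivity) (by nlinarith) ho')
    rw [hs2]
    ring

end Kernels

/-! ### The two-point function as matrix elements of functions of the one-particle operator -/

section TwoPoint

variable {d : ℕ} {p : Params d} {L : ℕ} {β : ℝ}

/-- The coefficients of the two-point function. -/
def coupling (p : Params d) (L : ℕ) (f g : box d L → ℂ) (i : Fin 3) (x y : box d L) : ℝ :=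
  ![√(1 / (2 * p.m x)) * (f x).re * (√(1 / (2 * p.m y)) * (g y).re),
    √(2 * p.m x) * (f x).im * (√(2 * p.m y) * (g y).im),
    √(1 / (2 * p.m x)) * (f x).re * (√(2 * p.m y) * (g y).im) -
      √(2 * p.m x) * (f x).im * (√(1 / (2 * p.m y)) * (g y).re)] i

theorem zetaCoeff_eq (f : box d L → ℂ) (k : box d L) : zetaCoeff p L f k =
    (((√(2 * freq p L k))⁻¹ * ∑ x : box d L, √(1 / (2 * p.m x)) * (f x).re *
        eigenMatrix (hOne_isHermitian p L) x k : ℝ) : ℂ) +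
      ((√(freq p L k / 2) * ∑ x : box d L, √(2 * p.m x) * (f x).im *
        eigenMatrix (hOne_isHermitian p L) x k : ℝ) : ℂ) * Complex.I := by
  rw [zetaCoeff, modeCoeff, PiLp.inner_apply, PiLp.inner_apply]
  simp only [modeA, modeB, RCLike.inner_apply, conj_trivial]
  congr 4
  · funext x
    ring
  · exact Finset.sum_congr rfl fun x _ => by ring

/-- `thermalForm` is only real-linear, so the oscillation and the factor `i` of the mixed
position-momentum terms must stay inside it. Two terms with `conj e` and one with `i conj e` result,
hence three kernels. -/
theorem thermalForm_modes (c X Y X' Y' : ℝ) {γ : ℝ} (hγ : 0 < γ) (e : ℂ) :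
    thermalForm c (starRingEnd ℂ (e * (((√(2 * γ))⁻¹ * X : ℝ) +
        ((√(γ / 2) * Y : ℝ) : ℂ) * Complex.I)) *
      (((√(2 * γ))⁻¹ * X' : ℝ) + ((√(γ / 2) * Y' : ℝ) : ℂ) * Complex.I)) =
    (X * X' : ℝ) * (((2 * γ)⁻¹ : ℝ) * thermalForm c (starRingEnd ℂ e)) +
      (Y * Y' : ℝ) * ((γ / 2 : ℝ) * thermalForm c (starRingEnd ℂ e)) +
      (X * Y' - Y * X' : ℝ) * ((1 / 2 : ℝ) * thermalForm c (Complex.I * starRingEnd ℂ e)) := by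
  have h1 : (√(γ / 2) : ℝ) * √(γ / 2) = γ / 2 := Real.mul_self_sqrt (by positivity)
  have h2 : (√(2 * γ))⁻¹ * (√(2 * γ))⁻¹ = (2 * γ)⁻¹ := by
    rw [← mul_inv, Real.mul_self_sqrt (by positivity)]
  have h3 := sqrt_half_mul_inv hγ
  have hw : starRingEnd ℂ (e * (((√(2 * γ))⁻¹ * X : ℝ) +
        ((√(γ / 2) * Y : ℝ) : ℂ) * Complex.I)) *
      (((√(2 * γ))⁻¹ * X' : ℝ) + ((√(γ / 2) * Y' : ℝ) : ℂ) * Complex.I) =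
      ((X * X' * (2 * γ)⁻¹ : ℝ) : ℂ) * starRingEnd ℂ e +
      ((Y * Y' * (γ / 2) : ℝ) : ℂ) * starRingEnd ℂ e +
      (((X * Y' - Y * X') * (1 / 2) : ℝ) : ℂ) * (Complex.I * starRingEnd ℂ e) := by
    have h1' : (√(γ / 2) : ℂ) * √(γ / 2) = (γ / 2 : ℝ) := by rw [← Complex.ofReal_mul, h1]
    have h2' : ((√(2 * γ))⁻¹ : ℂ) * (√(2 * γ))⁻¹ = ((2 * γ)⁻¹ : ℝ) := by
      rw [← h2]
      push_cast
      rfl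
    have h3' : (√(γ / 2) : ℂ) * (√(2 * γ))⁻¹ = (1 / 2 : ℝ) := by
      rw [← h3]
      push_cast
      rfl
    rw [map_mul, map_add, map_mul, Complex.conj_ofReal, Complex.conj_ofReal, Complex.conj_I]
    push_cast at h1' h2' h3' ⊢
    linear_combination (-(starRingEnd ℂ e * √(γ / 2) * √(γ / 2) * Y * Y') : ℂ) * Complex.I_mul_I +
      (starRingEnd ℂ e * Y * Y' : ℂ) * h1' + (starRingEnd ℂ e * X * X' : ℂ) * h2' +
      (starRingEnd ℂ e * Complex.I * (X * Y' - Y * X') : ℂ) * h3'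
  rw [hw, thermalForm_add, thermalForm_add, thermalForm_real_mul, thermalForm_real_mul,
    thermalForm_real_mul]
  push_cast
  ring

theorem twoPoint_eq (hm : ∀ x : box d L, 0 < p.m x) (h : (h₀ p L).PosDef)
    (f g : box d L → ℂ) (t : ℝ) :
    twoPoint p L β (evolve p L t (zetaCoeff p L f)) (zetaCoeff p L g) =
      ∑ i, ∑ x, ∑ y, (coupling p L f g i x y : ℂ) *
        funElem (hOne_isHermitian p L) (kernel β t i) x y := by
  have hrhs : ∑ i, ∑ x, ∑ y, (coupling p L f g i x y : ℂ) *
        funElem (hOne_isHermitian p L) (kernel β t i) x y =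
      ∑ k, ∑ i, ((∑ x, ∑ y, coupling p L f g i x y *
        (eigenMatrix (hOne_isHermitian p L) x k * eigenMatrix (hOne_isHermitian p L) y k) : ℝ) : ℂ) *
          kernel β t i ((hOne_isHermitian p L).eigenvalues k) := by
    conv_rhs => rw [Finset.sum_comm]
    refine Finset.sum_congr rfl fun i _ => ?_
    push_cast
    simp only [Finset.sum_mul]
    conv_rhs => rw [Finset.sum_comm]
    refine Finset.sum_congr rfl fun x _ => ?_
    conv_rhs => rw [Finset.sum_comm]
    refine Finset.sum_congr rfl fun y _ => ?_
    rw [funElem, Finset.mul_sum]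
    refine Finset.sum_congr rfl fun k _ => ?_
    simp only [eigenMatrix]
    ring
  rw [hrhs, twoPoint]
  refine Finset.sum_congr rfl fun k _ => ?_
  have hγ := (isNormalModes hm h).pos k
  have hconj : starRingEnd ℂ (Complex.exp ((t * (2 * freq p L k) : ℝ) * Complex.I)) =
      oscillation t ((hOne_isHermitian p L).eigenvalues k) := by
    rw [← Complex.exp_conj, map_mul, Complex.conj_ofReal, Complex.conj_I, oscillation, freq]
    push_cast
    congr 1
    ring
  have key := thermalForm_modes (cothFactor β (freq p L k))
    (∑ x : box d L, √(1 / (2 * p.m x)) * (f x).re * eigenMatrix (hOne_isHermitian p L) x k)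
    (∑ x : box d L, √(2 * p.m x) * (f x).im * eigenMatrix (hOne_isHermitian p L) x k)
    (∑ x : box d L, √(1 / (2 * p.m x)) * (g x).re * eigenMatrix (hOne_isHermitian p L) x k)
    (∑ x : box d L, √(2 * p.m x) * (g x).im * eigenMatrix (hOne_isHermitian p L) x k)
    hγ (Complex.exp ((t * (2 * freq p L k) : ℝ) * Complex.I))
  rw [← zetaCoeff_eq, ← zetaCoeff_eq, hconj] at key
  refine key.trans ?_
  rw [Fin.sum_univ_three]
  congr 1
  · congr 1
    · congr 2
      rw [Finset.sum_mul_sum]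
      refine Finset.sum_congr rfl fun x _ => Finset.sum_congr rfl fun y _ => ?_
      simp only [coupling, Matrix.cons_val_zero]
      ring
    · congr 2
      rw [Finset.sum_mul_sum]
      refine Finset.sum_congr rfl fun x _ => Finset.sum_congr rfl fun y _ => ?_
      simp only [coupling, Matrix.cons_val_one, Matrix.cons_val_zero]
      ring
  · congr 2
    rw [Finset.sum_mul_sum, Finset.sum_mul_sum, ← Finset.sum_sub_distrib]
    refine Finset.sum_congr rfl fun x _ => ?_
    rw [← Finset.sum_sub_distrib]
    refine Finset.sum_congr rfl fun y _ => ?_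
    simp only [coupling, Matrix.cons_val]
    ring

/-- Needed for measurability: it reduces the covariance to the two-point function, which is
expressed through matrix elements of functions of `h_L`. -/
theorem thermalNormSq_eq (ζ : box d L → ℂ) :
    (thermalNormSq p L β ζ : ℂ) = twoPoint p L β (evolve p L 0 ζ) ζ := by
  have h0 : evolve p L 0 ζ = ζ := by
    funext k
    simp [evolve]
  rw [h0, thermalNormSq, twoPoint]
  push_cast
  refine Finset.sum_congr rfl fun k _ => ?_
  have hk : starRingEnd ℂ (ζ k) * ζ k = ((‖ζ k‖ ^ 2 : ℝ) : ℂ) := by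
    rw [mul_comm, Complex.mul_conj, Complex.normSq_eq_norm_sq]
  rw [hk, Complex.ofReal_re, Complex.ofReal_im]
  push_cast
  ring

theorem continuous_twoPoint (ζ ξ : box d L → ℂ) :
    Continuous fun t => twoPoint p L β (evolve p L t ζ) ξ := by
  unfold twoPoint evolve
  fun_prop

theorem thermalNormSq_nonneg (hm : ∀ x : box d L, 0 < p.m x) (h : (h₀ p L).PosDef) (hβ : 0 < β)
    (ζ : box d L → ℂ) : 0 ≤ thermalNormSq p L β ζ :=
  Finset.sum_nonneg fun k _ => mul_nonneg (by positivity)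
    (zero_le_one.trans (one_le_cothFactor hβ ((isNormalModes hm h).pos k)))

/-- The mean value inequality on the convex half-plane `Re ≤ b`, which contains both `0` and `w`. -/
theorem norm_exp_sub_one_le_of_re_le {w : ℂ} {b : ℝ} (hb : 0 ≤ b) (hw : w.re ≤ b) :
    ‖Complex.exp w - 1‖ ≤ Real.exp b * ‖w‖ := by
  have h := (convex_halfSpace_re_le b).norm_image_sub_le_of_norm_hasDerivWithin_le
    (f := Complex.exp) (f' := Complex.exp) (C := Real.exp b) (x := 0) (y := w)
    (fun z _ => (Complex.hasDerivAt_exp z).hasDerivWithinAt)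
    (fun z hz => by
      rw [Complex.norm_exp]
      exact Real.exp_le_exp.2 hz) (by simpa using hb) hw
  simpa using h

/-- Nonnegativity of the covariance of the evolved `f` plus `g` gives `-Re z ≤ a / 2`, where `a` is
the sum of the two covariances. Hence `|exp(-z) - 1|` is at most both `2 exp(a / 2)` and `exp(a / 2)
|z|`, and the prefactor `exp(-a / 2)` removes the exponential whatever the size of `f` and `g`. -/
theorem norm_thermalCorr_le (hm : ∀ x : box d L, 0 < p.m x) (h : (h₀ p L).PosDef) (hβ : 0 < β)
    (f g : box d L → ℂ) (t : ℝ) :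
    ‖thermalCorr p L β f g t‖ ≤ 2 ∧ ‖thermalCorr p L β f g t‖ ≤
      ‖twoPoint p L β (evolve p L t (zetaCoeff p L f)) (zetaCoeff p L g)‖ := by
  rw [thermalCorr_eq hm h hβ]
  set a := thermalNormSq p L β (zetaCoeff p L f) + thermalNormSq p L β (zetaCoeff p L g) with ha
  set z := twoPoint p L β (evolve p L t (zetaCoeff p L f)) (zetaCoeff p L g)
  have ha0 : 0 ≤ a := add_nonneg (thermalNormSq_nonneg hm h hβ _) (thermalNormSq_nonneg hm h hβ _)
  have hz : 0 ≤ a + 2 * z.re := by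
    have := thermalNormSq_nonneg hm h hβ (fun k => evolve p L t (zetaCoeff p L f) k +
      zetaCoeff p L g k)
    rwa [thermalNormSq_add, thermalNormSq_evolve] at this
  have hE : ‖Complex.exp (-((a : ℝ) / 2 : ℂ))‖ = Real.exp (-(a / 2)) := by
    rw [Complex.norm_exp]
    congr 1
    rw [← Complex.ofReal_ofNat, ← Complex.ofReal_div, ← Complex.ofReal_neg, Complex.ofReal_re]
  rw [norm_mul, hE]
  constructor
  · have h1 : ‖Complex.exp (-z) - 1‖ ≤ Real.exp (a / 2) + Real.exp (a / 2) := by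
      refine (norm_sub_le _ _).trans (add_le_add ?_ ?_)
      · rw [Complex.norm_exp]
        exact Real.exp_le_exp.2 (by rw [Complex.neg_re]; linarith)
      · rw [norm_one]
        exact Real.one_le_exp (by linarith)
    calc _ ≤ Real.exp (-(a / 2)) * (Real.exp (a / 2) + Real.exp (a / 2)) := by gcongr
      _ = 2 := by
        rw [mul_add, ← Real.exp_add]
        norm_num
  · have h1 := norm_exp_sub_one_le_of_re_le (w := -z) (b := a / 2) (by linarith)
      (by rw [Complex.neg_re]; linarith)
    calc _ ≤ Real.exp (-(a / 2)) * (Real.exp (a / 2) * ‖-z‖) := by gcongr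
      _ = _ := by
        rw [← mul_assoc, ← Real.exp_add, norm_neg]
        simp

end TwoPoint

/-! ### Matrix elements of functions of a symmetric matrix -/

section FunElem

variable {n : Type} [Fintype n] [DecidableEq n] {M : Matrix n n ℝ}

theorem funElem_eq (hM : M.IsHermitian) (F : ℝ → ℂ) (x y : n) : funElem hM F x y =
    ∑ k, (eigenMatrix hM x k : ℂ) * F (hM.eigenvalues k) * (eigenMatrix hM y k : ℂ) := rfl

theorem sum_eigenMatrix_mul (hM : M.IsHermitian) (k y : n) :
    ∑ z, eigenMatrix hM z k * M z y = hM.eigenvalues k * eigenMatrix hM y k := by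
  have h1 : ∀ z, eigenMatrix hM z k * M z y = ∑ l, (hM.eigenvalues l * eigenMatrix hM y l) *
      (eigenMatrix hM z k * eigenMatrix hM z l) := fun z => by
    rw [← sum_eigenvalues_mul hM z y, Finset.mul_sum]
    exact Finset.sum_congr rfl fun l _ => by ring
  simp only [h1]
  rw [Finset.sum_comm]
  simp only [← Finset.mul_sum, sum_eigenMatrix_col, mul_ite, mul_one, mul_zero,
    Finset.sum_ite_eq, Finset.mem_univ, if_true]

theorem sum_eigenvalues_pow (hM : M.IsHermitian) (j : ℕ) (x y : n) :
    ∑ k, eigenMatrix hM x k * hM.eigenvalues k ^ j * eigenMatrix hM y k = (M ^ j) x y := by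
  induction j generalizing y with
  | zero =>
    simp only [pow_zero, mul_one, Matrix.one_apply]
    exact sum_eigenMatrix_row hM x y
  | succ j ih =>
    rw [pow_succ, Matrix.mul_apply]
    simp only [← ih, Finset.sum_mul]
    rw [Finset.sum_comm]
    refine Finset.sum_congr rfl fun k _ => ?_
    simp only [mul_assoc]
    rw [← Finset.mul_sum, ← Finset.mul_sum, sum_eigenMatrix_mul]
    ring

/-- For polynomials the dependence on the choice of eigenvectors disappears and only entries of
powers of `M` remain. This is the entry point for measurability. -/
theorem funElem_polynomial (hM : M.IsHermitian) (Q : Polynomial ℝ) (x y : n) :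
    funElem hM (fun s => ((Q.eval s : ℝ) : ℂ)) x y =
      ((∑ j ∈ Finset.range (Q.natDegree + 1), Q.coeff j * (M ^ j) x y : ℝ) : ℂ) := by
  rw [funElem_eq]
  simp only [← Complex.ofReal_mul, ← Complex.ofReal_sum]
  congr 1
  simp only [← sum_eigenvalues_pow hM, Finset.mul_sum]
  rw [Finset.sum_comm]
  refine Finset.sum_congr rfl fun k _ => ?_
  rw [Polynomial.eval_eq_sum_range, Finset.mul_sum, Finset.sum_mul]
  exact Finset.sum_congr rfl fun j _ => by ring

theorem tendsto_funElem {α : Type*} {l : Filter α} (hM : M.IsHermitian) {G : α → ℝ → ℂ}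
    {F : ℝ → ℂ} (h : ∀ k, Tendsto (fun j => G j (hM.eigenvalues k)) l (𝓝 (F (hM.eigenvalues k))))
    (x y : n) : Tendsto (fun j => funElem hM (G j) x y) l (𝓝 (funElem hM F x y)) := by
  simp only [funElem_eq]
  exact tendsto_finsetSum _ fun k _ => ((h k).const_mul _).mul_const _

/-- Evaluate the eigenvalue equation at a component of largest modulus of the eigenvector. -/
theorem eigenvalues_le (hM : M.IsHermitian) {R : ℝ} (hR : ∀ x, ∑ y, |M x y| ≤ R) (k : n) :
    hM.eigenvalues k ≤ R := by
  obtain ⟨y, -, hy⟩ := Finset.exists_max_image Finset.univ (fun y => |eigenMatrix hM y k|)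
    ⟨k, Finset.mem_univ k⟩
  have hpos : 0 < |eigenMatrix hM y k| := by
    by_contra hcon
    have h0 : ∀ x, eigenMatrix hM x k = 0 := fun x => by
      have := hy x (Finset.mem_univ x)
      exact abs_nonpos_iff.1 (this.trans (not_lt.1 hcon))
    have := sum_eigenMatrix_col hM k k
    simp [h0] at this
  have h1 := sum_eigenMatrix_mul hM k y
  have h2 : hM.eigenvalues k * |eigenMatrix hM y k| ≤ R * |eigenMatrix hM y k| := by
    calc hM.eigenvalues k * |eigenMatrix hM y k| ≤ |hM.eigenvalues k| * |eigenMatrix hM y k| := by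
          gcongr
          exact le_abs_self _
      _ = |∑ z, eigenMatrix hM z k * M z y| := by rw [h1, abs_mul]
      _ ≤ ∑ z, |eigenMatrix hM z k * M z y| := Finset.abs_sum_le_sum_abs _ _
      _ ≤ ∑ z, |M y z| * |eigenMatrix hM y k| := by
          refine Finset.sum_le_sum fun z _ => ?_
          have hz : M z y = M y z := by simpa using hM.apply y z
          rw [abs_mul, mul_comm, hz]
          exact mul_le_mul_of_nonneg_left (hy z (Finset.mem_univ z)) (abs_nonneg _)
      _ ≤ R * |eigenMatrix hM y k| := by
          rw [← Finset.sum_mul]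
          gcongr
          exact hR y
  exact le_of_mul_le_mul_right h2 hpos

/-- A matrix element of `F(M)` is bounded by an eigenfunction correlator when `s F(s)` is bounded
on the spectrum. -/
theorem enorm_funElem_rpow_le (hM : M.IsHermitian) {F : ℝ → ℂ} {K r : ℝ} (hK : 0 < K)
    (hr : 0 ≤ r) (hpos : ∀ k, 0 < hM.eigenvalues k)
    (hF : ∀ k, hM.eigenvalues k * ‖F (hM.eigenvalues k)‖ ≤ K) (x y : n) :
    ‖funElem hM F x y‖ₑ ^ r ≤ ENNReal.ofReal (K ^ r) * ⨆ (u : ℝ → ℂ) (_ : ∀ s, ‖u s‖ ≤ 1),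
      ‖funElem hM (fun s => ((s ^ (-1 : ℝ) : ℝ) : ℂ) * u s) x y‖ₑ ^ r := by
  classical
  -- `u(s) = s F(s) / K` on the spectrum, where it is bounded by `1`; it is cut off elsewhere
  -- because the correlator requires the bound on all of `ℝ`.
  let u : ℝ → ℂ := fun s => if 0 < s ∧ s * ‖F s‖ ≤ K then s * F s / K else 0
  have hu : ∀ s, ‖u s‖ ≤ 1 := fun s => by
    by_cases hs : 0 < s ∧ s * ‖F s‖ ≤ K
    · simp only [u, if_pos hs, norm_div, norm_mul, Complex.norm_real, Real.norm_eq_abs,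
        abs_of_pos hs.1, abs_of_pos hK]
      exact (div_le_one hK).2 hs.2
    · simp [u, if_neg hs]
  have h1 : funElem hM F x y =
      (K : ℂ) * funElem hM (fun s => ((s ^ (-1 : ℝ) : ℝ) : ℂ) * u s) x y := by
    rw [funElem_eq, funElem_eq, Finset.mul_sum]
    refine Finset.sum_congr rfl fun k _ => ?_
    have he : (hM.eigenvalues k : ℂ) ≠ 0 := by exact_mod_cast (hpos k).ne'
    have hK' : (K : ℂ) ≠ 0 := by exact_mod_cast hK.ne'
    simp only [u, if_pos (And.intro (hpos k) (hF k)), Real.rpow_neg_one, Complex.ofReal_inv]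
    field_simp
  have hK2 : ‖(K : ℂ)‖ₑ ^ r = ENNReal.ofReal (K ^ r) := by
    rw [← ofReal_norm, Complex.norm_real, Real.norm_of_nonneg hK.le,
      ENNReal.ofReal_rpow_of_pos hK]
  rw [h1, enorm_mul, ENNReal.mul_rpow_of_nonneg _ _ hr, hK2]
  gcongr
  exact le_iSup₂ (f := fun (u : ℝ → ℂ) (_ : ∀ s, ‖u s‖ ≤ 1) =>
    ‖funElem hM (fun s => ((s ^ (-1 : ℝ) : ℝ) : ℂ) * u s) x y‖ₑ ^ r) u hu

end FunElem

/-! ### Measurability in the random parameters -/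

section Measurability

variable {n : Type} [Fintype n] [DecidableEq n]
variable {Ω : Type*} [MeasurableSpace Ω] {M : Ω → Matrix n n ℝ}

theorem measurable_matrix_pow (hmeas : ∀ x y, Measurable fun ω => M ω x y) (j : ℕ) (x y : n) :
    Measurable fun ω => (M ω ^ j) x y := by
  induction j generalizing y with
  | zero => simp
  | succ j ih =>
    simp only [pow_succ, Matrix.mul_apply]
    exact Finset.measurable_sum _ fun z _ => (ih z).mul (hmeas z y)

/-- The chosen eigenvectors need not depend measurably on `ω`. Weierstrass approximation of `F` on
`[-j, j]` exhibits the matrix element as a pointwise limit of polynomial ones, which are measurable.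
-/
theorem measurable_funElem_ofReal (hM : ∀ ω, (M ω).IsHermitian)
    (hmeas : ∀ x y, Measurable fun ω => M ω x y) {F : ℝ → ℝ} (hF : Continuous F) (x y : n) :
    Measurable fun ω => funElem (hM ω) (fun s => (F s : ℂ)) x y := by
  have hQ : ∀ j : ℕ, ∃ Q : Polynomial ℝ, ∀ s ∈ Set.Icc (-(j : ℝ)) j,
      |Q.eval s - F s| < 1 / ((j : ℝ) + 1) := fun j =>
    exists_polynomial_near_of_continuousOn _ _ F hF.continuousOn _ (by positivity)
  choose Q hQ using hQ
  refine measurable_of_tendsto_metrizable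
    (f := fun j ω => funElem (hM ω) (fun s => (((Q j).eval s : ℝ) : ℂ)) x y) (fun j => ?_)
    (tendsto_pi_nhds.2 fun ω => tendsto_funElem (hM ω) (fun k => ?_) x y)
  · simp only [funElem_polynomial]
    refine Complex.measurable_ofReal.comp (Finset.measurable_sum _ fun i _ => ?_)
    exact (measurable_matrix_pow hmeas i x y).const_mul _
  · refine (Complex.continuous_ofReal.tendsto _).comp ?_
    rw [tendsto_iff_norm_sub_tendsto_zero]
    refine squeeze_zero' (Eventually.of_forall fun j => norm_nonneg _) ?_
      tendsto_one_div_add_atTop_nhds_zero_nat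
    filter_upwards [eventually_ge_atTop ⌈|(hM ω).eigenvalues k|⌉₊] with j hj
    have : |(hM ω).eigenvalues k| ≤ j := (Nat.le_ceil _).trans (by exact_mod_cast hj)
    exact (hQ j _ (abs_le.1 this)).le

theorem measurable_funElem (hM : ∀ ω, (M ω).IsHermitian)
    (hmeas : ∀ x y, Measurable fun ω => M ω x y) {F : ℝ → ℂ} (hF : Continuous F) (x y : n) :
    Measurable fun ω => funElem (hM ω) F x y := by
  have h : ∀ ω, funElem (hM ω) F x y = funElem (hM ω) (fun s => ((F s).re : ℂ)) x y +
      Complex.I * funElem (hM ω) (fun s => ((F s).im : ℂ)) x y := fun ω => by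
    rw [funElem_eq, funElem_eq, funElem_eq, Finset.mul_sum, ← Finset.sum_add_distrib]
    refine Finset.sum_congr rfl fun k _ => ?_
    conv_lhs => rw [← Complex.re_add_im (F _)]
    ring
  simp only [h]
  exact (measurable_funElem_ofReal hM hmeas (Complex.continuous_re.comp hF) x y).add
    ((measurable_funElem_ofReal hM hmeas (Complex.continuous_im.comp hF) x y).const_mul _)

/-- The kernels are singular at zero. Replacing `s` by `max s (1 / (j + 1))` makes the function
continuous and, for large `j`, changes nothing at a positive eigenvalue. -/
theorem aemeasurable_funElem {P : Measure Ω} (hM : ∀ ω, (M ω).IsHermitian)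
    (hmeas : ∀ x y, Measurable fun ω => M ω x y)
    (hpos : ∀ᵐ ω ∂P, ∀ k, 0 < (hM ω).eigenvalues k) {F : ℝ → ℂ}
    (hF : ContinuousOn F (Set.Ioi 0)) (x y : n) :
    AEMeasurable (fun ω => funElem (hM ω) F x y) P := by
  have hcont : ∀ j : ℕ, Continuous fun s => F (max s (1 / ((j : ℝ) + 1))) := fun j => by
    refine hF.comp_continuous (by fun_prop) fun s => ?_
    have : (0 : ℝ) < 1 / ((j : ℝ) + 1) := by positivity
    exact lt_max_of_lt_right this
  have hj : ∀ j : ℕ, Measurable fun ω =>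
      funElem (hM ω) (fun s => F (max s (1 / ((j : ℝ) + 1)))) x y := fun j =>
    measurable_funElem hM hmeas (hcont j) x y
  refine aemeasurable_of_tendsto_metrizable_ae' (fun j => (hj j).aemeasurable) ?_
  filter_upwards [hpos] with ω hω
  refine tendsto_funElem (G := fun (j : ℕ) s => F (max s (1 / ((j : ℝ) + 1)))) (hM ω)
    (fun k => ?_) x y
  have key : ∀ᶠ j : ℕ in atTop, F (max ((hM ω).eigenvalues k) (1 / ((j : ℝ) + 1))) =
      F ((hM ω).eigenvalues k) := by
    filter_upwards [(tendsto_one_div_add_atTop_nhds_zero_nat (𝕜 := ℝ)).eventually_lt_const (hω k)]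
      with j hj
    rw [max_eq_left hj.le]
  exact (tendsto_congr' key).2 tendsto_const_nhds

theorem iSup_eq_iSup_rat {φ : ℝ → ℝ≥0∞} (hφ : Continuous φ) : ⨆ t, φ t = ⨆ q : ℚ, φ q := by
  refine le_antisymm (iSup_le fun t => ?_) (iSup_le fun q => le_iSup φ q)
  have hcl : IsClosed {t | φ t ≤ ⨆ q : ℚ, φ q} := isClosed_le hφ continuous_const
  have hd : ∀ t, t ∈ {t | φ t ≤ ⨆ q : ℚ, φ q} := fun t =>
    Rat.denseRange_cast.induction_on (p := fun t => t ∈ {t | φ t ≤ ⨆ q : ℚ, φ q}) t hcl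
      fun q => le_iSup (fun q : ℚ => φ q) q
  exact hd t

theorem rpow_sum_le_sum_rpow {ι : Type*} (s : Finset ι) (a : ι → ℝ≥0∞) {r : ℝ} (hr0 : 0 < r)
    (hr1 : r ≤ 1) : (∑ i ∈ s, a i) ^ r ≤ ∑ i ∈ s, a i ^ r :=
  Finset.le_sum_of_subadditive (fun b : ℝ≥0∞ => b ^ r) (ENNReal.zero_rpow_of_pos hr0).le
    (fun b c => ENNReal.rpow_add_le_add_rpow b c hr0.le hr1) s a

end Measurability

/-! ### Deterministic bounds, uniform in the box -/

section Bounds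

variable {d : ℕ} {p : Params d} {L : ℕ} {mmin mmax kmax lmax : ℝ}

/-- A crude count: displacements to neighbors lie in `{-1, 0, 1}^d`. Only independence of `L`
matters. -/
theorem card_neighbors_le (x : box d L) :
    (Finset.univ.filter fun y : box d L => dist₁ (x : Fin d → ℤ) y = 1).card ≤ 3 ^ d := by
  have h : (Fintype.piFinset fun _ : Fin d => Finset.Icc (-1 : ℤ) 1).card = 3 ^ d := by simp
  rw [← h]
  refine Finset.card_le_card_of_injOn (fun y i => (x : Fin d → ℤ) i - (y : Fin d → ℤ) i)
    (fun y hy => ?_) (fun y _ y' _ hyy => ?_)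
  · rw [Finset.mem_coe, Fintype.mem_piFinset]
    intro i
    have h1 : |(x : Fin d → ℤ) i - (y : Fin d → ℤ) i| ≤ dist₁ (x : Fin d → ℤ) y :=
      Finset.single_le_sum (f := fun i => |(x : Fin d → ℤ) i - (y : Fin d → ℤ) i|)
        (fun j _ => abs_nonneg _) (Finset.mem_univ i)
    have h2 : dist₁ (x : Fin d → ℤ) y = 1 := by simpa using hy
    rw [h2] at h1
    exact Finset.mem_Icc.2 (abs_le.1 h1)
  · refine Subtype.ext (funext fun i => ?_)
    have := congrFun hyy i
    simp only at this
    linarith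

theorem edgeWeight_nonneg (hb : p.Bounded mmin mmax kmax lmax) (x y : box d L) :
    0 ≤ edgeWeight p L x y := by
  unfold edgeWeight
  split_ifs with h
  · exact (hb.lam_mem _ _ h).1
  · exact le_rfl

/-- `max lmax 0` keeps the bound nonnegative without a sign condition on `lmax`. -/
theorem sum_edgeWeight_le (hb : p.Bounded mmin mmax kmax lmax) (x : box d L) :
    ∑ y, edgeWeight p L x y ≤ 3 ^ d * max lmax 0 := by
  calc ∑ y, edgeWeight p L x y ≤
        ∑ y : box d L, if dist₁ (x : Fin d → ℤ) y = 1 then max lmax 0 else 0 := by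
        refine Finset.sum_le_sum fun y _ => ?_
        unfold edgeWeight
        split_ifs with h
        · exact (hb.lam_mem _ _ h).2.trans (le_max_left _ _)
        · exact le_rfl
    _ = (Finset.univ.filter fun y : box d L => dist₁ (x : Fin d → ℤ) y = 1).card *
          max lmax 0 := by
        rw [← Finset.sum_filter, Finset.sum_const, nsmul_eq_mul]
    _ ≤ 3 ^ d * max lmax 0 := by
        gcongr
        exact_mod_cast card_neighbors_le x

/-- A bound on the norm of the one-particle operators. -/
def spectralBound (d : ℕ) (mmin kmax lmax : ℝ) : ℝ :=
  1 / (2 * mmin) * (kmax / 2 + 2 * (3 ^ d * max lmax 0))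

theorem sum_abs_hOne_le (hmin : 0 < mmin) (hb : p.Bounded mmin mmax kmax lmax) (x : box d L) :
    ∑ y, |hOne p L x y| ≤ spectralBound d mmin kmax lmax := by
  have h1 : ∀ y, |hOne p L x y| ≤ 1 / (2 * mmin) *
      ((if x = y then p.k x / 2 + ∑ u, edgeWeight p L x u else 0) + edgeWeight p L x y) :=
    fun y => by
      have h2 : |h₀ p L x y| ≤
          (if x = y then p.k x / 2 + ∑ u, edgeWeight p L x u else 0) + edgeWeight p L x y := by
        rw [h₀_apply]
        refine (abs_sub _ _).trans ?_
        rw [abs_of_nonneg (edgeWeight_nonneg hb x y), abs_of_nonneg]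
        split_ifs
        · have := (hb.k_mem x).1
          exact add_nonneg (by linarith) (Finset.sum_nonneg fun u _ => edgeWeight_nonneg hb x u)
        · exact le_rfl
      rw [hOne_apply, abs_mul, abs_mul, abs_of_nonneg (Real.sqrt_nonneg _),
        abs_of_nonneg (Real.sqrt_nonneg _)]
      calc _ ≤ √(1 / (2 * mmin)) * |h₀ p L x y| * √(1 / (2 * mmin)) := by
            gcongr
            · exact (hb.m_mem x).1
            · exact (hb.m_mem y).1
        _ = 1 / (2 * mmin) * |h₀ p L x y| := by
            rw [mul_right_comm, Real.mul_self_sqrt (by positivity)]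
        _ ≤ _ := by gcongr
  refine (Finset.sum_le_sum fun y _ => h1 y).trans ?_
  rw [← Finset.mul_sum, Finset.sum_add_distrib, Finset.sum_ite_eq, if_pos (Finset.mem_univ x),
    spectralBound]
  have h3 := sum_edgeWeight_le hb x
  have h4 := (hb.k_mem x).2
  exact mul_le_mul_of_nonneg_left (by linarith) (by positivity)

/-- A bound on the weights `√(1/(2m))` and `√(2m)`. -/
def weightBound (mmin mmax : ℝ) : ℝ := √(1 / (2 * mmin)) + √(2 * mmax)

theorem abs_coupling_le (hmin : 0 < mmin) (hb : p.Bounded mmin mmax kmax lmax)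
    (f g : box d L → ℂ) (i : Fin 3) (x y : box d L) :
    |coupling p L f g i x y| ≤ 2 * weightBound mmin mmax ^ 2 * (‖f x‖ * ‖g y‖) := by
  set c := weightBound mmin mmax
  have hc : 0 ≤ c := by
    have : c = √(1 / (2 * mmin)) + √(2 * mmax) := rfl
    rw [this]
    positivity
  have h1 : ∀ x : box d L, √(1 / (2 * p.m x)) ≤ c := fun x => by
    have := (hb.m_mem x).1
    refine le_trans (Real.sqrt_le_sqrt ?_) (le_add_of_nonneg_right (Real.sqrt_nonneg _))
    gcongr
  have h2 : ∀ x : box d L, √(2 * p.m x) ≤ c := fun x => by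
    have := (hb.m_mem x).2
    refine le_trans (Real.sqrt_le_sqrt ?_) (le_add_of_nonneg_left (Real.sqrt_nonneg _))
    gcongr
  have hre : ∀ (f : box d L → ℂ) (x : box d L), |√(1 / (2 * p.m x)) * (f x).re| ≤ c * ‖f x‖ :=
    fun f x => by
      rw [abs_mul, abs_of_nonneg (Real.sqrt_nonneg _)]
      exact mul_le_mul (h1 x) (Complex.abs_re_le_norm _) (abs_nonneg _) hc
  have him : ∀ (f : box d L → ℂ) (x : box d L), |√(2 * p.m x) * (f x).im| ≤ c * ‖f x‖ :=
    fun f x => by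
      rw [abs_mul, abs_of_nonneg (Real.sqrt_nonneg _)]
      exact mul_le_mul (h2 x) (Complex.abs_im_le_norm _) (abs_nonneg _) hc
  have hprod : ∀ a b : ℝ, |a| ≤ c * ‖f x‖ → |b| ≤ c * ‖g y‖ →
      |a * b| ≤ c ^ 2 * (‖f x‖ * ‖g y‖) := fun a b ha hb => by
    rw [abs_mul]
    calc |a| * |b| ≤ (c * ‖f x‖) * (c * ‖g y‖) := by gcongr
      _ = _ := by ring
  have hnn : 0 ≤ c ^ 2 * (‖f x‖ * ‖g y‖) := by positivity
  fin_cases i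
  · exact (hprod _ _ (hre f x) (hre g y)).trans (by linarith)
  · exact (hprod _ _ (him f x) (him g y)).trans (by linarith)
  · refine (abs_sub _ _).trans ?_
    have h3 := hprod _ _ (hre f x) (him g y)
    have h4 := hprod _ _ (him f x) (hre g y)
    linarith

end Bounds

/-! ### Measurability of the matrix and of the couplings -/

section Randomness

variable {d : ℕ} {Ω : Type*} [MeasurableSpace Ω] {p : Ω → Params d}

theorem measurable_hOne (hm : ∀ x, Measurable fun ω => (p ω).m x)
    (hk : ∀ x, Measurable fun ω => (p ω).k x)
    (hlam : ∀ x y, dist₁ x y = 1 → Measurable fun ω => (p ω).lam s(x, y)) (L : ℕ)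
    (x y : box d L) : Measurable fun ω => hOne (p ω) L x y := by
  have hs : ∀ x : box d L, Measurable fun ω => √(1 / (2 * (p ω).m x)) := fun x =>
    (((hm x).const_mul 2).const_div 1).sqrt
  have he : ∀ x y : box d L, Measurable fun ω => edgeWeight (p ω) L x y := fun x y => by
    unfold edgeWeight
    split_ifs with h
    · exact hlam _ _ h
    · exact measurable_const
  simp only [hOne_apply, h₀_apply]
  refine ((hs x).mul (Measurable.sub ?_ (he x y))).mul (hs y)
  split_ifs
  · exact ((hk x).div_const 2).add (Finset.measurable_sum _ fun u _ => he x u)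
  · exact measurable_const

theorem measurable_coupling (hm : ∀ x, Measurable fun ω => (p ω).m x) {L : ℕ}
    (f g : box d L → ℂ) (i : Fin 3) (x y : box d L) :
    Measurable fun ω => coupling (p ω) L f g i x y := by
  have h1 : ∀ x : box d L, Measurable fun ω => √(1 / (2 * (p ω).m x)) := fun x =>
    (((hm x).const_mul 2).const_div 1).sqrt
  have h2 : ∀ x : box d L, Measurable fun ω => √(2 * (p ω).m x) := fun x =>
    ((hm x).const_mul 2).sqrt
  have h1' : ∀ (x : box d L) (c : ℝ), Measurable fun ω => √(1 / (2 * (p ω).m x)) * c :=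
    fun x c => (h1 x).mul_const c
  have h2' : ∀ (x : box d L) (c : ℝ), Measurable fun ω => √(2 * (p ω).m x) * c :=
    fun x c => (h2 x).mul_const c
  unfold coupling
  fin_cases i
  · exact (h1' x _).mul (h1' y _)
  · exact (h2' x _).mul (h2' y _)
  · exact ((h1' x _).mul (h2' y _)).sub ((h2' x _).mul (h1' y _))

end Randomness

/-! ### Expected supremum of the thermal correlation -/

section Decay

variable {d : ℕ} {Ω : Type*} [MeasurableSpace Ω] {P : Measure Ω} {p : Ω → Params d}
  {L : ℕ} {β : ℝ}

theorem continuous_thermalCorr {p : Params d} (hm : ∀ x : box d L, 0 < p.m x)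
    (h : (h₀ p L).PosDef) (hβ : 0 < β) (f g : box d L → ℂ) :
    Continuous fun t => thermalCorr p L β f g t := by
  simp only [thermalCorr_eq hm h hβ]
  have := continuous_twoPoint (p := p) (β := β) (zetaCoeff p L f) (zetaCoeff p L g)
  fun_prop

/-- The supremum over rational times of the moments of the two-point kernels. -/
def kernelSup (p : Params d) (L : ℕ) (β r : ℝ) (i : Fin 3) (x y : box d L) : ℝ≥0∞ :=
  ⨆ q : ℚ, ‖funElem (hOne_isHermitian p L) (kernel β q i) x y‖ₑ ^ r

theorem aemeasurable_funElem_kernel (hm : ∀ x, Measurable fun ω => (p ω).m x)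
    (hk : ∀ x, Measurable fun ω => (p ω).k x)
    (hlam : ∀ x y, dist₁ x y = 1 → Measurable fun ω => (p ω).lam s(x, y))
    (hpos : ∀ᵐ ω ∂P, (∀ x : box d L, 0 < (p ω).m x) ∧ (h₀ (p ω) L).PosDef) (hβ : 0 < β)
    (t : ℝ) (i : Fin 3) (x y : box d L) :
    AEMeasurable (fun ω => funElem (hOne_isHermitian (p ω) L) (kernel β t i) x y) P := by
  refine aemeasurable_funElem (fun ω => hOne_isHermitian (p ω) L)
    (measurable_hOne hm hk hlam L) ?_ (continuousOn_kernel hβ t i) x y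
  filter_upwards [hpos] with ω hω
  exact (posDef_hOne hω.1 hω.2).eigenvalues_pos

theorem aemeasurable_twoPoint (hm : ∀ x, Measurable fun ω => (p ω).m x)
    (hk : ∀ x, Measurable fun ω => (p ω).k x)
    (hlam : ∀ x y, dist₁ x y = 1 → Measurable fun ω => (p ω).lam s(x, y))
    (hpos : ∀ᵐ ω ∂P, (∀ x : box d L, 0 < (p ω).m x) ∧ (h₀ (p ω) L).PosDef) (hβ : 0 < β)
    (f g : box d L → ℂ) (t : ℝ) : AEMeasurable (fun ω => twoPoint (p ω) L β
      (evolve (p ω) L t (zetaCoeff (p ω) L f)) (zetaCoeff (p ω) L g)) P := by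
  have h1 : AEMeasurable (fun ω => ∑ i, ∑ x, ∑ y, (coupling (p ω) L f g i x y : ℂ) *
      funElem (hOne_isHermitian (p ω) L) (kernel β t i) x y) P := by
    refine Finset.aemeasurable_fun_sum _ fun i _ => Finset.aemeasurable_fun_sum _ fun x _ =>
      Finset.aemeasurable_fun_sum _ fun y _ => ?_
    exact (Complex.measurable_ofReal.comp (measurable_coupling hm f g i x y)).aemeasurable.mul
      (aemeasurable_funElem_kernel hm hk hlam hpos hβ t i x y)
  refine h1.congr ?_
  filter_upwards [hpos] with ω hω
  exact (twoPoint_eq hω.1 hω.2 f g t).symm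

theorem aemeasurable_thermalCorr (hm : ∀ x, Measurable fun ω => (p ω).m x)
    (hk : ∀ x, Measurable fun ω => (p ω).k x)
    (hlam : ∀ x y, dist₁ x y = 1 → Measurable fun ω => (p ω).lam s(x, y))
    (hpos : ∀ᵐ ω ∂P, (∀ x : box d L, 0 < (p ω).m x) ∧ (h₀ (p ω) L).PosDef) (hβ : 0 < β)
    (f g : box d L → ℂ) (t : ℝ) : AEMeasurable (fun ω => thermalCorr (p ω) L β f g t) P := by
  have h1 := aemeasurable_twoPoint hm hk hlam hpos hβ
  have h2 : AEMeasurable (fun ω => Complex.exp (-((twoPoint (p ω) L β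
      (evolve (p ω) L 0 (zetaCoeff (p ω) L f)) (zetaCoeff (p ω) L f) + twoPoint (p ω) L β
      (evolve (p ω) L 0 (zetaCoeff (p ω) L g)) (zetaCoeff (p ω) L g)) / 2)) *
      (Complex.exp (-twoPoint (p ω) L β (evolve (p ω) L t (zetaCoeff (p ω) L f))
        (zetaCoeff (p ω) L g)) - 1)) P :=
    (Complex.measurable_exp.comp_aemeasurable (((h1 f f 0).add (h1 g g 0)).div_const 2).neg).mul
      ((Complex.measurable_exp.comp_aemeasurable (h1 f g t).neg).sub_const 1)
  refine h2.congr ?_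
  filter_upwards [hpos] with ω hω
  rw [thermalCorr_eq hω.1 hω.2 hβ, Complex.ofReal_add, thermalNormSq_eq, thermalNormSq_eq]

theorem aemeasurable_iSup_thermalCorr (hm : ∀ x, Measurable fun ω => (p ω).m x)
    (hk : ∀ x, Measurable fun ω => (p ω).k x)
    (hlam : ∀ x y, dist₁ x y = 1 → Measurable fun ω => (p ω).lam s(x, y))
    (hpos : ∀ᵐ ω ∂P, (∀ x : box d L, 0 < (p ω).m x) ∧ (h₀ (p ω) L).PosDef) (hβ : 0 < β)
    (f g : box d L → ℂ) : AEMeasurable (fun ω => ⨆ t : ℝ, ‖thermalCorr (p ω) L β f g t‖ₑ) P := by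
  have h1 : AEMeasurable (fun ω => ⨆ q : ℚ, ‖thermalCorr (p ω) L β f g q‖ₑ) P :=
    AEMeasurable.iSup fun q => (aemeasurable_thermalCorr hm hk hlam hpos hβ f g q).enorm
  refine h1.congr ?_
  filter_upwards [hpos] with ω hω
  exact (iSup_eq_iSup_rat (continuous_thermalCorr hω.1 hω.2 hβ f g).enorm).symm

/-- For `0 < r ≤ 1`, `min(2, x) ≤ 2 x^r`: if `x ≤ 1` then `x ≤ x^r`, and otherwise `x^r ≥ 1`.
Subadditivity of the power then distributes it over the sum for `z`. -/
theorem enorm_thermalCorr_le {p : Params d} (hm : ∀ x : box d L, 0 < p.m x)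
    (h : (h₀ p L).PosDef) (hβ : 0 < β) {r : ℝ} (hr0 : 0 < r) (hr1 : r ≤ 1) (f g : box d L → ℂ)
    (t : ℝ) : ‖thermalCorr p L β f g t‖ₑ ≤ 2 * ∑ i, ∑ x, ∑ y,
      ‖coupling p L f g i x y‖ₑ ^ r *
        ‖funElem (hOne_isHermitian p L) (kernel β t i) x y‖ₑ ^ r := by
  obtain ⟨h2, hz⟩ := norm_thermalCorr_le hm h hβ f g t
  set z := twoPoint p L β (evolve p L t (zetaCoeff p L f)) (zetaCoeff p L g) with hzdef
  have h3 : ‖thermalCorr p L β f g t‖ ≤ 2 * ‖z‖ ^ r := by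
    by_cases h1 : ‖z‖ ≤ 1
    · have h4 : ‖z‖ ≤ ‖z‖ ^ r := by
        rcases (norm_nonneg z).eq_or_lt with h0 | h0
        · rw [← h0]
          positivity
        · simpa using Real.rpow_le_rpow_of_exponent_ge h0 h1 hr1
      linarith [norm_nonneg z]
    · have h4 : 1 ≤ ‖z‖ ^ r := Real.one_le_rpow (not_le.1 h1).le hr0.le
      linarith
  have h4 : ‖thermalCorr p L β f g t‖ₑ ≤ 2 * ‖z‖ₑ ^ r := by
    rw [← ofReal_norm, ← ofReal_norm, ENNReal.ofReal_rpow_of_nonneg (norm_nonneg _) hr0.le,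
      ← ENNReal.ofReal_ofNat, ← ENNReal.ofReal_mul (by norm_num)]
    exact ENNReal.ofReal_le_ofReal h3
  refine h4.trans ?_
  gcongr
  rw [hzdef, twoPoint_eq hm h]
  have hsum : ∀ {ι : Type} (s : Finset ι) (a : ι → ℂ),
      ‖∑ i ∈ s, a i‖ₑ ^ r ≤ ∑ i ∈ s, ‖a i‖ₑ ^ r := fun s a =>
    (ENNReal.rpow_le_rpow (enorm_sum_le s a) hr0.le).trans (rpow_sum_le_sum_rpow s _ hr0 hr1)
  refine (hsum _ _).trans (Finset.sum_le_sum fun i _ => (hsum _ _).trans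
    (Finset.sum_le_sum fun x _ => (hsum _ _).trans (Finset.sum_le_sum fun y _ => le_of_eq ?_)))
  rw [enorm_mul, ENNReal.mul_rpow_of_nonneg _ _ hr0.le]
  congr 2
  rw [← ofReal_norm, ← ofReal_norm, Complex.norm_real]

/-- The constant is the same for all times and the time dependence sits entirely in `u`, so the
supremum over `u` inside the correlator absorbs the supremum over `t`. -/
theorem lintegral_kernelSup_le {mmin mmax kmax lmax : ℝ} (hmin : 0 < mmin)
    (hb : ∀ᵐ ω ∂P, (p ω).Bounded mmin mmax kmax lmax)
    (hpos : ∀ᵐ ω ∂P, (∀ x : box d L, 0 < (p ω).m x) ∧ (h₀ (p ω) L).PosDef) (hβ : 0 < β)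
    {r Γ : ℝ} (hr0 : 0 < r) (hΓ : 1 ≤ Γ) (hΓR : spectralBound d mmin kmax lmax ≤ Γ)
    (i : Fin 3) (x y : box d L) :
    ∫⁻ ω, kernelSup (p ω) L β r i x y ∂P ≤ ENNReal.ofReal ((Γ ^ 2 * (Γ + 1 / β)) ^ r) *
      ∫⁻ ω, ⨆ (u : ℝ → ℂ) (_ : ∀ s, ‖u s‖ ≤ 1),
        ‖funElem (hOne_isHermitian (p ω) L)
          (fun s => ((s ^ (-1 : ℝ) : ℝ) : ℂ) * u s) x y‖ₑ ^ r ∂P := by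
  rw [← lintegral_const_mul' _ _ ENNReal.ofReal_ne_top]
  refine lintegral_mono_ae ?_
  filter_upwards [hb, hpos] with ω hbω hω
  have hev := (posDef_hOne hω.1 hω.2).eigenvalues_pos
  refine iSup_le fun q => enorm_funElem_rpow_le (hOne_isHermitian (p ω) L) (by positivity) hr0.le
    hev (fun k => mul_norm_kernel_le hβ q i (hev k) hΓ ?_) x y
  have h1 := eigenvalues_le (hOne_isHermitian (p ω) L) (sum_abs_hOne_le hmin hbω) k
  nlinarith

/-- The bound on the expected supremum of the thermal correlations by eigenfunction correlators. -/
theorem lintegral_iSup_thermalCorr_le (hm : ∀ x, Measurable fun ω => (p ω).m x)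
    (hk : ∀ x, Measurable fun ω => (p ω).k x)
    (hlam : ∀ x y, dist₁ x y = 1 → Measurable fun ω => (p ω).lam s(x, y))
    {mmin mmax kmax lmax : ℝ} (hmin : 0 < mmin)
    (hb : ∀ᵐ ω ∂P, (p ω).Bounded mmin mmax kmax lmax)
    (hpos : ∀ᵐ ω ∂P, (∀ x : box d L, 0 < (p ω).m x) ∧ (h₀ (p ω) L).PosDef) (hβ : 0 < β)
    {r Γ : ℝ} (hr0 : 0 < r) (hr1 : r ≤ 1) (hΓ : 1 ≤ Γ)
    (hΓR : spectralBound d mmin kmax lmax ≤ Γ) {ρ : box d L → box d L → ℝ}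
    (hρ : ∀ x y, 0 ≤ ρ x y)
    (hcorr : ∀ x y : box d L, ∫⁻ ω, ⨆ (u : ℝ → ℂ) (_ : ∀ s, ‖u s‖ ≤ 1),
        ‖funElem (hOne_isHermitian (p ω) L)
          (fun s => ((s ^ (-1 : ℝ) : ℝ) : ℂ) * u s) x y‖ₑ ^ r ∂P ≤ ENNReal.ofReal (ρ x y))
    (f g : box d L → ℂ) :
    ∫⁻ ω, ⨆ t : ℝ, ‖thermalCorr (p ω) L β f g t‖ₑ ∂P ≤
      ENNReal.ofReal (6 * (2 * weightBound mmin mmax ^ 2) ^ r * (Γ ^ 2 * (Γ + 1 / β)) ^ r *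
        ∑ x, ∑ y, ‖f x‖ ^ r * ‖g y‖ ^ r * ρ x y) := by
  set c := 2 * weightBound mmin mmax ^ 2 with hc
  have hc0 : 0 ≤ c := by positivity
  set K := Γ ^ 2 * (Γ + 1 / β) with hKdef
  have hK0 : 0 ≤ K := by positivity
  have hmeas : ∀ i x y, AEMeasurable (fun ω => kernelSup (p ω) L β r i x y) P := fun i x y =>
    AEMeasurable.iSup fun q =>
      (aemeasurable_funElem_kernel hm hk hlam hpos hβ q i x y).enorm.pow_const r
  have hpt : ∀ᵐ ω ∂P, ⨆ t : ℝ, ‖thermalCorr (p ω) L β f g t‖ₑ ≤ 2 * ∑ i, ∑ x, ∑ y,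
      ENNReal.ofReal ((c * (‖f x‖ * ‖g y‖)) ^ r) * kernelSup (p ω) L β r i x y := by
    filter_upwards [hb, hpos] with ω hbω hω
    rw [iSup_eq_iSup_rat (continuous_thermalCorr hω.1 hω.2 hβ f g).enorm]
    refine iSup_le fun q => (enorm_thermalCorr_le hω.1 hω.2 hβ hr0 hr1 f g q).trans ?_
    gcongr with i _ x _ y _
    · rw [← ofReal_norm, ENNReal.ofReal_rpow_of_nonneg (norm_nonneg _) hr0.le]
      refine ENNReal.ofReal_le_ofReal (Real.rpow_le_rpow (norm_nonneg _) ?_ hr0.le)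
      exact abs_coupling_le hmin hbω f g i x y
    · exact le_iSup (fun q : ℚ =>
        ‖funElem (hOne_isHermitian (p ω) L) (kernel β q i) x y‖ₑ ^ r) q
  refine (lintegral_mono_ae hpt).trans ?_
  rw [lintegral_const_mul' _ _ (by norm_num), lintegral_finsetSum' _ fun i _ =>
    Finset.aemeasurable_fun_sum _ fun x _ => Finset.aemeasurable_fun_sum _ fun y _ =>
      (hmeas i x y).const_mul _]
  have hi : ∀ i, ∫⁻ ω, ∑ x, ∑ y, ENNReal.ofReal ((c * (‖f x‖ * ‖g y‖)) ^ r) *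
      kernelSup (p ω) L β r i x y ∂P ≤
      ENNReal.ofReal (∑ x, ∑ y, c ^ r * K ^ r * (‖f x‖ ^ r * ‖g y‖ ^ r * ρ x y)) := fun i => by
    rw [lintegral_finsetSum' _ fun x _ => Finset.aemeasurable_fun_sum _ fun y _ =>
      (hmeas i x y).const_mul _, ENNReal.ofReal_sum_of_nonneg fun x _ =>
        Finset.sum_nonneg fun y _ => by have := hρ x y; positivity]
    refine Finset.sum_le_sum fun x _ => ?_
    rw [lintegral_finsetSum' _ fun y _ => (hmeas i x y).const_mul _,
      ENNReal.ofReal_sum_of_nonneg fun y _ => by have := hρ x y; positivity]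
    refine Finset.sum_le_sum fun y _ => ?_
    rw [lintegral_const_mul' _ _ ENNReal.ofReal_ne_top]
    calc _ ≤ ENNReal.ofReal ((c * (‖f x‖ * ‖g y‖)) ^ r) *
          (ENNReal.ofReal (K ^ r) * ENNReal.ofReal (ρ x y)) := by
          gcongr
          refine (lintegral_kernelSup_le hmin hb hpos hβ hr0 hΓ hΓR i x y).trans ?_
          gcongr
          exact hcorr x y
      _ = _ := by
          rw [← ENNReal.ofReal_mul (by positivity), ← ENNReal.ofReal_mul (by positivity),
            Real.mul_rpow hc0 (by positivity), Real.mul_rpow (norm_nonneg _) (norm_nonneg _)]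
          congr 1
          ring
  -- The constant `6` is the `2` of `enorm_thermalCorr_le` times the number of kernels.
  calc _ ≤ 2 * ∑ _i : Fin 3,
        ENNReal.ofReal (∑ x, ∑ y, c ^ r * K ^ r * (‖f x‖ ^ r * ‖g y‖ ^ r * ρ x y)) := by
        gcongr with i _
        exact hi i
    _ = _ := by
        rw [Finset.sum_const, Finset.card_univ, Fintype.card_fin, nsmul_eq_mul]
        simp only [← Finset.mul_sum]
        rw [← ENNReal.ofReal_ofNat 2, Nat.cast_ofNat, ← ENNReal.ofReal_ofNat 3,
          ← ENNReal.ofReal_mul (by norm_num), ← ENNReal.ofReal_mul (by norm_num)]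
        congr 1
        ring

end Decay

end HarmonicOscillators

end

/-! ### The main theorem -/

open HarmonicOscillators in
theorem theorem5p1 {d : ℕ} (hd : 1 ≤ d)
    {Ω : Type*} [MeasurableSpace Ω] (P : Measure Ω) [IsProbabilityMeasure P]
    (p : Ω → Params d)
    (hm : ∀ x, Measurable fun ω => (p ω).m x)
    (hk : ∀ x, Measurable fun ω => (p ω).k x)
    (hlam : ∀ x y, dist₁ x y = 1 → Measurable fun ω => (p ω).lam s(x, y))
    (mmin mmax kmax lmax : ℝ) (hmmin : 0 < mmin)
    (hA1 : ∀ᵐ ω ∂P, (p ω).Bounded mmin mmax kmax lmax)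
    (hA2 : ∀ L : ℕ, 1 ≤ L → ∀ᵐ ω ∂P, (h₀ (p ω) L).PosDef)
    (β : ℝ) (hβ : 0 < β)
    (r : ℝ) (hr0 : 0 < r) (hr1 : r ≤ 1)
    (hcorr : ExpDecayCorrelators P p (-1) r) :
    ∃ C' μ' : ℝ, 0 < μ' ∧ ∀ L : ℕ, 1 ≤ L → ∀ f g : box d L → ℂ,
      AEMeasurable (fun ω => ⨆ t : ℝ, ‖thermalCorr (p ω) L β f g t‖ₑ) P ∧
      ∫⁻ ω, ⨆ t : ℝ, ‖thermalCorr (p ω) L β f g t‖ₑ ∂P ≤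
        ENNReal.ofReal (C' * ∑ x : box d L, ∑ y : box d L,
          ‖f x‖ ^ r * ‖g y‖ ^ r * Real.exp (-μ' * dist₁ (x : Fin d → ℤ) y)) := by
  obtain ⟨C, η, hη, hC⟩ := hcorr
  -- With `Γ ≥ 1`, a bound `s ≤ Γ` on the spectrum also gives `s ≤ Γ²`, the form used for the
  -- kernels.
  set Γ := max 1 (spectralBound d mmin kmax lmax) with hΓ
  -- The decay rate `η` of the correlators is kept unchanged. `C` carries no sign condition, hence
  -- `max C 0`.
  refine ⟨6 * (2 * weightBound mmin mmax ^ 2) ^ r * (Γ ^ 2 * (Γ + 1 / β)) ^ r * max C 0, η, hη,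
    fun L hL f g => ?_⟩
  have hpos : ∀ᵐ ω ∂P, (∀ x : box d L, 0 < (p ω).m x) ∧ (h₀ (p ω) L).PosDef := by
    filter_upwards [hA1, hA2 L hL] with ω h1 h2
    exact ⟨fun x => hmmin.trans_le (h1.m_mem x).1, h2⟩
  refine ⟨aemeasurable_iSup_thermalCorr hm hk hlam hpos hβ f g, ?_⟩
  refine (lintegral_iSup_thermalCorr_le hm hk hlam hmmin hA1 hpos hβ hr0 hr1 (le_max_left _ _)
    (le_max_right _ _)
    (ρ := fun x y => max C 0 * Real.exp (-η * dist₁ (x : Fin d → ℤ) y))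
    (fun x y => by positivity) (fun x y => (hC L hL x y).trans
      (ENNReal.ofReal_le_ofReal (by gcongr; exact le_max_left _ _))) f g).trans (le_of_eq ?_)
  rw [← hΓ]
  congr 1
  rw [mul_assoc _ (max C 0), Finset.mul_sum (a := max C 0)]
  congr 1
  refine Finset.sum_congr rfl fun x _ => ?_
  rw [Finset.mul_sum]
  exact Finset.sum_congr rfl fun y _ => by ring
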